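/- **Proposition (weak dependence on the soft edges, local version).** Let $-\infty\le b_-<b_+\le+\infty$, $\beta>0$, and let $V:[b_-,b_+]\to\mathbb R$ be continuous (here $[b_-,b_+]$ denotes $\{x\in\mathbb R: b_-\le x\le b_+\}$). If $b_\tau=\tau\infty$ for $\tau\in\{+,-\}$, assume that $\liminf_{x\to\tau\infty}\frac{V(x)}{2\ln|x|}>1$. For an interval $I\subseteq[b_-,b_+]$ set $$Z_{N}^{V;I}=\int_{I^N}\prod_{i=1}^N e^{-\frac{N\beta}{2}V(\lambda_i)}\prod_{i<j}|\lambda_i-\lambda_j|^\beta\,\prod_{i=1}^N\mathrm d\lambda_i ,$$ let $\mu_N^{V;I}$ be the probability measure on $I^N$ whose density is this integrand divided by $Z_N^{V;I}$, and let the correlator $W_n^{V;I}(x_1,\dots,x_n)$ be the joint cumulant under $\mu_N^{V;I}$ of the $n$ random variables $\sum_{i=1}^N\frac1{x_j-\lambda_i}$, $1\le j\le n$. Let $\mu_{\mathrm{eq}}$ be the equilibrium measure, i.e. the probability measure on $[b_-,b_+]$ minimizing $\int V\,\mathrm d\mu-\iint\ln|\xi-\eta|\,\mathrm d\mu(\xi)\mathrm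 d\mu(\eta)$, let $\alpha_-$ and $\alpha_+$ be the smallest and the largest point of its (compact) support, and let $\mathcal J(x)=\frac{V(x)}2-\int\ln|x-\xi|\,\mathrm d\mu_{\mathrm{eq}}(\xi)$ for $x\in[b_-,b_+]$. Assume that the minimum value of $\mathcal J$ on $[b_-,b_+]$ is achieved only at points of $[\alpha_-,\alpha_+]$. Then for every $\varepsilon>0$ there exist $\eta_\varepsilon>0$ and an integer $N_0$ such that for all $N\ge N_0$ and all real $a_-$ with $b_-<a_-<\alpha_--\varepsilon$, the measure $\mu_N^{V;[a_-,b_+]}$ is well defined ($0<Z_N^{V;[a_-,b_+]}<\infty$), $\ln Z_N^{V;[a_-,b_+]}$ is differentiable in $a_-$, and $$\left|\partial_{a_-}\ln Z_N^{V;[a_-,b_+]}\right|\le e^{-N\eta_\varepsilon};$$ moreover, for all $n\ge1$ and all $x_1,\dots,x_n\in\mathbb C\setminus[a_-,b_+]$, $W_n^{V;[a_-,b_+]}(x_1,\dots,x_n)$ is differentiable in $a_-$, and $$\left|\partial_{a_-}W_n^{V;[a_-,b_+]}(x_1,\dots,x_n)\right|\le\frac{\gamma_n\,N^n}{\prod_{i=1}^n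 d(x_i,[a_-,b_+])}\,e^{-N\eta_\varepsilon},$$ where $\gamma_n>0$ is a universal constant depending only on $n$. The same holds at the upper edge: for all real $a_+$ with $\alpha_++\varepsilon<a_+<b_+$, with $[a_-,b_+]$ replaced by $[b_-,a_+]$ and $\partial_{a_-}$ by $\partial_{a_+}$. -/

import Mathlib

open MeasureTheory Filter Set

noncomputable section

namespace BetaEnsemble

/-- The real interval `[b, c]`, whose end points may be infinite. -/
def interval (b c : EReal) : Set ℝ := {x : ℝ | b ≤ (x : EReal) ∧ (x : EReal) ≤ c}

/-- The weight `∏ᵢ exp(-(Nβ/2) V(λᵢ)) ∏_{i<j} |λᵢ - λⱼ|^β`. -/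
def weight (N : ℕ) (β : ℝ) (V : ℝ → ℝ) (l : Fin N → ℝ) : ℝ :=
  (∏ i, Real.exp (-((N : ℝ) * β / 2 * V (l i)))) *
    ∏ i, ∏ j ∈ Finset.Ioi i, |l i - l j| ^ β

/-- The cube `I^N`. -/
def cube (N : ℕ) (I : Set ℝ) : Set (Fin N → ℝ) := {l | ∀ i, l i ∈ I}

/-- The partition function `Z_{N,β}^{V;I}`. -/
def partitionFunction (N : ℕ) (β : ℝ) (V : ℝ → ℝ) (I : Set ℝ) : ℝ :=
  ∫ l in cube N I, weight N β V l

/-- The law `μ_{N,β}^{V;I}` of the eigenvalues. It is a probability measure exactly when the weight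
is integrable on `I^N` with a positive integral. -/
def law (N : ℕ) (β : ℝ) (V : ℝ → ℝ) (I : Set ℝ) : Measure (Fin N → ℝ) :=
  (volume.restrict (cube N I)).withDensity
    fun l => ENNReal.ofReal (weight N β V l / partitionFunction N β V I)

/-- The Cauchy-Stieltjes transform `∫ dM_N(ξ) / (x - ξ)` of the unnormalized empirical measure
`M_N = ∑ᵢ δ_{λᵢ}`. -/
def stieltjes {N : ℕ} (x : ℂ) (l : Fin N → ℝ) : ℂ := ∑ i, (x - (l i : ℂ))⁻¹

/-- The joint cumulant of `X₁, …, Xₙ`, as the sum over set partitions `π` of `{1, …, n}` of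
`(-1)^(|π|-1) (|π|-1)! ∏_{B ∈ π} E[∏_{i ∈ B} Xᵢ]`. -/
def jointCumulant {Ω : Type*} [MeasurableSpace Ω] (P : Measure Ω) {n : ℕ} (X : Fin n → Ω → ℂ) : ℂ :=
  ∑ π : Finpartition (Finset.univ : Finset (Fin n)),
    (-1 : ℂ) ^ (π.parts.card - 1) * ((π.parts.card - 1).factorial : ℂ) *
      ∏ B ∈ π.parts, ∫ ω, ∏ i ∈ B, X i ω ∂P

/-- The correlator `W_n^{V;I}(x₁, …, xₙ)` for a given number `N` of eigenvalues. -/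
def correlator (N : ℕ) (β : ℝ) (V : ℝ → ℝ) (I : Set ℝ) {n : ℕ} (x : Fin n → ℂ) : ℂ :=
  jointCumulant (law N β V I) fun i => stieltjes (x i)

/-- The set `I ⊆ ℝ`, as a subset of the complex plane. -/
def complexSet (I : Set ℝ) : Set ℂ := (fun t : ℝ => (t : ℂ)) '' I

/-- `V` is continuous on `[b₋, b₊]`, and `liminf V(x) / (2 ln |x|) > 1` at each infinite end. -/
structure IsConfining (V : ℝ → ℝ) (bm bp : EReal) : Prop where
  continuousOn : ContinuousOn V (interval bm bp)
  atBot : bm = ⊥ → 1 < liminf (fun x : ℝ => ((V x / (2 * Real.log |x|) : ℝ) : EReal)) atBot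
  atTop : bp = ⊤ → 1 < liminf (fun x : ℝ => ((V x / (2 * Real.log |x|) : ℝ) : EReal)) atTop

/-- `ν` is a probability measure on `I` at which the energy is finite. The energy is `+∞` at a
measure with an atom, which has to be said because `Real.log 0 = 0`. For a confining potential, the
kernel `(V(x) + V(y))/2 - ln|x - y|` is bounded below and its integral is `+∞` whenever one of the
last two conditions fails. -/
structure HasFiniteEnergy (V : ℝ → ℝ) (I : Set ℝ) (ν : Measure ℝ) : Prop where
  isProbabilityMeasure : IsProbabilityMeasure ν
  carrier : ν Iᶜ = 0
  noAtoms : ∀ x, ν {x} = 0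
  integrable_potential : Integrable V ν
  integrable_log : Integrable (fun p : ℝ × ℝ => Real.log |p.1 - p.2|) (ν.prod ν)

/-- The energy `∫ V dν - ∬ ln|ξ - η| dν(ξ) dν(η)`, used where it is finite. -/
def energy (V : ℝ → ℝ) (ν : Measure ℝ) : ℝ :=
  ∫ x, V x ∂ν - ∫ p : ℝ × ℝ, Real.log |p.1 - p.2| ∂(ν.prod ν)

/-- `ν` is an equilibrium measure: it minimizes the energy among the probability measures
on `I`. -/
def IsEquilibriumMeasure (V : ℝ → ℝ) (I : Set ℝ) (ν : Measure ℝ) : Prop :=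
  HasFiniteEnergy V I ν ∧ ∀ ρ : Measure ℝ, HasFiniteEnergy V I ρ → energy V ν ≤ energy V ρ

/-- The left end `α₋` of the (compact) support. -/
def leftEnd (ν : Measure ℝ) : ℝ := sInf ν.support

/-- The right end `α₊` of the (compact) support. -/
def rightEnd (ν : Measure ℝ) : ℝ := sSup ν.support

/-- `J(x) = V(x)/2 - ∫ ln|x - ξ| dν(ξ)`, for `x` in the interval. For the equilibrium measure
the logarithm is integrable at every such `x`. -/
def rate (V : ℝ → ℝ) (ν : Measure ℝ) (x : ℝ) : ℝ :=
  V x / 2 - ∫ t, Real.log |x - t| ∂ν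

end BetaEnsemble

end

/-! ### The regularized logarithm and its conditional negative definiteness -/

namespace BetaEnsemble

open scoped Topology

/-! Differentiating an integral over `[a, b₊]^N` in `a` leaves a boundary term: one eigenvalue is
frozen at `a` and the others are integrated. The weight is symmetric, so for the partition function
`Z` this is `N` times a single slice integral (`hasDerivAt_integral_cube_left`, `weight_insertNth`).
Everything reduces to showing that this term is at most `e^{-Nη} Z`, uniformly in `a` at distance at
least `ε` from the hull of the support (`exists_edge_bound`). The quotient rule then controls
expectations of bounded observables, and cumulants are polynomials in such expectations
(`edge_dependence`).

For the boundary term, configurations with an eigenvalue at `a` are split by the distance `regDist`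
of their empirical measure to the equilibrium measure. This distance uses the kernel `½ ln (z² +
κ²)` instead of `ln |z|`, because an empirical measure has atoms. The kernel is conditionally
negative definite (`regEnergy_nonpos`): its derivative in `κ` is a Cauchy kernel, a positive
superposition of cosines. So `regDist` is nonnegative and obeys a Cauchy-Schwarz inequality.

If the distance is large, completing the square around the equilibrium measure bounds the weight by
`exp(-(β/2) N² (E + const))` times an integrable product (`weight_le`), `E` being the minimal
energy. On the other hand `Z` is at least `exp(-(β/2) N² (E + small))`
(`exists_partitionFunction_lower_bound`): a sample from the equilibrium measure with at most average
energy is thickened to a box.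

If the distance is small, the eigenvalue at `a` is moved to a short segment `ν` in the hull of the
support. By Jensen's inequality (`le_setIntegral_weight`) the gain is governed by `J(a) - min J`, up
to the error of replacing the empirical measure by the equilibrium one in the potential difference
tested against `δ_a - ν`; Cauchy-Schwarz controls this error (`weight_cons_le_of_regDist_le`). The
Euler-Lagrange conditions, the hypothesis on the minimizers of `J` and the growth of `V` give a gap
of at least `c (1 + ln (1 + |a|))` (`exists_rate_gap`). Its logarithmic growth matches that of the
error terms, whence the uniformity in `a`. -/

/-- The function `ln (1 + |x|)`. -/
noncomputable def logOneAdd (x : ℝ) : ℝ := Real.log (1 + |x|)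

/-- The regularized logarithm `½ ln (z² + κ²)`. -/
noncomputable def regLog (κ z : ℝ) : ℝ := Real.log (z ^ 2 + κ ^ 2) / 2

lemma logOneAdd_nonneg (x : ℝ) : 0 ≤ logOneAdd x :=
  Real.log_nonneg (by linarith [abs_nonneg x])

lemma continuous_logOneAdd : Continuous logOneAdd := by
  unfold logOneAdd
  refine Continuous.log (by fun_prop) fun x => ?_
  positivity

lemma logOneAdd_neg (x : ℝ) : logOneAdd (-x) = logOneAdd x := by simp [logOneAdd]

lemma continuous_regLog {κ : ℝ} (hκ : 0 < κ) : Continuous (regLog κ) := by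
  unfold regLog
  refine Continuous.div_const (Continuous.log (by fun_prop) fun x => ?_) _
  positivity

lemma regLog_neg (κ z : ℝ) : regLog κ (-z) = regLog κ z := by simp [regLog]

lemma regLog_zero {κ : ℝ} : regLog κ 0 = Real.log κ := by
  simp [regLog]

lemma regLog_mono {κ κ' : ℝ} (hκ : 0 < κ) (h : κ ≤ κ') (z : ℝ) : regLog κ z ≤ regLog κ' z := by
  unfold regLog
  gcongr

lemma log_le_regLog (κ : ℝ) {z : ℝ} (hz : z ≠ 0) : Real.log |z| ≤ regLog κ z := by
  have h : Real.log |z| = Real.log (z ^ 2) / 2 := by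
    rw [← sq_abs, Real.log_pow]; push_cast; ring
  rw [h]
  unfold regLog
  have : 0 < z ^ 2 := by positivity
  gcongr
  nlinarith

lemma log_le_regLog_zero {κ : ℝ} (hκ : 0 < κ) (z : ℝ) : Real.log κ ≤ regLog κ z := by
  unfold regLog
  have h : Real.log κ = Real.log (κ ^ 2) / 2 := by
    rw [Real.log_pow]; push_cast; ring
  rw [h]
  gcongr
  nlinarith [sq_nonneg z]

/-- For `κ ≤ 1` one has `(x - y)² + κ² ≤ ((1 + |x|) (1 + |y|))²`. The bound is free of `κ` and
separates the variables, so integrability of `logOneAdd` is the only moment condition needed. -/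
lemma regLog_sub_le {κ : ℝ} (hκ : 0 < κ) (hκ1 : κ ≤ 1) (x y : ℝ) :
    regLog κ (x - y) ≤ logOneAdd x + logOneAdd y := by
  unfold regLog logOneAdd
  rw [← Real.log_mul (by positivity) (by positivity), div_le_iff₀ (by norm_num)]
  have : Real.log ((1 + |x|) * (1 + |y|)) * 2 = Real.log (((1 + |x|) * (1 + |y|)) ^ 2) := by
    rw [Real.log_pow]; push_cast; ring
  rw [this]
  apply Real.log_le_log (by positivity)
  have h1 : |x - y| ≤ |x| + |y| := abs_sub x y
  have h2 : (x - y) ^ 2 ≤ (|x| + |y|) ^ 2 := by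
    rw [← sq_abs]; gcongr
  have h3 : κ ^ 2 ≤ 1 := by nlinarith
  nlinarith [abs_nonneg x, abs_nonneg y, mul_nonneg (abs_nonneg x) (abs_nonneg y),
    mul_nonneg (mul_nonneg (abs_nonneg x) (abs_nonneg y)) (abs_nonneg x),
    mul_nonneg (mul_nonneg (abs_nonneg x) (abs_nonneg y)) (abs_nonneg y),
    mul_nonneg (mul_nonneg (abs_nonneg x) (abs_nonneg y)) (mul_nonneg (abs_nonneg x) (abs_nonneg y))]

lemma log_abs_sub_le (x y : ℝ) : Real.log |x - y| ≤ logOneAdd x + logOneAdd y := by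
  rcases eq_or_ne (x - y) 0 with h | h
  · simp only [h, abs_zero, Real.log_zero]
    linarith [logOneAdd_nonneg x, logOneAdd_nonneg y]
  · exact (log_le_regLog 1 h).trans (regLog_sub_le one_pos le_rfl x y)

lemma abs_regLog_sub_le {κ : ℝ} (hκ : 0 < κ) (hκ1 : κ ≤ 1) (x y : ℝ) :
    |regLog κ (x - y)| ≤ |Real.log κ| + logOneAdd x + logOneAdd y := by
  rw [abs_le]
  constructor
  · linarith [log_le_regLog_zero hκ (x - y), neg_abs_le (Real.log κ), logOneAdd_nonneg x,
      logOneAdd_nonneg y]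
  · linarith [regLog_sub_le hκ hκ1 x y, abs_nonneg (Real.log κ)]

lemma tendsto_regLog_zero {z : ℝ} (hz : z ≠ 0) :
    Tendsto (fun κ => regLog κ z) (𝓝[>] 0) (𝓝 (Real.log |z|)) := by
  have h : Real.log |z| = regLog 0 z := by
    unfold regLog
    rw [← sq_abs]
    simp
  rw [h]
  refine Tendsto.mono_left ?_ nhdsWithin_le_nhds
  have : ContinuousAt (fun κ => regLog κ z) 0 := by
    unfold regLog
    refine ContinuousAt.div_const (ContinuousAt.log (by fun_prop) ?_) _
    have : 0 < z ^ 2 := by positivity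
    positivity
  exact this

/-- The regularized logarithmic energy of a pair of measures. -/
noncomputable def regEnergy (κ : ℝ) (ν ν' : Measure ℝ) : ℝ :=
  ∫ p : ℝ × ℝ, regLog κ (p.1 - p.2) ∂(ν.prod ν')

lemma regEnergy_comm (κ : ℝ) (ν ν' : Measure ℝ) [SFinite ν] [SFinite ν'] :
    regEnergy κ ν ν' = regEnergy κ ν' ν := by
  unfold regEnergy
  rw [← integral_prod_swap]
  refine integral_congr_ae (Eventually.of_forall fun p => ?_)
  simp only [Prod.fst_swap, Prod.snd_swap]
  rw [← regLog_neg, neg_sub]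

lemma integrable_logOneAdd_add {ν ν' : Measure ℝ} [IsFiniteMeasure ν] [IsFiniteMeasure ν']
    (h : Integrable logOneAdd ν) (h' : Integrable logOneAdd ν') (c : ℝ) :
    Integrable (fun p : ℝ × ℝ => c + logOneAdd p.1 + logOneAdd p.2) (ν.prod ν') :=
  ((integrable_const c).add (h.comp_fst ν')).add (h'.comp_snd ν)

lemma integrable_regLog_prod {κ : ℝ} (hκ : 0 < κ) (hκ1 : κ ≤ 1) {ν ν' : Measure ℝ}
    [IsFiniteMeasure ν] [IsFiniteMeasure ν']
    (h : Integrable logOneAdd ν) (h' : Integrable logOneAdd ν') :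
    Integrable (fun p : ℝ × ℝ => regLog κ (p.1 - p.2)) (ν.prod ν') := by
  refine (integrable_logOneAdd_add h h' |Real.log κ|).mono'
    (((continuous_regLog hκ).comp (by fun_prop)).aestronglyMeasurable) ?_
  exact Eventually.of_forall fun p => abs_regLog_sub_le hκ hκ1 _ _

lemma integrable_regLog_sub {κ : ℝ} (hκ : 0 < κ) (hκ1 : κ ≤ 1) {ν : Measure ℝ}
    [IsFiniteMeasure ν] (h : Integrable logOneAdd ν) (x : ℝ) :
    Integrable (fun y : ℝ => regLog κ (x - y)) ν := by
  refine ((integrable_const (|Real.log κ| + logOneAdd x)).add h).mono'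
    (((continuous_regLog hκ).comp (by fun_prop)).aestronglyMeasurable) ?_
  exact Eventually.of_forall fun p => abs_regLog_sub_le hκ hκ1 _ _

/-- Real part of the Laplace transform of `e^{ikz}`. It displays the Cauchy kernel as a
superposition of cosines with positive weights, the source of all positivity below. -/
lemma integral_exp_neg_mul_cos {s : ℝ} (hs : 0 < s) (z : ℝ) :
    ∫ k in Ioi (0 : ℝ), Real.exp (-(s * k)) * Real.cos (k * z) = s / (s ^ 2 + z ^ 2) := by
  have ha : (-(s : ℂ) + z * Complex.I).re < 0 := by simpa using hs
  have h := integral_exp_mul_complex_Ioi ha 0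
  have hi := integrableOn_exp_mul_complex_Ioi ha 0
  have h2 := congrArg Complex.re h
  rw [← RCLike.re_to_complex, ← integral_re hi] at h2
  have e : ∀ k : ℝ, RCLike.re (Complex.exp ((-(s : ℂ) + z * Complex.I) * k))
      = Real.exp (-(s * k)) * Real.cos (k * z) := by
    intro k
    rw [RCLike.re_to_complex, Complex.exp_re]
    simp [mul_comm]
  simp only [e] at h2
  rw [h2]
  have : (-(s : ℂ) + z * Complex.I) ≠ 0 := fun h0 => by rw [h0] at ha; simp at ha
  simp only [Complex.ofReal_zero, mul_zero, Complex.exp_zero, Complex.div_re, Complex.neg_re, Complex.one_re, Complex.normSq_apply]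
  simp
  field_simp

/-- `∫ cos (k x) dν(x)`. -/
noncomputable def cosTransform (ν : Measure ℝ) (k : ℝ) : ℝ := ∫ x, Real.cos (k * x) ∂ν

/-- `∫ sin (k x) dν(x)`. -/
noncomputable def sinTransform (ν : Measure ℝ) (k : ℝ) : ℝ := ∫ x, Real.sin (k * x) ∂ν

lemma integrable_cos_mul (ν : Measure ℝ) [IsFiniteMeasure ν] (k : ℝ) :
    Integrable (fun x => Real.cos (k * x)) ν :=
  (integrable_const (1 : ℝ)).mono' (by fun_prop)
    (Eventually.of_forall fun x => by simpa using Real.abs_cos_le_one _)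

lemma integrable_sin_mul (ν : Measure ℝ) [IsFiniteMeasure ν] (k : ℝ) :
    Integrable (fun x => Real.sin (k * x)) ν :=
  (integrable_const (1 : ℝ)).mono' (by fun_prop)
    (Eventually.of_forall fun x => by simpa using Real.abs_sin_le_one _)

lemma integrable_exp_neg_mul_cos_prod {s : ℝ} (hs : 0 < s) (ν ν' : Measure ℝ) [IsFiniteMeasure ν]
    [IsFiniteMeasure ν'] :
    Integrable (fun q : (ℝ × ℝ) × ℝ => Real.exp (-(s * q.2)) * Real.cos (q.2 * (q.1.1 - q.1.2)))
      ((ν.prod ν').prod (volume.restrict (Ioi 0))) := by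
  have h : Integrable (fun k : ℝ => Real.exp (-(s * k))) (volume.restrict (Ioi 0)) := by
    have := exp_neg_integrableOn_Ioi 0 hs
    simpa [IntegrableOn] using this
  refine (h.comp_snd (ν.prod ν')).mono' (by fun_prop) (Eventually.of_forall fun q => ?_)
  rw [norm_mul, Real.norm_eq_abs, Real.norm_eq_abs, Real.abs_exp]
  exact mul_le_of_le_one_right (Real.exp_pos _).le (Real.abs_cos_le_one _)

lemma integral_cos_mul_sub (ν ν' : Measure ℝ) [IsFiniteMeasure ν] [IsFiniteMeasure ν'] (s k : ℝ) :
    ∫ p : ℝ × ℝ, Real.exp (-(s * k)) * Real.cos (k * (p.1 - p.2)) ∂(ν.prod ν')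
      = Real.exp (-(s * k)) * (cosTransform ν k * cosTransform ν' k +
        sinTransform ν k * sinTransform ν' k) := by
  rw [integral_const_mul]
  congr 1
  simp only [mul_sub, Real.cos_sub]
  rw [integral_add ((integrable_cos_mul ν k).mul_prod (integrable_cos_mul ν' k))
    ((integrable_sin_mul ν k).mul_prod (integrable_sin_mul ν' k))]
  exact congrArg₂ (· + ·)
    (integral_prod_mul (fun x => Real.cos (k * x)) (fun x => Real.cos (k * x)))
    (integral_prod_mul (fun x => Real.sin (k * x)) (fun x => Real.sin (k * x)))

/-- Fubini, after which `cos (k (x - y))` splits into products: on the Fourier side the kernel is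
diagonal. -/
lemma integral_cauchy_kernel {s : ℝ} (hs : 0 < s) (ν ν' : Measure ℝ) [IsFiniteMeasure ν]
    [IsFiniteMeasure ν'] :
    ∫ p : ℝ × ℝ, s / (s ^ 2 + (p.1 - p.2) ^ 2) ∂(ν.prod ν') =
      ∫ k in Ioi (0 : ℝ), Real.exp (-(s * k)) * (cosTransform ν k * cosTransform ν' k +
        sinTransform ν k * sinTransform ν' k) := by
  simp only [← integral_exp_neg_mul_cos hs]
  rw [integral_integral_swap (integrable_exp_neg_mul_cos_prod hs ν ν')]
  simp only [integral_cos_mul_sub]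

lemma integrable_transforms {s : ℝ} (hs : 0 < s) (ν ν' : Measure ℝ) [IsFiniteMeasure ν]
    [IsFiniteMeasure ν'] :
    IntegrableOn (fun k => Real.exp (-(s * k)) * (cosTransform ν k * cosTransform ν' k +
        sinTransform ν k * sinTransform ν' k)) (Ioi 0) := by
  have := (integrable_exp_neg_mul_cos_prod hs ν ν').integral_prod_right
  simp only [integral_cos_mul_sub] at this
  exact this

/-- The Cauchy kernel is positive definite. -/
lemma cauchy_kernel_posDef {s : ℝ} (hs : 0 < s) {ι : Type*} [Fintype ι] (ν : ι → Measure ℝ)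
    [∀ i, IsFiniteMeasure (ν i)] (c : ι → ℝ) :
    0 ≤ ∑ i, ∑ j, c i * c j *
      ∫ p : ℝ × ℝ, s / (s ^ 2 + (p.1 - p.2) ^ 2) ∂((ν i).prod (ν j)) := by
  simp only [integral_cauchy_kernel hs, ← integral_const_mul]
  have hint : ∀ i j, IntegrableOn (fun k => c i * c j * (Real.exp (-(s * k)) *
      (cosTransform (ν i) k * cosTransform (ν j) k +
        sinTransform (ν i) k * sinTransform (ν j) k))) (Ioi 0) := fun i j =>
    (integrable_transforms hs (ν i) (ν j)).const_mul _
  have : ∀ i, ∑ j, ∫ k in Ioi (0 : ℝ), c i * c j * (Real.exp (-(s * k)) *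
      (cosTransform (ν i) k * cosTransform (ν j) k +
        sinTransform (ν i) k * sinTransform (ν j) k)) = ∫ k in Ioi (0 : ℝ), ∑ j, c i * c j *
      (Real.exp (-(s * k)) * (cosTransform (ν i) k * cosTransform (ν j) k +
        sinTransform (ν i) k * sinTransform (ν j) k)) := fun i =>
    (integral_finsetSum _ fun j _ => hint i j).symm
  simp only [this]
  rw [← integral_finsetSum _ fun i _ => integrable_finsetSum _ fun j _ => hint i j]
  refine integral_nonneg fun k => ?_
  -- At each frequency the quadratic form is a positive multiple of a sum of two squares.
  have e : ∑ i, ∑ j, c i * c j * (Real.exp (-(s * k)) *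
      (cosTransform (ν i) k * cosTransform (ν j) k + sinTransform (ν i) k * sinTransform (ν j) k))
      = Real.exp (-(s * k)) * ((∑ i, c i * cosTransform (ν i) k) ^ 2 +
        (∑ i, c i * sinTransform (ν i) k) ^ 2) := by
    rw [sq, sq, Finset.sum_mul_sum, Finset.sum_mul_sum, ← Finset.sum_add_distrib, Finset.mul_sum]
    simp only [← Finset.sum_add_distrib, Finset.mul_sum]
    refine Finset.sum_congr rfl fun i _ => Finset.sum_congr rfl fun j _ => ?_
    ring
  simp only [Pi.zero_apply]
  rw [e]
  positivity

lemma hasDerivAt_regLog {s : ℝ} (hs : 0 < s) (z : ℝ) :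
    HasDerivAt (fun s => regLog s z) (s / (s ^ 2 + z ^ 2)) s := by
  unfold regLog
  have h : HasDerivAt (fun s : ℝ => z ^ 2 + s ^ 2) (2 * s) s := by
    simpa using (hasDerivAt_pow 2 s).const_add (z ^ 2)
  have h2 := (h.log (by positivity)).div_const 2
  have e : s / (s ^ 2 + z ^ 2) = 2 * s / (z ^ 2 + s ^ 2) / 2 := by
    rw [add_comm (s ^ 2)]
    ring
  rw [e]
  exact h2

/-- The derivative of `regLog s z` in `s` is the Cauchy kernel, so positive definiteness is
inherited by integrating over the scale. -/
lemma regLog_sub_regLog {κ T : ℝ} (hκ : 0 < κ) (hT : κ ≤ T) (z : ℝ) :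
    regLog T z - regLog κ z = ∫ s in Icc κ T, s / (s ^ 2 + z ^ 2) := by
  rw [integral_Icc_eq_integral_Ioc, ← intervalIntegral.integral_of_le hT]
  symm
  refine intervalIntegral.integral_eq_sub_of_hasDerivAt (f := fun s => regLog s z) (fun s hs => ?_)
    (ContinuousOn.intervalIntegrable ?_)
  · rw [uIcc_of_le hT] at hs
    exact hasDerivAt_regLog (hκ.trans_le hs.1) z
  · refine ContinuousOn.div (by fun_prop) (by fun_prop) fun s hs => ?_
    rw [uIcc_of_le hT] at hs
    have : 0 < s := hκ.trans_le hs.1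
    positivity

lemma integrable_cauchy_prod {κ T : ℝ} (hκ : 0 < κ) (ν ν' : Measure ℝ)
    [IsFiniteMeasure ν] [IsFiniteMeasure ν'] :
    Integrable (fun q : (ℝ × ℝ) × ℝ => q.2 / (q.2 ^ 2 + (q.1.1 - q.1.2) ^ 2))
      ((ν.prod ν').prod (volume.restrict (Icc κ T))) := by
  have hm : ∀ᵐ q ∂((ν.prod ν').prod (volume.restrict (Icc κ T))), q.2 ∈ Icc κ T :=
    Measure.quasiMeasurePreserving_snd.ae (ae_restrict_mem measurableSet_Icc)
  refine (integrable_const (1 / κ)).mono' ?_ (hm.mono fun q hq => ?_)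
  · exact (Measurable.div (by fun_prop) (by fun_prop)).aestronglyMeasurable
  · have h0 : 0 < q.2 := hκ.trans_le hq.1
    rw [Real.norm_of_nonneg (by positivity)]
    calc q.2 / (q.2 ^ 2 + (q.1.1 - q.1.2) ^ 2) ≤ q.2 / q.2 ^ 2 := by
          gcongr; nlinarith [sq_nonneg (q.1.1 - q.1.2)]
      _ = 1 / q.2 := by field_simp
      _ ≤ 1 / κ := by gcongr; exact hq.1

lemma integral_regLog_sub {κ T : ℝ} (hκ : 0 < κ) (hT : κ ≤ T) (ν ν' : Measure ℝ)
    [IsFiniteMeasure ν] [IsFiniteMeasure ν'] :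
    ∫ p : ℝ × ℝ, (regLog T (p.1 - p.2) - regLog κ (p.1 - p.2)) ∂(ν.prod ν') =
      ∫ s in Icc κ T, ∫ p : ℝ × ℝ, s / (s ^ 2 + (p.1 - p.2) ^ 2) ∂(ν.prod ν') := by
  simp only [regLog_sub_regLog hκ hT]
  exact integral_integral_swap (integrable_cauchy_prod hκ ν ν')

/-- The kernel `½ ln (z² + T²) - ½ ln (z² + κ²)` is positive definite for `κ ≤ T`. -/
lemma regLog_sub_posDef {κ T : ℝ} (hκ : 0 < κ) (hT : κ ≤ T) {ι : Type*} [Fintype ι]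
    (ν : ι → Measure ℝ) [∀ i, IsFiniteMeasure (ν i)] (c : ι → ℝ) :
    0 ≤ ∑ i, ∑ j, c i * c j * ∫ p : ℝ × ℝ,
      (regLog T (p.1 - p.2) - regLog κ (p.1 - p.2)) ∂((ν i).prod (ν j)) := by
  simp only [integral_regLog_sub hκ hT]
  have hint : ∀ i j, IntegrableOn (fun s => c i * c j *
      ∫ p : ℝ × ℝ, s / (s ^ 2 + (p.1 - p.2) ^ 2) ∂((ν i).prod (ν j))) (Icc κ T) := fun i j =>
    (integrable_cauchy_prod hκ (ν i) (ν j)).integral_prod_right.const_mul _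
  have : ∀ i, ∑ j, c i * c j * ∫ s in Icc κ T,
      ∫ p : ℝ × ℝ, s / (s ^ 2 + (p.1 - p.2) ^ 2) ∂((ν i).prod (ν j)) = ∫ s in Icc κ T,
      ∑ j, c i * c j * ∫ p : ℝ × ℝ, s / (s ^ 2 + (p.1 - p.2) ^ 2) ∂((ν i).prod (ν j)) := fun i => by
    rw [integral_finsetSum _ fun j _ => hint i j]
    simp only [integral_const_mul (c i * c _)]
  rw [Finset.sum_congr rfl fun i _ => this i,
    ← integral_finsetSum _ fun i _ => integrable_finsetSum _ fun j _ => hint i j]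
  exact setIntegral_nonneg measurableSet_Icc fun s hs =>
    cauchy_kernel_posDef (hκ.trans_le hs.1) ν c

lemma regLog_sub_log {T : ℝ} (hT : 0 < T) (z : ℝ) :
    regLog T z - Real.log T = regLog 1 (z / T) := by
  unfold regLog
  have h : z ^ 2 + T ^ 2 = T ^ 2 * ((z / T) ^ 2 + 1 ^ 2) := by field_simp
  rw [h, Real.log_mul (by positivity) (by positivity), Real.log_pow]
  push_cast; ring

lemma regLog_one_nonneg (z : ℝ) : 0 ≤ regLog 1 z := by
  simpa using log_le_regLog_zero one_pos z

/-- By scaling, the integrand is `regLog 1 (z / T)`. It tends to `0`, and for `T ≥ 1` it lies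
between `0` and `regLog 1 z`, which dominates. -/
lemma tendsto_integral_regLog_atTop {ν ν' : Measure ℝ} [IsFiniteMeasure ν] [IsFiniteMeasure ν']
    (h : Integrable logOneAdd ν) (h' : Integrable logOneAdd ν') :
    Tendsto (fun T : ℝ => ∫ p : ℝ × ℝ, (regLog T (p.1 - p.2) - Real.log T) ∂(ν.prod ν'))
      atTop (𝓝 0) := by
  have h0 : (0 : ℝ) = ∫ p : ℝ × ℝ, (0 : ℝ) ∂(ν.prod ν') := by simp
  rw [h0]
  refine tendsto_integral_filter_of_dominated_convergence
    (fun p => regLog 1 (p.1 - p.2)) ?_ ?_ (integrable_regLog_prod one_pos le_rfl h h') ?_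
  · filter_upwards [eventually_gt_atTop 0] with T hT
    exact (((continuous_regLog hT).comp (by fun_prop)).sub continuous_const).aestronglyMeasurable
  · filter_upwards [eventually_ge_atTop 1] with T hT
    refine Eventually.of_forall fun p => ?_
    have hT0 : 0 < T := by linarith
    rw [regLog_sub_log hT0, Real.norm_of_nonneg (regLog_one_nonneg _)]
    unfold regLog
    have : ((p.1 - p.2) / T) ^ 2 ≤ (p.1 - p.2) ^ 2 := by
      rw [div_pow]
      exact div_le_self (sq_nonneg _) (by nlinarith)
    gcongr
  · refine Eventually.of_forall fun p => ?_
    have hc : Tendsto (fun T : ℝ => regLog 1 ((p.1 - p.2) / T)) atTop (𝓝 (regLog 1 0)) :=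
      ((continuous_regLog one_pos).tendsto 0).comp (tendsto_const_nhds.div_atTop tendsto_id)
    rw [regLog_zero, Real.log_one] at hc
    refine hc.congr' ?_
    filter_upwards [eventually_gt_atTop 0] with T hT
    exact (regLog_sub_log hT _).symm

/-- The regularized logarithm is conditionally negative definite. -/
theorem regEnergy_nonpos {κ : ℝ} (hκ : 0 < κ) (hκ1 : κ ≤ 1) {ι : Type*} [Fintype ι]
    (ν : ι → Measure ℝ) [∀ i, IsProbabilityMeasure (ν i)] (hν : ∀ i, Integrable logOneAdd (ν i))
    (c : ι → ℝ) (hc : ∑ i, c i = 0) :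
    ∑ i, ∑ j, c i * c j * regEnergy κ (ν i) (ν j) ≤ 0 := by
  -- Since the coefficients sum to zero, subtracting `ln T` does not change the form of the kernel
  -- at scale `T`. That form then vanishes as `T → ∞`, and only minus the form at scale `κ` remains,
  -- which is therefore nonnegative.
  have hlim : Tendsto (fun T : ℝ => ∑ i, ∑ j, c i * c j *
      (∫ p : ℝ × ℝ, (regLog T (p.1 - p.2) - Real.log T) ∂((ν i).prod (ν j))
        - regEnergy κ (ν i) (ν j))) atTop
      (𝓝 (∑ i, ∑ j, c i * c j * (0 - regEnergy κ (ν i) (ν j)))) :=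
    tendsto_finsetSum _ fun i _ => tendsto_finsetSum _ fun j _ =>
      ((tendsto_integral_regLog_atTop (hν i) (hν j)).sub_const _).const_mul _
  have hpos : ∀ᶠ T : ℝ in atTop, 0 ≤ ∑ i, ∑ j, c i * c j *
      (∫ p : ℝ × ℝ, (regLog T (p.1 - p.2) - Real.log T) ∂((ν i).prod (ν j))
        - regEnergy κ (ν i) (ν j)) := by
    filter_upwards [eventually_ge_atTop 1] with T hT
    have hT0 : 0 < T := by linarith
    have hTint : ∀ i j, Integrable (fun p : ℝ × ℝ => regLog T (p.1 - p.2) - Real.log T)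
        ((ν i).prod (ν j)) := by
      intro i j
      simp only [regLog_sub_log hT0]
      refine (integrable_regLog_prod one_pos le_rfl (hν i) (hν j)).mono'
        (((continuous_regLog one_pos).comp (by fun_prop)).aestronglyMeasurable) ?_
      refine Eventually.of_forall fun p => ?_
      rw [Real.norm_of_nonneg (regLog_one_nonneg _)]
      unfold regLog
      have : ((p.1 - p.2) / T) ^ 2 ≤ (p.1 - p.2) ^ 2 := by
        rw [div_pow]
        exact div_le_self (sq_nonneg _) (by nlinarith)
      gcongr
    have hz : ∑ i, ∑ j, c i * c j * Real.log T = 0 := by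
      simp only [mul_assoc, ← Finset.mul_sum, ← Finset.sum_mul, hc]
      simp
    have := regLog_sub_posDef hκ (hκ1.trans hT) ν c
    refine (this.trans_eq (sub_zero _).symm).trans_eq ?_
    rw [← hz, ← Finset.sum_sub_distrib]
    refine Finset.sum_congr rfl fun i _ => ?_
    rw [← Finset.sum_sub_distrib]
    refine Finset.sum_congr rfl fun j _ => ?_
    rw [← mul_sub]
    congr 1
    have e : ∀ p : ℝ × ℝ, regLog T (p.1 - p.2) - regLog κ (p.1 - p.2) =
      ((regLog T (p.1 - p.2) - Real.log T) - regLog κ (p.1 - p.2)) + Real.log T := fun p => by ring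
    simp only [e]
    have h1 : Integrable (fun p : ℝ × ℝ => (regLog T (p.1 - p.2) - Real.log T) -
        regLog κ (p.1 - p.2)) ((ν i).prod (ν j)) :=
      (hTint i j).sub (integrable_regLog_prod hκ hκ1 (hν i) (hν j))
    rw [integral_add h1 (integrable_const _), integral_sub (hTint i j)
      (integrable_regLog_prod hκ hκ1 (hν i) (hν j))]
    simp [regEnergy]
  have := ge_of_tendsto hlim hpos
  simp only [zero_sub, mul_neg, Finset.sum_neg_distrib] at this
  linarith

/-- The difference of the two kernels is positive definite outright, so no neutrality of the
coefficients is required here. -/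
theorem regEnergy_mono {κ T : ℝ} (hκ : 0 < κ) (hT : κ ≤ T) (hT1 : T ≤ 1) {ι : Type*} [Fintype ι]
    (ν : ι → Measure ℝ) [∀ i, IsProbabilityMeasure (ν i)] (hν : ∀ i, Integrable logOneAdd (ν i))
    (c : ι → ℝ) :
    ∑ i, ∑ j, c i * c j * regEnergy κ (ν i) (ν j) ≤
      ∑ i, ∑ j, c i * c j * regEnergy T (ν i) (ν j) := by
  have := regLog_sub_posDef hκ hT ν c
  have e : ∀ i j, ∫ p : ℝ × ℝ,
      (regLog T (p.1 - p.2) - regLog κ (p.1 - p.2)) ∂((ν i).prod (ν j)) =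
      regEnergy T (ν i) (ν j) - regEnergy κ (ν i) (ν j) := fun i j =>
    integral_sub (integrable_regLog_prod (hκ.trans_le hT) hT1 (hν i) (hν j))
      (integrable_regLog_prod hκ (hT.trans hT1) (hν i) (hν j))
  simp only [e, mul_sub, Finset.sum_sub_distrib] at this
  linarith

end BetaEnsemble

/-! ### Averages of the logarithm over segments, and the first variation of the energy -/

namespace BetaEnsemble

open scoped Topology

/-- The average of `ln |·|` over the segment from `z` to `z + s`. -/
noncomputable def avgLog (z s : ℝ) : ℝ := ∫ u in Icc (0 : ℝ) 1, Real.log |z + s * u|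

lemma avgLog_eq {s : ℝ} (hs : s ≠ 0) (z : ℝ) :
    avgLog z s = s⁻¹ * ((z + s) * Real.log (z + s) - z * Real.log z - s) := by
  unfold avgLog
  rw [integral_Icc_eq_integral_Ioc, ← intervalIntegral.integral_of_le zero_le_one]
  simp only [Real.log_abs]
  rw [intervalIntegral.integral_comp_add_mul (fun x => Real.log x) hs, integral_log]
  simp only [mul_zero, add_zero, mul_one, smul_eq_mul]
  ring

lemma integrableOn_log_affine {s : ℝ} (hs : s ≠ 0) (z : ℝ) :
    IntegrableOn (fun u => Real.log |z + s * u|) (Icc 0 1) := by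
  rw [integrableOn_Icc_iff_integrableOn_Ioc, ← intervalIntegrable_iff_integrableOn_Ioc_of_le
    zero_le_one]
  simp only [Real.log_abs]
  have h := (intervalIntegral.intervalIntegrable_log' (a := z + s * 0) (b := z + s * 1))
  have h2 := (h.comp_add_left z).comp_mul_left (c := s)
  simpa [hs] using h2

lemma mul_log_ge {p : ℝ} (hp : 0 ≤ p) : p - 1 ≤ p * Real.log p := by
  rcases hp.eq_or_lt with rfl | hp
  · simp
  have := Real.one_sub_inv_le_log_of_pos hp
  calc p - 1 = p * (1 - p⁻¹) := by field_simp
    _ ≤ _ := by gcongr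

/-- A lower bound uniform in `s`, which provides the dominating function as the segment shrinks.
Dividing by `z` and putting `v = (z + s) / z` reduces it to `v ln v / (v - 1) ≥ -1`. -/
lemma avgLog_ge_log {s z : ℝ} (hs : s ≠ 0) (hz : z ≠ 0) : Real.log |z| - 2 ≤ avgLog z s := by
  have key : ∀ v : ℝ, v ≠ 1 → -1 ≤ v * Real.log v / (v - 1) := by
    intro v hv
    rcases lt_or_ge v 0 with h | h
    · have h1 := mul_log_ge (neg_nonneg.2 h.le)
      rw [Real.log_neg_eq_log] at h1
      rw [le_div_iff_of_neg (by linarith)]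
      linarith
    · rcases lt_or_gt_of_ne hv with h1 | h1
      · rw [le_div_iff_of_neg (by linarith)]
        have := Real.log_nonpos h h1.le
        nlinarith
      · rw [le_div_iff₀ (by linarith)]
        have := Real.log_nonneg h1.le
        nlinarith
  rw [avgLog_eq hs, Real.log_abs]
  rcases eq_or_ne (z + s) 0 with h0 | h0
  · have : s = -z := by linarith
    rw [h0, this]
    simp only [zero_mul, zero_sub, sub_neg_eq_add, inv_neg]
    have e : -z⁻¹ * (-(z * Real.log z) + z) = Real.log z - 1 := by field_simp; ring
    rw [e]; linarith
  · have hv : (z + s) / z ≠ 1 := by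
      intro h; rw [div_eq_one_iff_eq hz] at h; exact hs (by linarith)
    have := key _ hv
    rw [Real.log_div h0 hz] at this
    have e : s⁻¹ * ((z + s) * Real.log (z + s) - z * Real.log z - s) =
      (z + s) / z * (Real.log (z + s) - Real.log z) / ((z + s) / z - 1) + Real.log z - 1 := by
      have : (z + s) / z - 1 = s / z := by field_simp; ring
      rw [this]; field_simp; ring
    rw [e]; linarith

/-- A lower bound uniform in `z`: the uniform measure on a segment has a potential bounded below. In
the variable `v = z / s` the claim is `(v + 1) ln (v + 1) - v ln v ≥ -1`. -/
lemma avgLog_ge_scale {s : ℝ} (hs : s ≠ 0) (z : ℝ) : Real.log |s| - 2 ≤ avgLog z s := by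
  have g0 : ∀ v : ℝ, 0 ≤ v → 0 ≤ (v + 1) * Real.log (v + 1) - v * Real.log v := by
    intro v hv
    rcases hv.eq_or_lt with rfl | hv
    · simp
    have h1 : Real.log v ≤ Real.log (v + 1) := Real.log_le_log hv (by linarith)
    have h2 : 0 ≤ Real.log (v + 1) := Real.log_nonneg (by linarith)
    nlinarith
  have key : ∀ v : ℝ, -1 ≤ (v + 1) * Real.log (v + 1) - v * Real.log v := by
    intro v
    rcases le_or_gt 0 v with h | h
    · linarith [g0 v h]
    rcases le_or_gt v (-1) with h1 | h1
    · have := g0 (-v - 1) (by linarith)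
      rw [show -v - 1 + 1 = -v by ring, show -v - 1 = -(v + 1) by ring, Real.log_neg_eq_log,
        Real.log_neg_eq_log] at this
      linarith
    · have h2 := mul_log_ge (p := v + 1) (by linarith)
      have h3 := mul_log_ge (p := -v) (by linarith)
      rw [Real.log_neg_eq_log] at h3
      linarith
  have := key (z / s)
  rw [avgLog_eq hs, Real.log_abs]
  have e : s⁻¹ * ((z + s) * Real.log (z + s) - z * Real.log z - s) =
      (z / s + 1) * Real.log (z / s + 1) - z / s * Real.log (z / s) + Real.log s - 1 := by
    have h1 : z / s + 1 = (z + s) / s := by field_simp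
    have h2 : (z + s) / s * Real.log ((z + s) / s) =
        (z + s) / s * (Real.log (z + s) - Real.log s) := by
      rcases eq_or_ne (z + s) 0 with h0 | h0
      · simp [h0]
      · rw [Real.log_div h0 hs]
    have h3 : z / s * Real.log (z / s) = z / s * (Real.log z - Real.log s) := by
      rcases eq_or_ne z 0 with h0 | h0
      · simp [h0]
      · rw [Real.log_div h0 hs]
    rw [h1, h2, h3]
    field_simp
    ring
  rw [e]; linarith

lemma log_abs_add_le {s u : ℝ} (hs : |s| ≤ 1) (hu : u ∈ Icc (0 : ℝ) 1) (z : ℝ) :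
    Real.log |z + s * u| ≤ 1 + logOneAdd z := by
  have h : Real.log |z - -(s * u)| ≤ _ := log_abs_sub_le z (-(s * u))
  rw [sub_neg_eq_add, logOneAdd_neg] at h
  have h2 : logOneAdd (s * u) ≤ 1 := by
    unfold logOneAdd
    have : |s * u| ≤ 1 := by
      rw [abs_mul, abs_of_nonneg hu.1]
      exact mul_le_one₀ hs hu.1 hu.2
    have := Real.log_le_sub_one_of_pos (show 0 < 1 + |s * u| by positivity)
    linarith
  linarith

lemma avgLog_le {s : ℝ} (hs : s ≠ 0) (hs1 : |s| ≤ 1) (z : ℝ) : avgLog z s ≤ 1 + logOneAdd z := by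
  unfold avgLog
  have h := setIntegral_mono_on (integrableOn_log_affine hs z)
    (integrableOn_const (C := 1 + logOneAdd z) (by simp)) measurableSet_Icc
    fun u hu => log_abs_add_le hs1 hu z
  simpa using h

/-- The average is the difference quotient at `z` of the primitive `x ln x - x`. -/
lemma tendsto_avgLog {z : ℝ} (hz : z ≠ 0) :
    Tendsto (avgLog z) (𝓝[≠] 0) (𝓝 (Real.log |z|)) := by
  have h := ((Real.hasDerivAt_mul_log hz).sub (hasDerivAt_id z))
  rw [hasDerivAt_iff_tendsto_slope_zero] at h
  rw [Real.log_abs]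
  simp only [add_sub_cancel_right] at h
  refine h.congr' ?_
  filter_upwards [self_mem_nhdsWithin] with s hs
  rw [avgLog_eq hs]
  simp only [Pi.sub_apply, id, smul_eq_mul]
  ring

lemma measurable_avgLog (s : ℝ) : Measurable fun z => avgLog z s := by
  unfold avgLog
  have : StronglyMeasurable (fun p : ℝ × ℝ => Real.log |p.1 + s * p.2|) := by
    apply Measurable.stronglyMeasurable
    fun_prop
  exact this.integral_prod_right.measurable

/-- The potential `∫ ln |x - y| dν(y)`. -/
noncomputable def potential (ν : Measure ℝ) (x : ℝ) : ℝ := ∫ y, Real.log |x - y| ∂ν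

lemma logOneAdd_sub_le (x y : ℝ) : logOneAdd (x - y) ≤ logOneAdd x + logOneAdd y := by
  unfold logOneAdd
  rw [← Real.log_mul (by positivity) (by positivity)]
  apply Real.log_le_log (by positivity)
  have h1 : |x - y| ≤ |x| + |y| := abs_sub x y
  nlinarith [mul_nonneg (abs_nonneg x) (abs_nonneg y)]

lemma abs_avgLog_le {s z : ℝ} (hs : s ≠ 0) (hs1 : |s| ≤ 1) (hz : z ≠ 0) :
    |avgLog z s| ≤ 2 + logOneAdd z + |(Real.log |z|)| := by
  rw [abs_le]
  constructor
  · linarith [avgLog_ge_log hs hz, neg_abs_le (Real.log |z|), logOneAdd_nonneg z]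
  · linarith [avgLog_le hs hs1 z, abs_nonneg (Real.log |z|), logOneAdd_nonneg z]

lemma ae_ne_of_noAtoms {ν : Measure ℝ} (x : ℝ) (hx : ν {x} = 0) : ∀ᵐ y ∂ν, x - y ≠ 0 := by
  have : ∀ᵐ y ∂ν, y ∉ ({x} : Set ℝ) := measure_eq_zero_iff_ae_notMem.1 hx
  filter_upwards [this] with y hy h
  exact hy (by rw [mem_singleton_iff]; linarith)

lemma tendsto_integral_avgLog {ν : Measure ℝ} [IsFiniteMeasure ν] (h1 : Integrable logOneAdd ν)
    {x : ℝ} (hx : ν {x} = 0) (hlog : Integrable (fun y => Real.log |x - y|) ν) :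
    Tendsto (fun s => ∫ y, avgLog (x - y) s ∂ν) (𝓝[≠] 0) (𝓝 (potential ν x)) := by
  refine tendsto_integral_filter_of_dominated_convergence
    (fun y => 2 + (logOneAdd x + logOneAdd y) + |(Real.log |x - y|)|) ?_ ?_ ?_ ?_
  · exact Eventually.of_forall fun s =>
      ((measurable_avgLog s).comp (by fun_prop)).aestronglyMeasurable
  · have hb : ∀ᶠ s : ℝ in 𝓝[≠] 0, |s| ≤ 1 := by
      filter_upwards [nhdsWithin_le_nhds (Metric.closedBall_mem_nhds (0 : ℝ) one_pos)] with s hs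
      simpa using hs
    filter_upwards [self_mem_nhdsWithin, hb] with s hs hs1
    filter_upwards [ae_ne_of_noAtoms x hx] with y hy
    exact (abs_avgLog_le hs hs1 hy).trans (by linarith [logOneAdd_sub_le x y])
  · exact (((integrable_const _).add ((integrable_const _).add h1))).add hlog.abs
  · filter_upwards [ae_ne_of_noAtoms x hx] with y hy
    exact tendsto_avgLog hy

/-- The uniform probability measure on the segment from `x` to `x + s`. -/
noncomputable def segmentMeasure (x s : ℝ) : Measure ℝ :=
  Measure.map (fun u => x + s * u) (volume.restrict (Icc 0 1))

instance (x s : ℝ) : IsProbabilityMeasure (segmentMeasure x s) := by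
  have : IsProbabilityMeasure (volume.restrict (Icc (0 : ℝ) 1)) := ⟨by simp⟩
  exact Measure.isProbabilityMeasure_map (by fun_prop)

lemma measurableEmbedding_affine (x : ℝ) {s : ℝ} (hs : s ≠ 0) :
    MeasurableEmbedding (fun u : ℝ => x + s * u) :=
  (measurableEmbedding_addLeft x).comp (measurableEmbedding_mulLeft₀ hs)

lemma integral_segmentMeasure (x : ℝ) {s : ℝ} (hs : s ≠ 0) (f : ℝ → ℝ) :
    ∫ y, f y ∂(segmentMeasure x s) = ∫ u in Icc (0 : ℝ) 1, f (x + s * u) :=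
  (measurableEmbedding_affine x hs).integral_map f

lemma integrable_segmentMeasure (x : ℝ) {s : ℝ} (hs : s ≠ 0) (f : ℝ → ℝ) :
    Integrable f (segmentMeasure x s) ↔ IntegrableOn (fun u => f (x + s * u)) (Icc (0 : ℝ) 1) :=
  (measurableEmbedding_affine x hs).integrable_map_iff

lemma segmentMeasure_singleton (x : ℝ) {s : ℝ} (hs : s ≠ 0) (y : ℝ) :
    segmentMeasure x s {y} = 0 := by
  unfold segmentMeasure
  rw [(measurableEmbedding_affine x hs).map_apply]
  have : ((fun u => x + s * u) ⁻¹' {y}).Subsingleton := by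
    intro u hu v hv
    simp only [mem_preimage, mem_singleton_iff] at hu hv
    exact mul_left_cancel₀ hs (by linarith)
  exact this.measure_zero _

lemma segmentMeasure_mem (x : ℝ) {s : ℝ} (hs : s ≠ 0) {K : Set ℝ}
    (hK : ∀ u ∈ Icc (0 : ℝ) 1, x + s * u ∈ K) : segmentMeasure x s Kᶜ = 0 := by
  unfold segmentMeasure
  rw [(measurableEmbedding_affine x hs).map_apply]
  refine measure_mono_null (t := (Icc 0 1)ᶜ) (fun u hu hu' => hu (hK u hu')) ?_
  rw [Measure.restrict_apply measurableSet_Icc.compl]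
  simp

lemma integrable_logOneAdd_segmentMeasure (x : ℝ) {s : ℝ} (hs : s ≠ 0) :
    Integrable logOneAdd (segmentMeasure x s) := by
  rw [integrable_segmentMeasure x hs]
  exact (continuous_logOneAdd.comp (by fun_prop)).continuousOn.integrableOn_Icc

lemma integral_log_segmentMeasure (x y : ℝ) {s : ℝ} (hs : s ≠ 0) :
    ∫ t, Real.log |y - t| ∂(segmentMeasure x s) = avgLog (x - y) s := by
  rw [integral_segmentMeasure x hs]
  unfold avgLog
  refine integral_congr_ae (Eventually.of_forall fun u => ?_)
  simp only
  rw [← abs_neg]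
  congr 2; ring

lemma integrable_log_sub_segmentMeasure (x y : ℝ) {s : ℝ} (hs : s ≠ 0) :
    Integrable (fun t => Real.log |y - t|) (segmentMeasure x s) := by
  rw [integrable_segmentMeasure x hs]
  refine (integrableOn_log_affine hs (x - y)).congr_fun (fun u _ => ?_) measurableSet_Icc
  simp only
  rw [← abs_neg]
  congr 2; ring

/-- Since the logarithm has the nonnegative upper bound `logOneAdd x + logOneAdd y`, a lower bound
on its integral already controls the integral of its absolute value. -/
lemma abs_log_abs_le (x y : ℝ) :
    |(Real.log |x - y|)| ≤ 2 * (logOneAdd x + logOneAdd y) - Real.log |x - y| := by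
  have h := log_abs_sub_le x y
  have h1 := logOneAdd_nonneg x
  have h2 := logOneAdd_nonneg y
  rw [abs_le]
  constructor <;> linarith

lemma measurable_log_abs_sub : Measurable fun p : ℝ × ℝ => Real.log |p.1 - p.2| := by
  fun_prop

/-- Tonelli: the inner integral of `|ln|` over the segment is bounded through `abs_log_abs_le` and
the uniform lower bound `avgLog_ge_scale`. -/
lemma integrable_log_prod_segmentMeasure {ν : Measure ℝ} [IsFiniteMeasure ν]
    (h1 : Integrable logOneAdd ν) (x : ℝ) {s : ℝ} (hs : s ≠ 0) :
    Integrable (fun p : ℝ × ℝ => Real.log |p.1 - p.2|) (ν.prod (segmentMeasure x s)) := by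
  rw [integrable_prod_iff measurable_log_abs_sub.aestronglyMeasurable]
  refine ⟨Eventually.of_forall fun y => integrable_log_sub_segmentMeasure x y hs, ?_⟩
  set m := ∫ t, logOneAdd t ∂(segmentMeasure x s) with hm
  have hi := integrable_logOneAdd_segmentMeasure x hs
  refine Integrable.mono' (g := fun y => 2 * (logOneAdd y + m) - (Real.log |s| - 2))
    (((h1.add (integrable_const m)).const_mul 2).sub (integrable_const _))
    (measurable_log_abs_sub.norm.stronglyMeasurable.integral_prod_right).aestronglyMeasurable ?_
  refine Eventually.of_forall fun y => ?_
  have hpos : 0 ≤ ∫ t, ‖Real.log |y - t|‖ ∂(segmentMeasure x s) :=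
    integral_nonneg fun t => norm_nonneg _
  rw [Real.norm_of_nonneg hpos]
  have hi2 : Integrable (fun t => 2 * (logOneAdd y + logOneAdd t)) (segmentMeasure x s) :=
    ((integrable_const _).add hi).const_mul 2
  have hle := integral_mono (integrable_log_sub_segmentMeasure x y hs).norm
    (hi2.sub (integrable_log_sub_segmentMeasure x y hs)) fun t => abs_log_abs_le y t
  refine hle.trans ?_
  simp only [Pi.sub_apply]
  rw [integral_sub hi2 (integrable_log_sub_segmentMeasure x y hs), integral_log_segmentMeasure x y hs,
    integral_const_mul, integral_add (integrable_const _) hi]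
  have := avgLog_ge_scale hs (x - y)
  simp only [integral_const, probReal_univ, smul_eq_mul, one_mul]
  linarith

/-- `∬ ln |x - y| dν(x) dν'(y)`. -/
noncomputable def logEnergy (ν ν' : Measure ℝ) : ℝ :=
  ∫ p : ℝ × ℝ, Real.log |p.1 - p.2| ∂(ν.prod ν')

lemma logEnergy_comm (ν ν' : Measure ℝ) [SFinite ν] [SFinite ν'] :
    logEnergy ν ν' = logEnergy ν' ν := by
  unfold logEnergy
  rw [← integral_prod_swap]
  refine integral_congr_ae (Eventually.of_forall fun p => ?_)
  simp only [Prod.fst_swap, Prod.snd_swap]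
  rw [abs_sub_comm]

lemma integrable_log_swap {ν ν' : Measure ℝ} [SFinite ν] [SFinite ν']
    (h : Integrable (fun p : ℝ × ℝ => Real.log |p.1 - p.2|) (ν.prod ν')) :
    Integrable (fun p : ℝ × ℝ => Real.log |p.1 - p.2|) (ν'.prod ν) := by
  refine h.swap.congr (Eventually.of_forall fun p => ?_)
  simp only [Function.comp, Prod.fst_swap, Prod.snd_swap]
  rw [abs_sub_comm]

lemma nonneg_of_forall_small {a b : ℝ} (h : ∀ t ∈ Ioc (0 : ℝ) 1, 0 ≤ t * a + t ^ 2 * b) :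
    0 ≤ a := by
  have h1 : ∀ᶠ t : ℝ in 𝓝[>] 0, 0 ≤ a + t * b := by
    filter_upwards [Ioc_mem_nhdsGT one_pos] with t ht
    have := h t ht
    have h2 : t * a + t ^ 2 * b = t * (a + t * b) := by ring
    rw [h2] at this
    exact nonneg_of_mul_nonneg_right this ht.1
  have h2 : Tendsto (fun t : ℝ => a + t * b) (𝓝[>] 0) (𝓝 (a + 0 * b)) :=
    Tendsto.mono_left (Continuous.tendsto (by fun_prop) 0) nhdsWithin_le_nhds
  simpa using ge_of_tendsto h2 h1

/-- The first variation of the energy at an equilibrium measure is nonnegative. -/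
theorem IsEquilibriumMeasure.variation {V : ℝ → ℝ} {I : Set ℝ} {μ : Measure ℝ}
    (h : IsEquilibriumMeasure V I μ) {ρ : Measure ℝ} (hρ : HasFiniteEnergy V I ρ)
    (hc : Integrable (fun p : ℝ × ℝ => Real.log |p.1 - p.2|) (μ.prod ρ)) :
    (∫ x, V x ∂μ) / 2 - logEnergy μ μ ≤ (∫ x, V x ∂ρ) / 2 - logEnergy μ ρ := by
  obtain ⟨hμ, hmin⟩ := h
  have := hμ.isProbabilityMeasure
  have := hρ.isProbabilityMeasure
  -- The energy of `(1 - t) μ + t ρ` minus that of `μ` is `t d + t² b`, with `b` the value supplied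
  -- to `nonneg_of_forall_small`. Minimality for small `t` forces `d ≥ 0`.
  set d := 2 * (((∫ x, V x ∂ρ) / 2 - logEnergy μ ρ) - ((∫ x, V x ∂μ) / 2 - logEnergy μ μ)) with hd
  suffices 0 ≤ d by linarith
  refine nonneg_of_forall_small (b := 2 * logEnergy μ ρ - logEnergy μ μ - logEnergy ρ ρ)
    fun t ht => ?_
  set a : NNReal := ⟨1 - t, by linarith [ht.2]⟩ with ha
  set b : NNReal := ⟨t, ht.1.le⟩ with hb
  have hab : a + b = 1 := by
    apply NNReal.coe_injective
    change 1 - t + t = 1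
    ring
  have hc' := integrable_log_swap hc
  have hprod : (a • μ + b • ρ).prod (a • μ + b • ρ) = (a • a • μ.prod μ + b • a • ρ.prod μ)
      + (a • b • μ.prod ρ + b • b • ρ.prod ρ) := by
    rw [Measure.prod_add, Measure.add_prod, Measure.add_prod]
    simp only [Measure.prod_smul_left, Measure.prod_smul_right]
    rw [smul_comm b a (μ.prod ρ), smul_comm a b (ρ.prod μ)]
  have i1 := (hμ.integrable_log.smul_measure_nnreal (c := a)).smul_measure_nnreal (c := a)
  have i2 := (hc'.smul_measure_nnreal (c := a)).smul_measure_nnreal (c := b)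
  have i3 := (hc.smul_measure_nnreal (c := b)).smul_measure_nnreal (c := a)
  have i4 := (hρ.integrable_log.smul_measure_nnreal (c := b)).smul_measure_nnreal (c := b)
  have hfe : HasFiniteEnergy V I (a • μ + b • ρ) := by
    refine ⟨⟨?_⟩, ?_, fun x => ?_, ?_, ?_⟩
    · simp only [Measure.coe_add, Measure.coe_nnreal_smul_apply, Pi.add_apply, measure_univ, mul_one]
      exact_mod_cast hab
    · simp [hμ.carrier, hρ.carrier]
    · simp [hμ.noAtoms, hρ.noAtoms]
    · exact hμ.integrable_potential.smul_measure_nnreal.add_measure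
        hρ.integrable_potential.smul_measure_nnreal
    · rw [hprod]
      exact (i1.add_measure i2).add_measure (i3.add_measure i4)
  have hle := hmin _ hfe
  have e1 : ∫ x, V x ∂(a • μ + b • ρ) = (1 - t) * ∫ x, V x ∂μ + t * ∫ x, V x ∂ρ := by
    rw [integral_add_measure hμ.integrable_potential.smul_measure_nnreal
        hρ.integrable_potential.smul_measure_nnreal, integral_smul_nnreal_measure,
      integral_smul_nnreal_measure]
    rfl
  have e2 : logEnergy (a • μ + b • ρ) (a • μ + b • ρ) = (1 - t) * ((1 - t) * logEnergy μ μ) +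
      t * ((1 - t) * logEnergy ρ μ) + ((1 - t) * (t * logEnergy μ ρ) +
      t * (t * logEnergy ρ ρ)) := by
    unfold logEnergy
    rw [hprod, integral_add_measure (i1.add_measure i2) (i3.add_measure i4),
      integral_add_measure i1 i2, integral_add_measure i3 i4]
    simp only [integral_smul_nnreal_measure]
    rfl
  unfold energy at hle
  change _ - logEnergy μ μ ≤ _ - logEnergy _ _ at hle
  rw [e1, e2, logEnergy_comm ρ μ] at hle
  rw [hd]
  nlinarith [hle]

end BetaEnsemble

/-! ### Growth of the potential and regularized potentials -/

namespace BetaEnsemble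

open scoped Topology

lemma isClosed_interval (b c : EReal) : IsClosed (interval b c) :=
  (isClosed_le continuous_const continuous_coe_real_ereal).inter
    (isClosed_le continuous_coe_real_ereal continuous_const)

lemma ordConnected_interval (b c : EReal) : (interval b c).OrdConnected := by
  refine ⟨fun x hx y hy z hz => ⟨hx.1.trans ?_, le_trans ?_ hy.2⟩⟩
  · exact_mod_cast hz.1
  · exact_mod_cast hz.2

/-- At the right end point of the interval the segment has to run to the left, so `r` may be
negative. -/
lemma exists_segment_subset {b c : EReal} (hbc : b < c) {x : ℝ} (hx : x ∈ interval b c) :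
    ∃ r : ℝ, r ≠ 0 ∧ ∀ u ∈ Icc (0 : ℝ) 1, x + r * u ∈ interval b c := by
  have key : ∀ y ∈ interval b c, ∀ u ∈ Icc (0 : ℝ) 1, x + (y - x) * u ∈ interval b c := by
    intro y hy u hu
    have hc : Convex ℝ (interval b c) := (ordConnected_interval b c).convex
    have := hc.add_smul_sub_mem hx hy hu
    simpa [mul_comm] using this
  rcases hx.2.lt_or_eq with h | h
  · obtain ⟨y, h1, h2⟩ := EReal.lt_iff_exists_real_btwn.1 h
    have h1' : x < y := by exact_mod_cast h1
    exact ⟨y - x, by linarith [h1'] |> fun h : y - x ≠ 0 => h, key y ⟨hx.1.trans h1.le, h2.le⟩⟩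
  · rw [← h] at hbc
    obtain ⟨y, h1, h2⟩ := EReal.lt_iff_exists_real_btwn.1 hbc
    have h2' : y < x := by exact_mod_cast h2
    exact ⟨y - x, sub_ne_zero.2 h2'.ne, key y ⟨h1.le, h2.le.trans hx.2⟩⟩

lemma exists_growth_of_liminf {V : ℝ → ℝ} {l : Filter ℝ}
    (h : 1 < liminf (fun x : ℝ => ((V x / (2 * Real.log |x|) : ℝ) : EReal)) l) :
    ∃ q : ℝ, 1 < q ∧ ∀ᶠ x in l, q < V x / (2 * Real.log |x|) := by
  obtain ⟨q, h1, h2⟩ := EReal.lt_iff_exists_real_btwn.1 h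
  refine ⟨q, by exact_mod_cast h1, ?_⟩
  filter_upwards [eventually_lt_of_lt_liminf h2] with x hx
  exact_mod_cast hx

lemma IsConfining.exists_growth_atTop {V : ℝ → ℝ} {bm bp : EReal} (hV : IsConfining V bm bp) :
    ∃ q : ℝ, 1 < q ∧ ∃ R : ℝ, ∀ x ∈ interval bm bp, R ≤ x → q < V x / (2 * Real.log |x|) := by
  by_cases h : bp = ⊤
  · obtain ⟨q, hq, h1⟩ := exists_growth_of_liminf (hV.atTop h)
    obtain ⟨R, hR⟩ := eventually_atTop.1 h1
    exact ⟨q, hq, R, fun x _ hx => hR x hx⟩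
  -- At a finite end the threshold lies outside the interval, so the claim is vacuous and `2` is
  -- arbitrary.
  · refine ⟨2, by norm_num, bp.toReal + 1, fun x hx hx' => ?_⟩
    exfalso
    have h1 : x ≤ bp.toReal := by
      have := hx.2.trans (EReal.le_coe_toReal h)
      exact_mod_cast this
    linarith

lemma IsConfining.exists_growth_atBot {V : ℝ → ℝ} {bm bp : EReal} (hV : IsConfining V bm bp) :
    ∃ q : ℝ, 1 < q ∧ ∃ R : ℝ, ∀ x ∈ interval bm bp, x ≤ R → q < V x / (2 * Real.log |x|) := by
  by_cases h : bm = ⊥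
  · obtain ⟨q, hq, h1⟩ := exists_growth_of_liminf (hV.atBot h)
    obtain ⟨R, hR⟩ := eventually_atBot.1 h1
    exact ⟨q, hq, R, fun x _ hx => hR x hx⟩
  · refine ⟨2, by norm_num, bm.toReal - 1, fun x hx hx' => ?_⟩
    exfalso
    have h1 : bm.toReal ≤ x := by
      have := (EReal.coe_toReal_le h).trans hx.1
      exact_mod_cast this
    linarith

/-- A confining potential grows faster than `2 (1 + δ) ln (1 + |x|)`. -/
theorem IsConfining.exists_growth {V : ℝ → ℝ} {bm bp : EReal} (hV : IsConfining V bm bp) :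
    ∃ δ : ℝ, 0 < δ ∧ ∃ C : ℝ, ∀ x ∈ interval bm bp, (1 + δ) * logOneAdd x - C ≤ V x / 2 := by
  obtain ⟨q₁, hq₁, R₁, h₁⟩ := hV.exists_growth_atTop
  obtain ⟨q₂, hq₂, R₂, h₂⟩ := hV.exists_growth_atBot
  set q := min q₁ q₂ with hq
  have hq1 : 1 < q := lt_min hq₁ hq₂
  set R := max 2 (max |R₁| |R₂|) with hR
  have hfar : ∀ x ∈ interval bm bp, R ≤ |x| → q * logOneAdd x - q * Real.log 2 ≤ V x / 2 := by
    intro x hx hRx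
    have hx2 : 2 ≤ |x| := (le_max_left _ _).trans hRx
    have hlog : 0 < Real.log |x| := Real.log_pos (by linarith)
    have h3 : q < V x / (2 * Real.log |x|) := by
      rcases le_total 0 x with h0 | h0
      · refine (min_le_left _ _).trans_lt (h₁ x hx ?_)
        rw [abs_of_nonneg h0] at hRx
        exact (le_abs_self _).trans (((le_max_left _ _).trans (le_max_right _ _)).trans hRx)
      · refine (min_le_right _ _).trans_lt (h₂ x hx ?_)
        rw [abs_of_nonpos h0] at hRx
        have : |R₂| ≤ -x := ((le_max_right _ _).trans (le_max_right _ _)).trans hRx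
        linarith [neg_abs_le R₂]
    rw [lt_div_iff₀ (by positivity)] at h3
    have h4 : logOneAdd x ≤ Real.log 2 + Real.log |x| := by
      unfold logOneAdd
      rw [← Real.log_mul (by norm_num) (by positivity)]
      exact Real.log_le_log (by positivity) (by linarith)
    nlinarith
  have hcpt : IsCompact (interval bm bp ∩ Icc (-R) R) :=
    isCompact_Icc.inter_left (isClosed_interval bm bp)
  obtain ⟨m, hm⟩ := (hcpt.image_of_continuousOn
    (hV.continuousOn.mono inter_subset_left)).bddBelow
  have hR0 : 0 ≤ R := le_trans (by norm_num) (le_max_left _ _)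
  refine ⟨q - 1, by linarith, max (q * Real.log 2) (q * Real.log (1 + R) - m / 2),
    fun x hx => ?_⟩
  rw [show 1 + (q - 1) = q by ring]
  rcases le_total R |x| with h | h
  · linarith [hfar x hx h, le_max_left (q * Real.log 2) (q * Real.log (1 + R) - m / 2)]
  · have h5 : m ≤ V x := hm (mem_image_of_mem _ ⟨hx, abs_le.1 h⟩)
    have h6 : logOneAdd x ≤ Real.log (1 + R) := by
      unfold logOneAdd
      exact Real.log_le_log (by positivity) (by linarith)
    have := le_max_right (q * Real.log 2) (q * Real.log (1 + R) - m / 2)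
    nlinarith

/-- The potential `∫ ½ ln ((x - y)² + κ²) dν(y)`. -/
noncomputable def regPotential (κ : ℝ) (ν : Measure ℝ) (x : ℝ) : ℝ := ∫ y, regLog κ (x - y) ∂ν

lemma continuous_regPotential {κ : ℝ} (hκ : 0 < κ) (hκ1 : κ ≤ 1) {ν : Measure ℝ}
    [IsFiniteMeasure ν] (h : Integrable logOneAdd ν) : Continuous (regPotential κ ν) := by
  rw [continuous_iff_continuousAt]
  intro x₀
  unfold regPotential
  refine continuousAt_of_dominated
    (bound := fun y => (|Real.log κ| + (logOneAdd x₀ + 1)) + logOneAdd y) ?_ ?_ ?_ ?_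
  · exact Eventually.of_forall fun x =>
      ((continuous_regLog hκ).comp (by fun_prop)).aestronglyMeasurable
  · have : ∀ᶠ x in 𝓝 x₀, logOneAdd x < logOneAdd x₀ + 1 :=
      (continuous_logOneAdd.tendsto x₀).eventually_lt_const (by linarith)
    filter_upwards [this] with x hx
    refine Eventually.of_forall fun y => (abs_regLog_sub_le hκ hκ1 x y).trans ?_
    linarith
  · exact (integrable_const _).add h
  · exact Eventually.of_forall fun y =>
      ((continuous_regLog hκ).comp (by fun_prop)).continuousAt

lemma regPotential_mono {κ κ' : ℝ} (hκ : 0 < κ) (h : κ ≤ κ') (hκ1 : κ' ≤ 1) {ν : Measure ℝ}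
    [IsFiniteMeasure ν] (hν : Integrable logOneAdd ν) (x : ℝ) :
    regPotential κ ν x ≤ regPotential κ' ν x :=
  integral_mono (integrable_regLog_sub hκ (h.trans hκ1) hν x)
    (integrable_regLog_sub (hκ.trans_le h) hκ1 hν x) fun _ => regLog_mono hκ h _

lemma regPotential_le {κ : ℝ} (hκ : 0 < κ) (hκ1 : κ ≤ 1) {ν : Measure ℝ}
    [IsProbabilityMeasure ν] (hν : Integrable logOneAdd ν) (x : ℝ) :
    regPotential κ ν x ≤ logOneAdd x + ∫ y, logOneAdd y ∂ν := by
  have := integral_mono (integrable_regLog_sub hκ hκ1 hν x) ((integrable_const (logOneAdd x)).add hν)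
    fun y => regLog_sub_le hκ hκ1 x y
  refine this.trans_eq ?_
  simp only [Pi.add_apply]
  rw [integral_add (integrable_const _) hν]
  simp

lemma potential_le_regPotential {κ : ℝ} (hκ : 0 < κ) (hκ1 : κ ≤ 1) {ν : Measure ℝ}
    [IsFiniteMeasure ν] (hν : Integrable logOneAdd ν) {x : ℝ} (hx : ν {x} = 0)
    (hlog : Integrable (fun y => Real.log |x - y|) ν) : potential ν x ≤ regPotential κ ν x := by
  refine integral_mono_ae hlog (integrable_regLog_sub hκ hκ1 hν x) ?_
  filter_upwards [ae_ne_of_noAtoms x hx] with y hy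
  exact log_le_regLog κ hy

lemma potential_le {ν : Measure ℝ} [IsProbabilityMeasure ν] (hν : Integrable logOneAdd ν) (x : ℝ) :
    potential ν x ≤ logOneAdd x + ∫ y, logOneAdd y ∂ν := by
  by_cases h : Integrable (fun y => Real.log |x - y|) ν
  · have := integral_mono h ((integrable_const (logOneAdd x)).add hν) fun y => log_abs_sub_le x y
    refine this.trans_eq ?_
    simp only [Pi.add_apply]
    rw [integral_add (integrable_const _) hν]
    simp
  -- Without integrability the integral is `0` by convention, which still satisfies the bound.
  · unfold potential
    rw [integral_undef h]
    have : 0 ≤ ∫ y, logOneAdd y ∂ν := integral_nonneg fun y => logOneAdd_nonneg y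
    linarith [logOneAdd_nonneg x]

/-- The sequence of scales `1 / (n + 1)`. -/
noncomputable def scale (n : ℕ) : ℝ := 1 / ((n : ℝ) + 1)

lemma scale_pos (n : ℕ) : 0 < scale n := by unfold scale; positivity

lemma scale_le_one (n : ℕ) : scale n ≤ 1 := by
  unfold scale
  rw [div_le_one (by positivity)]
  have : (0 : ℝ) ≤ n := n.cast_nonneg
  linarith

lemma tendsto_scale : Tendsto scale atTop (𝓝[>] 0) :=
  tendsto_nhdsWithin_iff.2 ⟨tendsto_one_div_add_atTop_nhds_zero_nat,
    Eventually.of_forall scale_pos⟩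

lemma tendsto_regPotential {ν : Measure ℝ} [IsFiniteMeasure ν] (hν : Integrable logOneAdd ν)
    {x : ℝ} (hx : ν {x} = 0) (hlog : Integrable (fun y => Real.log |x - y|) ν) :
    Tendsto (fun n => regPotential (scale n) ν x) atTop (𝓝 (potential ν x)) := by
  refine tendsto_integral_of_dominated_convergence
    (fun y => |(Real.log |x - y|)| + |regLog 1 (x - y)|) (fun n =>
      ((continuous_regLog (scale_pos n)).comp (by fun_prop)).aestronglyMeasurable)
    (hlog.abs.add (integrable_regLog_sub one_pos le_rfl hν x).abs) (fun n => ?_) ?_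
  · filter_upwards [ae_ne_of_noAtoms x hx] with y hy
    have h1 := log_le_regLog (scale n) hy
    have h2 := regLog_mono (scale_pos n) (scale_le_one n) (x - y)
    rw [Real.norm_eq_abs, abs_le]
    constructor
    · linarith [neg_abs_le (Real.log |x - y|), abs_nonneg (regLog 1 (x - y))]
    · linarith [le_abs_self (regLog 1 (x - y)), abs_nonneg (Real.log |x - y|)]
  · filter_upwards [ae_ne_of_noAtoms x hx] with y hy
    exact (tendsto_regLog_zero hy).comp tendsto_scale

/-- Fatou's lemma: `regLog 1 - regLog (scale n)` is nonnegative, converges to `regLog 1 - ln`, and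
has integral at most `regPotential 1 ν x - b`. -/
lemma integrable_log_of_le_regPotential {ν : Measure ℝ} [IsFiniteMeasure ν]
    (hν : Integrable logOneAdd ν) {x : ℝ} (hx : ν {x} = 0) {b : ℝ}
    (hb : ∀ n, b ≤ regPotential (scale n) ν x) : Integrable (fun y => Real.log |x - y|) ν := by
  have hi : ∀ n, Integrable (fun y => regLog 1 (x - y) - regLog (scale n) (x - y)) ν := fun n =>
    (integrable_regLog_sub one_pos le_rfl hν x).sub
      (integrable_regLog_sub (scale_pos n) (scale_le_one n) hν x)
  have h1 : Integrable (fun y => regLog 1 (x - y) - Real.log |x - y|) ν := by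
    refine integrable_of_tendsto
      (G := fun n y => regLog 1 (x - y) - regLog (scale n) (x - y)) ?_
      (fun n => (hi n).aestronglyMeasurable) ?_
    · filter_upwards [ae_ne_of_noAtoms x hx] with y hy
      exact ((tendsto_regLog_zero hy).comp tendsto_scale).const_sub _
    · have hle : ∀ n, ∫⁻ y, ‖regLog 1 (x - y) - regLog (scale n) (x - y)‖ₑ ∂ν ≤
          ENNReal.ofReal (regPotential 1 ν x - b) := by
        intro n
        rw [← ofReal_integral_norm_eq_lintegral_enorm (hi n)]
        apply ENNReal.ofReal_le_ofReal
        have e : ∀ y, ‖regLog 1 (x - y) - regLog (scale n) (x - y)‖ =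
            regLog 1 (x - y) - regLog (scale n) (x - y) := fun y =>
          Real.norm_of_nonneg (sub_nonneg.2 (regLog_mono (scale_pos n) (scale_le_one n) _))
        simp only [e]
        rw [integral_sub (integrable_regLog_sub one_pos le_rfl hν x)
          (integrable_regLog_sub (scale_pos n) (scale_le_one n) hν x)]
        have := hb n
        unfold regPotential at this ⊢
        linarith
      refine ne_top_of_le_ne_top ENNReal.ofReal_ne_top (?_ : _ ≤
        ENNReal.ofReal (regPotential 1 ν x - b))
      exact liminf_le_of_le (by isBoundedDefault) fun c hc => by
        obtain ⟨n, hn⟩ := hc.exists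
        exact hn.trans (hle n)
  have := (integrable_regLog_sub one_pos le_rfl hν x).sub h1
  refine this.congr (Eventually.of_forall fun y => ?_)
  simp

/-! ### Euler-Lagrange conditions, compact support and the gap of the rate function -/

/-- The constant of the Euler-Lagrange equation. -/
noncomputable def robinConstant (V : ℝ → ℝ) (μ : Measure ℝ) : ℝ :=
  (∫ x, V x ∂μ) / 2 - logEnergy μ μ

section Equilibrium

variable {V : ℝ → ℝ} {bm bp : EReal} {μ : Measure ℝ}

lemma HasFiniteEnergy.ae_mem {I : Set ℝ} (h : HasFiniteEnergy V I μ) : ∀ᵐ x ∂μ, x ∈ I :=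
  h.carrier

lemma HasFiniteEnergy.integrable_logOneAdd (hV : IsConfining V bm bp)
    (h : HasFiniteEnergy V (interval bm bp) μ) : Integrable logOneAdd μ := by
  have := h.isProbabilityMeasure
  obtain ⟨δ, hδ, C, hC⟩ := hV.exists_growth
  refine Integrable.mono' (g := fun x => V x / 2 + C)
    ((h.integrable_potential.div_const 2).add (integrable_const C))
    continuous_logOneAdd.aestronglyMeasurable ?_
  filter_upwards [h.ae_mem] with x hx
  rw [Real.norm_of_nonneg (logOneAdd_nonneg x)]
  have := hC x hx
  nlinarith [logOneAdd_nonneg x]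

lemma hasFiniteEnergy_segmentMeasure (hV : ContinuousOn V (interval bm bp)) {x s : ℝ}
    (hs : s ≠ 0) (hx : ∀ u ∈ Icc (0 : ℝ) 1, x + s * u ∈ interval bm bp) :
    HasFiniteEnergy V (interval bm bp) (segmentMeasure x s) where
  isProbabilityMeasure := inferInstance
  carrier := segmentMeasure_mem x hs hx
  noAtoms := segmentMeasure_singleton x hs
  integrable_potential := by
    rw [integrable_segmentMeasure x hs]
    exact (hV.comp (by fun_prop) hx).integrableOn_Icc
  integrable_log := integrable_log_prod_segmentMeasure (integrable_logOneAdd_segmentMeasure x hs) x hs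

lemma logEnergy_segmentMeasure [IsFiniteMeasure μ] (h1 : Integrable logOneAdd μ) (x : ℝ) {s : ℝ}
    (hs : s ≠ 0) : logEnergy μ (segmentMeasure x s) = ∫ y, avgLog (x - y) s ∂μ := by
  unfold logEnergy
  rw [integral_prod _ (integrable_log_prod_segmentMeasure h1 x hs)]
  simp only [integral_log_segmentMeasure x _ hs]

/-- The average of the rate function over a short segment that starts at `x` is close to its value
at `x`. -/
lemma eventually_segment_rate_le (hV : ContinuousOn V (interval bm bp)) [IsProbabilityMeasure μ]
    (h1 : Integrable logOneAdd μ) {x r : ℝ} (hr : r ≠ 0)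
    (hx : ∀ u ∈ Icc (0 : ℝ) 1, x + r * u ∈ interval bm bp) (hμ : μ {x} = 0)
    (hlog : Integrable (fun y => Real.log |x - y|) μ) {e : ℝ} (he : 0 < e) :
    ∀ᶠ t : ℝ in 𝓝[>] 0, (∫ y, V y ∂(segmentMeasure x (r * t))) / 2 -
      logEnergy μ (segmentMeasure x (r * t)) ≤ rate V μ x + e := by
  have hlim0 : Tendsto (fun t : ℝ => r * t) (𝓝[>] 0) (𝓝[≠] 0) := by
    refine tendsto_nhdsWithin_iff.2 ⟨?_, ?_⟩
    · have : Tendsto (fun t : ℝ => r * t) (𝓝 0) (𝓝 (r * 0)) := Continuous.tendsto (by fun_prop) 0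
      rw [mul_zero] at this
      exact this.mono_left nhdsWithin_le_nhds
    · filter_upwards [self_mem_nhdsWithin] with t ht
      exact mul_ne_zero hr (ne_of_gt ht)
  have hpot := ((tendsto_integral_avgLog h1 hμ hlog).comp hlim0).eventually_const_lt
    (show potential μ x - e / 2 < potential μ x by linarith)
  have hxI : x ∈ interval bm bp := by simpa using hx 0 (by simp)
  have hVx : ∀ᶠ y in 𝓝[interval bm bp] x, V y < V x + e :=
    (hV x hxI).eventually_lt_const (by linarith)
  obtain ⟨d, hd, hVd⟩ := Metric.mem_nhdsWithin_iff.1 hVx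
  have hsmall : ∀ᶠ t : ℝ in 𝓝[>] 0, |r| * t < d := by
    have : Tendsto (fun t : ℝ => |r| * t) (𝓝[>] 0) (𝓝 (|r| * 0)) :=
      (Continuous.tendsto (by fun_prop) 0).mono_left nhdsWithin_le_nhds
    exact this.eventually_lt_const (by simpa using hd)
  filter_upwards [hpot, hsmall, Ioc_mem_nhdsGT (one_pos : (0 : ℝ) < 1)] with t h2 h3 ht
  have hs : r * t ≠ 0 := mul_ne_zero hr ht.1.ne'
  have hmem : ∀ u ∈ Icc (0 : ℝ) 1, x + r * t * u ∈ interval bm bp := fun u hu => by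
    rw [mul_assoc]
    exact hx _ ⟨mul_nonneg ht.1.le hu.1, mul_le_one₀ ht.2 hu.1 hu.2⟩
  rw [logEnergy_segmentMeasure h1 x hs]
  simp only [Function.comp] at h2
  have h4 : ∫ y, V y ∂(segmentMeasure x (r * t)) ≤ V x + e := by
    rw [integral_segmentMeasure x hs]
    have := setIntegral_mono_on (hV.comp (by fun_prop) hmem).integrableOn_Icc
      (integrableOn_const (C := V x + e) (s := Icc (0 : ℝ) 1) (μ := volume) (by simp))
      measurableSet_Icc fun u hu => by
        refine le_of_lt (hVd ⟨?_, hmem u hu⟩)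
        rw [Metric.mem_ball, Real.dist_eq, add_sub_cancel_left, abs_mul, abs_mul,
          abs_of_pos ht.1, abs_of_nonneg hu.1]
        refine lt_of_le_of_lt (mul_le_of_le_one_right ?_ hu.2) h3
        exact mul_nonneg (abs_nonneg _) ht.1.le
    simpa using this
  unfold rate
  unfold potential at h2
  linarith

variable (hbm : bm < bp) (hV : IsConfining V bm bp)
  (hμ : IsEquilibriumMeasure V (interval bm bp) μ)

include hbm hV hμ

/-- The variation inequality is tested on uniform measures of short segments at `x`. Their averaged
rate is at most `rate V μ x + e` once they are short enough. -/
lemma robinConstant_le_rate_of_integrable {x : ℝ} (hx : x ∈ interval bm bp)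
    (hlog : Integrable (fun y => Real.log |x - y|) μ) : robinConstant V μ ≤ rate V μ x := by
  have := hμ.1.isProbabilityMeasure
  have h1 := hμ.1.integrable_logOneAdd hV
  obtain ⟨r, hr, hseg⟩ := exists_segment_subset hbm hx
  refine le_of_forall_pos_le_add fun e he => ?_
  obtain ⟨t, ht, ht1⟩ := ((eventually_segment_rate_le hV.continuousOn h1 hr hseg (hμ.1.noAtoms x)
    hlog he).and (Ioc_mem_nhdsGT (one_pos : (0 : ℝ) < 1))).exists
  have hs : r * t ≠ 0 := mul_ne_zero hr ht1.1.ne'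
  refine le_trans (hμ.variation (hasFiniteEnergy_segmentMeasure hV.continuousOn hs fun u hu => ?_)
    (integrable_log_prod_segmentMeasure h1 x hs)) ht
  rw [mul_assoc]
  exact hseg _ ⟨mul_nonneg ht1.1.le hu.1, mul_le_one₀ ht1.2 hu.1 hu.2⟩

/-- The excess of the rate over the constant is nonnegative almost everywhere and integrates to
zero. -/
lemma ae_rate_eq : ∀ᵐ x ∂μ, x ∈ interval bm bp ∧ Integrable (fun y => Real.log |x - y|) μ ∧
    rate V μ x = robinConstant V μ := by
  have := hμ.1.isProbabilityMeasure
  have hint := hμ.1.integrable_log.prod_right_ae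
  have hmem := hμ.1.ae_mem
  have hpi : Integrable (fun x => ∫ t, Real.log |x - t| ∂μ) μ := hμ.1.integrable_log.integral_prod_left
  have hri : Integrable (fun x => rate V μ x - robinConstant V μ) μ :=
    ((hμ.1.integrable_potential.div_const 2).sub hpi).sub (integrable_const _)
  have hzero : ∫ x, (rate V μ x - robinConstant V μ) ∂μ = 0 := by
    unfold rate
    have hd : Integrable (fun x => V x / 2 - ∫ t, Real.log |x - t| ∂μ) μ :=
      (hμ.1.integrable_potential.div_const 2).sub hpi
    rw [integral_sub hd (integrable_const _), integral_sub (hμ.1.integrable_potential.div_const 2) hpi, integral_div,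
      ← integral_prod _ hμ.1.integrable_log]
    simp [robinConstant, logEnergy]
  have hnn : 0 ≤ᵐ[μ] fun x => rate V μ x - robinConstant V μ := by
    filter_upwards [hint, hmem] with x hx hx'
    exact sub_nonneg.2 (robinConstant_le_rate_of_integrable hbm hV hμ hx' hx)
  have := (integral_eq_zero_iff_of_nonneg_ae hnn hri).1 hzero
  filter_upwards [hint, hmem, this] with x h1 h2 h3
  exact ⟨h2, h1, by simpa [sub_eq_zero] using h3⟩

/-- On the support of the equilibrium measure the rate function is equal to its minimum. -/
theorem rate_eq_of_mem_support {x : ℝ} (hx : x ∈ μ.support) :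
    x ∈ interval bm bp ∧ Integrable (fun y => Real.log |x - y|) μ ∧
      rate V μ x = robinConstant V μ := by
  have := hμ.1.isProbabilityMeasure
  have h1 := hμ.1.integrable_logOneAdd hV
  have hxI : x ∈ interval bm bp :=
    Measure.support_subset_of_isClosed (isClosed_interval bm bp) hμ.1.ae_mem hx
  have hae := ae_rate_eq hbm hV hμ
  have hcl : x ∈ closure {y | y ∈ interval bm bp ∧ Integrable (fun z => Real.log |y - z|) μ ∧
      rate V μ y = robinConstant V μ} :=
    Measure.support_subset_of_isClosed isClosed_closure
      (mem_of_superset hae subset_closure) hx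
  obtain ⟨y, hy, hylim⟩ := mem_closure_iff_seq_limit.1 hcl
  have hVlim : Tendsto (fun n => V (y n)) atTop (𝓝 (V x)) :=
    (hV.continuousOn x hxI).tendsto.comp
      (tendsto_nhdsWithin_iff.2 ⟨hylim, Eventually.of_forall fun n => (hy n).1⟩)
  -- The support lies in the closure of the set where equality holds. The potential itself need not
  -- be continuous, but its regularization is continuous and lies above it, so the inequality passes
  -- to limit points at each scale. Letting the scale tend to zero recovers the potential.
  have hb : ∀ n, V x / 2 - robinConstant V μ ≤ regPotential (scale n) μ x := by
    intro n
    refine le_of_tendsto_of_tendsto ((hVlim.div_const 2).sub_const (robinConstant V μ))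
      (((continuous_regPotential (scale_pos n) (scale_le_one n) h1).tendsto x).comp hylim)
      (Eventually.of_forall fun k => ?_)
    have h2 := potential_le_regPotential (scale_pos n) (scale_le_one n) h1 (hμ.1.noAtoms (y k))
      (hy k).2.1
    have h3 := (hy k).2.2
    unfold rate at h3
    unfold potential at h2
    simp only [Function.comp]
    linarith
  have hlog := integrable_log_of_le_regPotential h1 (hμ.1.noAtoms x) hb
  refine ⟨hxI, hlog, le_antisymm ?_ (robinConstant_le_rate_of_integrable hbm hV hμ hxI hlog)⟩
  have := ge_of_tendsto' (tendsto_regPotential h1 (hμ.1.noAtoms x) hlog) hb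
  unfold rate
  unfold potential at this
  linarith

/-- On the support the rate is constant, whereas it is at least a positive multiple of `logOneAdd x`
minus a constant. -/
lemma exists_support_subset : ∃ R : ℝ, μ.support ⊆ Icc (-R) R := by
  have := hμ.1.isProbabilityMeasure
  have h1 := hμ.1.integrable_logOneAdd hV
  obtain ⟨δ, hδ, C, hC⟩ := hV.exists_growth
  set m := ∫ y, logOneAdd y ∂μ with hm
  refine ⟨Real.exp ((robinConstant V μ + C + m) / δ), fun x hx => ?_⟩
  obtain ⟨hxI, _, hr⟩ := rate_eq_of_mem_support hbm hV hμ hx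
  have h2 := potential_le h1 x
  have h3 := hC x hxI
  unfold rate at hr
  unfold potential at h2
  have h4 : logOneAdd x ≤ (robinConstant V μ + C + m) / δ := by
    rw [le_div_iff₀ hδ]
    linarith
  unfold logOneAdd at h4
  rw [Real.log_le_iff_le_exp (by positivity)] at h4
  exact abs_le.1 (by linarith)

omit hbm hV in
lemma support_nonempty : μ.support.Nonempty := by
  have := hμ.1.isProbabilityMeasure
  exact Measure.nonempty_support (IsProbabilityMeasure.ne_zero μ)

lemma bddBelow_support : BddBelow μ.support := by
  obtain ⟨R, hR⟩ := exists_support_subset hbm hV hμ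
  exact bddBelow_Icc.mono hR

lemma bddAbove_support : BddAbove μ.support := by
  obtain ⟨R, hR⟩ := exists_support_subset hbm hV hμ
  exact bddAbove_Icc.mono hR

lemma leftEnd_mem : leftEnd μ ∈ μ.support :=
  Measure.isClosed_support.csInf_mem (support_nonempty hμ) (bddBelow_support hbm hV hμ)

lemma rightEnd_mem : rightEnd μ ∈ μ.support :=
  Measure.isClosed_support.csSup_mem (support_nonempty hμ) (bddAbove_support hbm hV hμ)

lemma support_subset_Icc : μ.support ⊆ Icc (leftEnd μ) (rightEnd μ) := fun _ hx =>
  ⟨csInf_le (bddBelow_support hbm hV hμ) hx, le_csSup (bddAbove_support hbm hV hμ) hx⟩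

lemma ae_mem_Icc : ∀ᵐ x ∂μ, x ∈ Icc (leftEnd μ) (rightEnd μ) := by
  filter_upwards [Measure.support_mem_ae (μ := μ)] with x hx
  exact support_subset_Icc hbm hV hμ hx

lemma Icc_subset_interval : Icc (leftEnd μ) (rightEnd μ) ⊆ interval bm bp :=
  (ordConnected_interval bm bp).out
    (rate_eq_of_mem_support hbm hV hμ (leftEnd_mem hbm hV hμ)).1
    (rate_eq_of_mem_support hbm hV hμ (rightEnd_mem hbm hV hμ)).1

lemma leftEnd_lt_rightEnd : leftEnd μ < rightEnd μ := by
  have := hμ.1.isProbabilityMeasure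
  by_contra hle
  have h : ∀ᵐ x ∂μ, x ∈ ({leftEnd μ} : Set ℝ) := by
    filter_upwards [ae_mem_Icc hbm hV hμ] with x hx
    rw [mem_singleton_iff]
    linarith [hx.1, hx.2, not_lt.1 hle]
  have h2 : ∀ᵐ x ∂μ, x ∉ ({leftEnd μ} : Set ℝ) :=
    measure_eq_zero_iff_ae_notMem.1 (hμ.1.noAtoms _)
  obtain ⟨x, hx, hx'⟩ := (h.and h2).exists
  exact hx' hx

/-- For the equilibrium measure the logarithm is integrable at every point. -/
lemma integrable_log_equilibrium (x : ℝ) :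
    Integrable (fun y => Real.log |x - y|) μ := by
  have := hμ.1.isProbabilityMeasure
  have h1 := hμ.1.integrable_logOneAdd hV
  by_cases hs : x ∈ μ.support
  · exact (rate_eq_of_mem_support hbm hV hμ hs).2.1
  · obtain ⟨r, hr, hball⟩ := Metric.isOpen_iff.1 Measure.isOpen_compl_support x hs
    refine Integrable.mono' (g := fun y => 2 * (logOneAdd x + logOneAdd y) - Real.log r)
      ((((integrable_const _).add h1).const_mul 2).sub (integrable_const _))
      (Measurable.aestronglyMeasurable (by fun_prop)) ?_
    filter_upwards [Measure.support_mem_ae (μ := μ)] with y hy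
    have hry : r ≤ |x - y| := by
      by_contra hlt
      have hyb : y ∈ Metric.ball x r := by
        rw [Metric.mem_ball, Real.dist_eq, abs_sub_comm]
        exact not_le.1 hlt
      exact hball hyb hy
    have := Real.log_le_log hr hry
    exact (abs_log_abs_le x y).trans (by linarith)

lemma robinConstant_le_rate {x : ℝ} (hx : x ∈ interval bm bp) : robinConstant V μ ≤ rate V μ x :=
  robinConstant_le_rate_of_integrable hbm hV hμ hx (integrable_log_equilibrium hbm hV hμ x)

omit hbm in
lemma exists_rate_growth : ∃ δ : ℝ, 0 < δ ∧ ∃ C : ℝ, ∀ x ∈ interval bm bp,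
    δ * logOneAdd x - C ≤ V x / 2 - regPotential 1 μ x := by
  have := hμ.1.isProbabilityMeasure
  have h1 := hμ.1.integrable_logOneAdd hV
  obtain ⟨δ, hδ, C, hC⟩ := hV.exists_growth
  refine ⟨δ, hδ, C + ∫ y, logOneAdd y ∂μ, fun x hx => ?_⟩
  linarith [regPotential_le one_pos le_rfl h1 x, hC x hx]

/-- At distance at least `ε` from the support the logarithm has no singularity, so dominated
convergence applies. -/
lemma continuousOn_rate_of_far {ε : ℝ} (hε : 0 < ε) (R : ℝ) :
    ContinuousOn (rate V μ) ((interval bm bp \ Ioo (leftEnd μ - ε) (rightEnd μ + ε)) ∩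
      Icc (-R) R) := by
  have := hμ.1.isProbabilityMeasure
  have h1 := hμ.1.integrable_logOneAdd hV
  have hfar : ∀ x ∈ (interval bm bp \ Ioo (leftEnd μ - ε) (rightEnd μ + ε)) ∩ Icc (-R) R,
      ∀ y ∈ Icc (leftEnd μ) (rightEnd μ), ε ≤ |x - y| := by
    intro x hx y hy
    rcases le_or_gt x (leftEnd μ - ε) with h | h
    · exact le_abs.2 (Or.inr (by linarith [hy.1]))
    · have : rightEnd μ + ε ≤ x := not_lt.1 fun h' => hx.1.2 ⟨h, h'⟩
      exact le_abs.2 (Or.inl (by linarith [hy.2]))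
  refine ((hV.continuousOn.mono fun x hx => hx.1.1).div_const 2).sub ?_
  refine continuousOn_of_dominated
    (bound := fun y => 2 * (logOneAdd R + logOneAdd y) - Real.log ε) ?_ ?_ ?_ ?_
  · exact fun x _ => Measurable.aestronglyMeasurable (by fun_prop)
  · intro x hx
    filter_upwards [ae_mem_Icc hbm hV hμ] with y hy
    have h2 := Real.log_le_log hε (hfar x hx y hy)
    have h3 : logOneAdd x ≤ logOneAdd R := by
      unfold logOneAdd
      have := abs_le.2 hx.2
      exact Real.log_le_log (by positivity) (by linarith [le_abs_self R])
    exact (abs_log_abs_le x y).trans (by linarith)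
  · exact ((((integrable_const _).add h1).const_mul 2).sub (integrable_const _))
  · filter_upwards [ae_mem_Icc hbm hV hμ] with y hy
    refine ContinuousOn.log (by fun_prop) fun x hx => ?_
    exact (hε.trans_le (hfar x hx y hy)).ne'

/-- Away from the convex hull of the support, the rate function exceeds its minimum by an amount
that grows logarithmically. -/
theorem exists_rate_gap
    (hmin : ∀ x ∈ interval bm bp, IsMinOn (rate V μ) (interval bm bp) x →
      x ∈ Icc (leftEnd μ) (rightEnd μ)) {ε : ℝ} (hε : 0 < ε) :
    ∃ c : ℝ, 0 < c ∧ ∀ a ∈ interval bm bp \ Ioo (leftEnd μ - ε) (rightEnd μ + ε),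
      robinConstant V μ + c * (1 + logOneAdd a) ≤ rate V μ a := by
  have := hμ.1.isProbabilityMeasure
  have h1 := hμ.1.integrable_logOneAdd hV
  obtain ⟨δ, hδ, C, hC⟩ := exists_rate_growth hV hμ
  set B := robinConstant V μ with hB
  -- Once `logOneAdd a ≥ M`, half of the growth `δ * logOneAdd a` absorbs the constants. Below `M`
  -- the point `a` lies in a compact set, where the rate attains a minimum.
  set M := max 0 (2 * (B + C + δ / 2) / δ) with hM
  set R := Real.exp M with hR
  have hlarge : ∀ a ∈ interval bm bp, M ≤ logOneAdd a →
      B + δ / 2 * (1 + logOneAdd a) ≤ rate V μ a := by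
    intro a ha hMa
    have h2 := hC a ha
    have h3 := potential_le_regPotential one_pos le_rfl h1 (hμ.1.noAtoms a)
      (integrable_log_equilibrium hbm hV hμ a)
    have h4 := (le_max_right _ _).trans hMa
    rw [div_le_iff₀ hδ] at h4
    unfold rate
    unfold potential at h3
    linarith
  have hnear : ∃ c : ℝ, 0 < c ∧ ∀ a ∈ (interval bm bp \ Ioo (leftEnd μ - ε) (rightEnd μ + ε)) ∩
      Icc (-R) R, B + c ≤ rate V μ a := by
    have hcpt : IsCompact ((interval bm bp \ Ioo (leftEnd μ - ε) (rightEnd μ + ε)) ∩ Icc (-R) R) :=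
      isCompact_Icc.inter_left ((isClosed_interval bm bp).sdiff isOpen_Ioo)
    rcases eq_empty_or_nonempty
      ((interval bm bp \ Ioo (leftEnd μ - ε) (rightEnd μ + ε)) ∩ Icc (-R) R) with he | hne
    · exact ⟨1, one_pos, fun a ha => by rw [he] at ha; exact ha.elim⟩
    · obtain ⟨x, hx, hxmin⟩ := hcpt.exists_isMinOn hne (continuousOn_rate_of_far hbm hV hμ hε R)
      have hlt : B < rate V μ x := by
        -- Equality would make `x` a global minimizer of the rate, hence a point of the hull of the
        -- support, from which `x` is separated by `ε`.
        refine lt_of_le_of_ne (robinConstant_le_rate hbm hV hμ hx.1.1) fun heq => ?_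
        have := hmin x hx.1.1 fun y hy => by
          change rate V μ x ≤ rate V μ y
          rw [← heq]
          exact robinConstant_le_rate hbm hV hμ hy
        exact hx.1.2 ⟨by linarith [this.1], by linarith [this.2]⟩
      exact ⟨rate V μ x - B, by linarith, fun a ha => by
        have h : rate V μ x ≤ rate V μ a := hxmin ha
        linarith⟩
  obtain ⟨c, hc, hca⟩ := hnear
  have hM0 : 0 ≤ M := le_max_left _ _
  refine ⟨min (δ / 2) (c / (1 + M)), lt_min (by positivity) (by positivity), fun a ha => ?_⟩
  have hL := logOneAdd_nonneg a
  rcases le_total M (logOneAdd a) with h | h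
  · have := hlarge a ha.1 h
    have h5 : min (δ / 2) (c / (1 + M)) * (1 + logOneAdd a) ≤ δ / 2 * (1 + logOneAdd a) := by
      gcongr; exact min_le_left _ _
    linarith
  · have haR : a ∈ Icc (-R) R := by
      unfold logOneAdd at h
      rw [Real.log_le_iff_le_exp (by positivity)] at h
      exact abs_le.1 (by linarith)
    have h5 : min (δ / 2) (c / (1 + M)) * (1 + logOneAdd a) ≤ c / (1 + M) * (1 + M) := by
      gcongr; exact min_le_right _ _
    rw [div_mul_cancel₀ _ (by positivity)] at h5
    linarith [hca a ⟨ha, haR⟩]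

/-- The regularized rate function is bounded below, up to a small error, by the minimum of the rate
function. -/
theorem exists_regRate_lower_bound {δ κ₁ : ℝ} (hδ : 0 < δ) (hκ₁ : 0 < κ₁) :
    ∃ κ : ℝ, 0 < κ ∧ κ ≤ κ₁ ∧ κ ≤ 1 ∧ ∃ c : ℝ, 0 < c ∧ ∀ x ∈ interval bm bp,
      robinConstant V μ - δ + c * logOneAdd x ≤ V x / 2 - regPotential κ μ x := by
  have := hμ.1.isProbabilityMeasure
  have h1 := hμ.1.integrable_logOneAdd hV
  obtain ⟨δ₀, hδ₀, C, hC⟩ := exists_rate_growth hV hμ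
  set B := robinConstant V μ with hB
  set F : ℕ → Set ℝ := fun n =>
    {x | x ∈ interval bm bp ∧ V x / 2 - regPotential (scale n) μ x ≤ B - δ / 2} with hF
  have hclosed : ∀ n, IsClosed (F n) := fun n =>
    (isClosed_interval bm bp).isClosed_le ((hV.continuousOn.div_const 2).sub
      (continuous_regPotential (scale_pos n) (scale_le_one n) h1).continuousOn) continuousOn_const
  have hscale : Antitone scale := fun m n hmn => by
    unfold scale
    have : (m : ℝ) ≤ n := by exact_mod_cast hmn
    gcongr
  have hanti : Antitone F := fun m n hmn x hx => ⟨hx.1, by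
    have := regPotential_mono (scale_pos n) (hscale hmn) (scale_le_one m) h1 x
    linarith [hx.2]⟩
  have hcpt : IsCompact (F 0) := by
    refine (isCompact_Icc (a := -Real.exp ((B + C) / δ₀)) (b := Real.exp ((B + C) / δ₀))).of_isClosed_subset
      (hclosed 0) fun x hx => ?_
    have h2 := hC x hx.1
    have h3 := hx.2
    rw [show scale 0 = 1 by simp [scale]] at h3
    have h4 : logOneAdd x ≤ (B + C) / δ₀ := by
      rw [le_div_iff₀ hδ₀]
      linarith
    unfold logOneAdd at h4
    rw [Real.log_le_iff_le_exp (by positivity)] at h4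
    exact abs_le.1 (by linarith)
  -- Cantor's intersection theorem: a point common to all the decreasing compact sets `F n` would
  -- have rate at most `B - δ / 2`, below the minimum.
  have hempty : ∃ n, F n = ∅ := by
    by_contra hne
    push Not at hne
    obtain ⟨x, hx⟩ := IsCompact.nonempty_iInter_of_sequence_nonempty_isCompact_isClosed F
      (fun n => hanti n.le_succ) (fun n => hne n) hcpt hclosed
    rw [mem_iInter] at hx
    have hxI := (hx 0).1
    have hlog := integrable_log_equilibrium hbm hV hμ x
    have h2 := le_of_tendsto' ((tendsto_regPotential h1 (hμ.1.noAtoms x) hlog).const_sub (V x / 2))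
      fun n => (hx n).2
    have h3 := robinConstant_le_rate hbm hV hμ hxI
    unfold rate at h3
    unfold potential at h2
    linarith
  obtain ⟨n, hn⟩ := hempty
  set κ := min κ₁ (scale n) with hκ
  have hκ0 : 0 < κ := lt_min hκ₁ (scale_pos n)
  have hκ1 : κ ≤ 1 := (min_le_right _ _).trans (scale_le_one n)
  have hlow : ∀ x ∈ interval bm bp, B - δ / 2 ≤ V x / 2 - regPotential κ μ x := by
    intro x hx
    have h2 : x ∉ F n := by rw [hn]; exact notMem_empty x
    have h3 : B - δ / 2 < V x / 2 - regPotential (scale n) μ x := by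
      by_contra hle
      exact h2 ⟨hx, not_lt.1 hle⟩
    have := regPotential_mono hκ0 (min_le_right _ _) (scale_le_one n) h1 x
    linarith
  have hlow2 : ∀ x ∈ interval bm bp, δ₀ * logOneAdd x - C ≤ V x / 2 - regPotential κ μ x := by
    intro x hx
    have := regPotential_mono hκ0 hκ1 le_rfl h1 x
    linarith [hC x hx]
  -- The bound `hlow` has the right constant but no growth, and `hlow2` grows but has a poor
  -- constant. Their convex combination with weight `θ` on the second keeps some growth and loses at
  -- most a further `δ / 2`.
  set θ := min (1 / 2) (δ / (2 * (|B - δ / 2 + C| + 1))) with hθ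
  have hθ0 : 0 < θ := lt_min (by norm_num) (by positivity)
  have hθ1 : θ ≤ 1 / 2 := min_le_left _ _
  have hθ2 : θ * |B - δ / 2 + C| ≤ δ / 2 := by
    calc θ * |B - δ / 2 + C| ≤ δ / (2 * (|B - δ / 2 + C| + 1)) * (|B - δ / 2 + C| + 1) := by
          gcongr
          · exact min_le_right _ _
          · linarith
      _ = δ / 2 := by field_simp
  refine ⟨κ, hκ0, min_le_left _ _, hκ1, θ * δ₀, by positivity, fun x hx => ?_⟩
  have h2 := hlow x hx
  have h3 := hlow2 x hx
  have h4 : θ * (B - δ / 2 + C) ≤ δ / 2 :=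
    (mul_le_mul_of_nonneg_left (le_abs_self _) hθ0.le).trans hθ2
  nlinarith [mul_le_mul_of_nonneg_left h3 hθ0.le,
    mul_le_mul_of_nonneg_left h2 (show 0 ≤ 1 - θ by linarith)]

end Equilibrium

end BetaEnsemble

/-! ### Symmetry of the weight and its bound through the empirical measure -/

namespace BetaEnsemble

open scoped Topology

lemma prod_abs_sub_rpow (N : ℕ) (β : ℝ) (l : Fin N → ℝ) :
    ∏ i, ∏ j ∈ Finset.Ioi i, |l i - l j| ^ β = |(Matrix.vandermonde l).det| ^ β := by
  rw [Matrix.det_vandermonde, Finset.abs_prod, ← Real.finsetProd_rpow _ _ fun i _ => abs_nonneg _]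
  refine Finset.prod_congr rfl fun i _ => ?_
  rw [Finset.abs_prod, ← Real.finsetProd_rpow _ _ fun i _ => abs_nonneg _]
  exact Finset.prod_congr rfl fun j _ => by rw [abs_sub_comm]

/-- The interaction is a power of the absolute value of a Vandermonde determinant, and permuting
rows only changes its sign. -/
lemma weight_comp_perm (N : ℕ) (β : ℝ) (V : ℝ → ℝ) (l : Fin N → ℝ) (σ : Equiv.Perm (Fin N)) :
    weight N β V (l ∘ σ) = weight N β V l := by
  unfold weight
  rw [prod_abs_sub_rpow, prod_abs_sub_rpow]
  have h1 : Matrix.vandermonde (l ∘ σ) = (Matrix.vandermonde l).submatrix σ id := rfl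
  rw [h1, Matrix.det_permute, abs_mul, abs_unit_intCast, one_mul]
  congr 1
  exact Equiv.prod_comp σ fun i => Real.exp (-((N : ℝ) * β / 2 * V (l i)))

/-- This makes the boundary terms of all indices equal, so they add up to `m + 1` times one of them.
-/
lemma weight_insertNth (m : ℕ) (β : ℝ) (V : ℝ → ℝ) (i : Fin (m + 1)) (x : ℝ) (t : Fin m → ℝ) :
    weight (m + 1) β V (i.insertNth x t) = weight (m + 1) β V (Fin.cons x t) := by
  have h : (i.insertNth x t : Fin (m + 1) → ℝ) =
      (Fin.cons x t : Fin (m + 1) → ℝ) ∘ i.cycleRange := by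
    funext j
    exact (Fin.cons_apply_cycleRange x t i j).symm
  rw [h, weight_comp_perm]

/-- The part of the weight that does not depend on the first eigenvalue. -/
noncomputable def restWeight (m : ℕ) (β : ℝ) (V : ℝ → ℝ) (t : Fin m → ℝ) : ℝ :=
  -- The factor stays `m + 1`, the total number of eigenvalues, although only `m` of them appear.
  (∏ i, Real.exp (-(((m + 1 : ℕ) : ℝ) * β / 2 * V (t i)))) *
    ∏ i, ∏ j ∈ Finset.Ioi i, |t i - t j| ^ β

lemma restWeight_nonneg (m : ℕ) (β : ℝ) (V : ℝ → ℝ) (t : Fin m → ℝ) : 0 ≤ restWeight m β V t := by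
  unfold restWeight
  positivity

lemma weight_cons (m : ℕ) (β : ℝ) (V : ℝ → ℝ) (x : ℝ) (t : Fin m → ℝ) :
    weight (m + 1) β V (Fin.cons x t) =
      restWeight m β V t * (Real.exp (-(((m + 1 : ℕ) : ℝ) * β / 2 * V x)) * ∏ j, |x - t j| ^ β) := by
  unfold weight restWeight
  rw [Fin.prod_univ_succ, Fin.prod_univ_succ, Fin.prod_Ioi_zero]
  simp only [Fin.prod_Ioi_succ, Fin.cons_zero, Fin.cons_succ]
  ring

lemma weight_nonneg (N : ℕ) (β : ℝ) (V : ℝ → ℝ) (l : Fin N → ℝ) : 0 ≤ weight N β V l := by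
  unfold weight
  positivity

lemma continuousOn_weight (N : ℕ) {β : ℝ} (hβ : 0 < β) {V : ℝ → ℝ} {I : Set ℝ}
    (hV : ContinuousOn V I) : ContinuousOn (weight N β V) (cube N I) := by
  unfold weight
  refine ContinuousOn.mul (continuousOn_finsetProd _ fun i _ => ?_)
    (Continuous.continuousOn ?_)
  · refine Real.continuous_exp.comp_continuousOn (ContinuousOn.neg (continuousOn_const.mul ?_))
    exact hV.comp (continuous_apply i).continuousOn fun l hl => hl i
  · refine continuous_finsetProd _ fun i _ => continuous_finsetProd _ fun j _ => ?_
    exact Continuous.rpow_const (by fun_prop) fun _ => Or.inr hβ.le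

lemma measurableSet_cube (N : ℕ) {I : Set ℝ} (hI : MeasurableSet I) : MeasurableSet (cube N I) := by
  have : cube N I = univ.pi fun _ => I := by
    ext l; simp [cube]
  rw [this]
  exact MeasurableSet.univ_pi fun _ => hI

lemma sum_sum_symm {N : ℕ} (f : Fin N → Fin N → ℝ) (hf : ∀ i j, f i j = f j i) :
    ∑ i, ∑ j, f i j = 2 * ∑ i, ∑ j ∈ Finset.Ioi i, f i j + ∑ i, f i i := by
  have h1 : ∀ i, ∑ j, f i j = ∑ j ∈ Finset.Iio i, f i j + f i i + ∑ j ∈ Finset.Ioi i, f i j := by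
    intro i
    have h2 : (Finset.univ : Finset (Fin N)) = Finset.Iic i ∪ Finset.Ioi i := by
      ext j; simp [le_or_gt]
    have h3 : Disjoint (Finset.Iic i) (Finset.Ioi i) := by
      rw [Finset.disjoint_left]
      intro j hj hj'
      simp only [Finset.mem_Iic, Finset.mem_Ioi] at hj hj'
      exact absurd hj' (not_lt.2 hj)
    have h4 : Finset.Iic i = insert i (Finset.Iio i) := by
      ext j; simp [le_iff_eq_or_lt]
    rw [h2, Finset.sum_union h3, h4, Finset.sum_insert (by simp)]
    ring
  have h5 : ∑ i, ∑ j ∈ Finset.Iio i, f i j = ∑ i, ∑ j ∈ Finset.Ioi i, f i j := by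
    rw [Finset.sum_comm' (t' := Finset.univ) (s' := fun j => Finset.Ioi j) (by simp)]
    exact Finset.sum_congr rfl fun i _ => Finset.sum_congr rfl fun j _ => hf j i
  simp only [h1, Finset.sum_add_distrib, h5]
  ring

lemma abs_le_exp_regLog (κ z : ℝ) : |z| ≤ Real.exp (regLog κ z) := by
  rcases eq_or_ne z 0 with rfl | hz
  · simpa using (Real.exp_pos _).le
  · rw [← Real.log_le_iff_le_exp (abs_pos.2 hz)]
    exact log_le_regLog κ hz

/-- The double sum runs over the diagonal as well, as the energy of an empirical measure requires.
The term `N * Real.log κ` compensates for the `N` diagonal values. -/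
lemma weight_le_exp_regLog (N : ℕ) {β : ℝ} (hβ : 0 < β) (κ : ℝ) (V : ℝ → ℝ)
    (l : Fin N → ℝ) :
    weight N β V l ≤ Real.exp (-(β / 2 * (N * ∑ i, V (l i) - ∑ i, ∑ j, regLog κ (l i - l j)
      + N * Real.log κ))) := by
  have h1 : ∏ i, ∏ j ∈ Finset.Ioi i, |l i - l j| ^ β ≤
      ∏ i, ∏ j ∈ Finset.Ioi i, Real.exp (β * regLog κ (l i - l j)) := by
    refine Finset.prod_le_prod (fun i _ => by positivity) fun i _ =>
      Finset.prod_le_prod (fun j _ => by positivity) fun j _ => ?_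
    rw [mul_comm, Real.exp_mul]
    exact Real.rpow_le_rpow (abs_nonneg _) (abs_le_exp_regLog κ _) hβ.le
  have h2 := sum_sum_symm (fun i j : Fin N => regLog κ (l i - l j))
    fun i j => by rw [← regLog_neg, neg_sub]
  simp only [sub_self, regLog_zero, Finset.sum_const, Finset.card_univ, Fintype.card_fin,
    nsmul_eq_mul] at h2
  unfold weight
  calc _ ≤ (∏ i, Real.exp (-((N : ℝ) * β / 2 * V (l i)))) *
        ∏ i, ∏ j ∈ Finset.Ioi i, Real.exp (β * regLog κ (l i - l j)) := by gcongr
    _ = _ := by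
      simp only [← Real.exp_sum, ← Finset.mul_sum, ← Real.exp_add, Finset.sum_neg_distrib]
      congr 1
      rw [h2]
      ring

/-- The empirical measure `N⁻¹ ∑ᵢ δ_{lᵢ}`. -/
noncomputable def empirical {N : ℕ} (l : Fin N → ℝ) : Measure ℝ :=
  (N : ENNReal)⁻¹ • ∑ i, Measure.dirac (l i)

instance {N : ℕ} [NeZero N] (l : Fin N → ℝ) : IsProbabilityMeasure (empirical l) := by
  constructor
  have h : (N : ENNReal) ≠ 0 := by exact_mod_cast NeZero.ne N
  simp [empirical, ENNReal.inv_mul_cancel h]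

lemma integrable_empirical {N : ℕ} [NeZero N] (l : Fin N → ℝ) (f : ℝ → ℝ) :
    Integrable f (empirical l) := by
  have h : (N : ENNReal) ≠ 0 := by exact_mod_cast NeZero.ne N
  refine Integrable.smul_measure ?_ (ENNReal.inv_ne_top.2 h)
  rw [integrable_finsetSum_measure]
  exact fun i _ => integrable_dirac (by simp)

lemma integral_empirical {N : ℕ} (l : Fin N → ℝ) (f : ℝ → ℝ) :
    ∫ x, f x ∂(empirical l) = (N : ℝ)⁻¹ * ∑ i, f (l i) := by
  unfold empirical
  rw [integral_smul_measure, integral_finsetSum_measure fun i _ => integrable_dirac (by simp)]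
  simp

lemma regEnergy_eq_integral {κ : ℝ} (hκ : 0 < κ) (hκ1 : κ ≤ 1) {ν ν' : Measure ℝ}
    [IsFiniteMeasure ν] [IsFiniteMeasure ν']
    (h : Integrable logOneAdd ν) (h' : Integrable logOneAdd ν') :
    regEnergy κ ν ν' = ∫ x, regPotential κ ν' x ∂ν :=
  integral_prod _ (integrable_regLog_prod hκ hκ1 h h')

lemma regEnergy_empirical {κ : ℝ} (hκ : 0 < κ) (hκ1 : κ ≤ 1) {N : ℕ} [NeZero N] (l : Fin N → ℝ)
    {ν : Measure ℝ} [IsFiniteMeasure ν] (h : Integrable logOneAdd ν) :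
    regEnergy κ (empirical l) ν = (N : ℝ)⁻¹ * ∑ i, regPotential κ ν (l i) := by
  rw [regEnergy_eq_integral hκ hκ1 (integrable_empirical l _) h, integral_empirical]

lemma regPotential_empirical (κ : ℝ) {N : ℕ} (l : Fin N → ℝ) (x : ℝ) :
    regPotential κ (empirical l) x = (N : ℝ)⁻¹ * ∑ i, regLog κ (x - l i) :=
  integral_empirical l _

/-- The squared distance of two measures for the regularized logarithmic energy. -/
noncomputable def regDist (κ : ℝ) (ν ν' : Measure ℝ) : ℝ :=
  2 * regEnergy κ ν ν' - regEnergy κ ν ν - regEnergy κ ν' ν'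

/-- The distance is minus the quadratic form of `ν - ν'`, and that form increases with the scale by
`regEnergy_mono`. -/
lemma regDist_anti {κ T : ℝ} (hκ : 0 < κ) (hT : κ ≤ T) (hT1 : T ≤ 1) {ν ν' : Measure ℝ}
    [IsProbabilityMeasure ν] [IsProbabilityMeasure ν'] (h : Integrable logOneAdd ν)
    (h' : Integrable logOneAdd ν') : regDist T ν ν' ≤ regDist κ ν ν' := by
  have hp : ∀ i : Fin 2, IsProbabilityMeasure (![ν, ν'] i) := by
    intro i; fin_cases i <;> simpa
  have := regEnergy_mono hκ hT hT1 ![ν, ν'] (fun i => by fin_cases i <;> simpa) ![1, -1]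
  simp only [Fin.sum_univ_two, Matrix.cons_val_zero, Matrix.cons_val_one] at this
  rw [regEnergy_comm κ ν' ν, regEnergy_comm T ν' ν] at this
  unfold regDist
  linarith

lemma regDist_nonneg {κ : ℝ} (hκ : 0 < κ) (hκ1 : κ ≤ 1) {ν ν' : Measure ℝ}
    [IsProbabilityMeasure ν] [IsProbabilityMeasure ν'] (h : Integrable logOneAdd ν)
    (h' : Integrable logOneAdd ν') : 0 ≤ regDist κ ν ν' := by
  have hp : ∀ i : Fin 2, IsProbabilityMeasure (![ν, ν'] i) := by
    intro i; fin_cases i <;> simpa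
  have := regEnergy_nonpos hκ hκ1 ![ν, ν'] (fun i => by fin_cases i <;> simpa) ![1, -1] (by simp)
  simp only [Fin.sum_univ_two, Matrix.cons_val_zero, Matrix.cons_val_one] at this
  rw [regEnergy_comm κ ν' ν] at this
  unfold regDist
  linarith

/-- A weighted Cauchy-Schwarz inequality for the regularized logarithmic energy. -/
lemma regEnergy_cross_le {κ t : ℝ} (hκ : 0 < κ) (hκ1 : κ ≤ 1) (ht : 0 < t)
    {ν₁ ν₂ ν₃ ν₄ : Measure ℝ} [IsProbabilityMeasure ν₁] [IsProbabilityMeasure ν₂]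
    [IsProbabilityMeasure ν₃] [IsProbabilityMeasure ν₄] (h₁ : Integrable logOneAdd ν₁)
    (h₂ : Integrable logOneAdd ν₂) (h₃ : Integrable logOneAdd ν₃) (h₄ : Integrable logOneAdd ν₄) :
    regEnergy κ ν₃ ν₁ - regEnergy κ ν₃ ν₂ - (regEnergy κ ν₄ ν₁ - regEnergy κ ν₄ ν₂) ≤
      regDist κ ν₁ ν₂ / (2 * t) + t * regDist κ ν₃ ν₄ / 2 := by
  have hp : ∀ i : Fin 4, IsProbabilityMeasure (![ν₁, ν₂, ν₃, ν₄] i) := by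
    intro i; fin_cases i <;> simpa
  -- Negativity of the form on the neutral combination `(ν₁ - ν₂) + t (ν₃ - ν₄)`, from which the
  -- cross term is isolated.
  have := regEnergy_nonpos hκ hκ1 ![ν₁, ν₂, ν₃, ν₄] (fun i => by fin_cases i <;> simpa)
    ![1, -1, t, -t] (by simp [Fin.sum_univ_four])
  simp only [Fin.sum_univ_four, Matrix.cons_val_zero, Matrix.cons_val_one, Matrix.cons_val] at this
  rw [regEnergy_comm κ ν₂ ν₁, regEnergy_comm κ ν₁ ν₃, regEnergy_comm κ ν₂ ν₃,
    regEnergy_comm κ ν₁ ν₄, regEnergy_comm κ ν₂ ν₄, regEnergy_comm κ ν₄ ν₃] at this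
  have e : regDist κ ν₁ ν₂ / (2 * t) + t * regDist κ ν₃ ν₄ / 2 =
      (regDist κ ν₁ ν₂ + t ^ 2 * regDist κ ν₃ ν₄) / (2 * t) := by
    field_simp
  rw [e, le_div_iff₀ (by positivity)]
  unfold regDist
  linarith

section Equilibrium

variable {V : ℝ → ℝ} {bm bp : EReal} {μ : Measure ℝ}

/-- The energy of the equilibrium measure. -/
lemma two_mul_robinConstant_add (V : ℝ → ℝ) (μ : Measure ℝ) :
    2 * robinConstant V μ + logEnergy μ μ = energy V μ := by
  unfold robinConstant energy logEnergy
  ring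

lemma logEnergy_le_regEnergy {κ : ℝ} (hκ : 0 < κ) (hκ1 : κ ≤ 1) {ν ν' : Measure ℝ}
    [IsFiniteMeasure ν] [IsFiniteMeasure ν'] (hν : ∀ x, ν' {x} = 0)
    (hint : Integrable (fun p : ℝ × ℝ => Real.log |p.1 - p.2|) (ν.prod ν'))
    (h : Integrable logOneAdd ν) (h' : Integrable logOneAdd ν') :
    logEnergy ν ν' ≤ regEnergy κ ν ν' := by
  refine integral_mono_ae hint (integrable_regLog_prod hκ hκ1 h h') ?_
  refine Measure.ae_prod_iff_ae_ae ?_ |>.2 ?_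
  · exact measurableSet_le measurable_log_abs_sub
      (((continuous_regLog hκ).comp (by fun_prop : Continuous fun p : ℝ × ℝ => p.1 - p.2)).measurable)
  · refine Eventually.of_forall fun x => ?_
    filter_upwards [ae_ne_of_noAtoms x (hν x)] with y hy
    exact log_le_regLog κ hy

/-- The weight of a configuration in terms of the distance of its empirical measure to the
equilibrium measure. -/
theorem weight_le (hV : IsConfining V bm bp) (hμ : HasFiniteEnergy V (interval bm bp) μ)
    {β κ δ c : ℝ} (hβ : 0 < β) (hκ : 0 < κ) (hκ1 : κ ≤ 1)
    (hlow : ∀ x ∈ interval bm bp,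
      robinConstant V μ - δ + c * logOneAdd x ≤ V x / 2 - regPotential κ μ x)
    {N : ℕ} [NeZero N] {l : Fin N → ℝ} (hl : ∀ i, l i ∈ interval bm bp) :
    weight N β V l ≤ Real.exp (-(β / 2 * ((N : ℝ) ^ 2 * (energy V μ - 2 * δ +
      regDist κ (empirical l) μ) + N * Real.log κ))) *
        ∏ i, Real.exp (-(β * N * c * logOneAdd (l i))) := by
  have := hμ.isProbabilityMeasure
  have h1 := hμ.integrable_logOneAdd hV
  have hN : (0 : ℝ) < N := by exact_mod_cast Nat.pos_of_ne_zero (NeZero.ne N)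
  refine (weight_le_exp_regLog N hβ κ V l).trans ?_
  rw [← Real.exp_sum, ← Real.exp_add, Real.exp_le_exp]
  have h2 : N * (robinConstant V μ - δ) + c * ∑ i, logOneAdd (l i) ≤
      (∑ i, V (l i)) / 2 - ∑ i, regPotential κ μ (l i) := by
    have := Finset.sum_le_sum fun i (_ : i ∈ Finset.univ) => hlow (l i) (hl i)
    simp only [Finset.sum_add_distrib, Finset.sum_sub_distrib, ← Finset.mul_sum,
      ← Finset.sum_div, Finset.sum_const, Finset.card_univ, Fintype.card_fin, nsmul_eq_mul] at this
    linarith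
  have h3 := logEnergy_le_regEnergy hκ hκ1 hμ.noAtoms hμ.integrable_log h1 h1
  -- Completing the square around `μ`. The linear term is then bounded by `hlow`, and `regEnergy κ μ
  -- μ` is replaced by the smaller `logEnergy μ μ`.
  have h4 : (N : ℝ) ^ 2 * regDist κ (empirical l) μ = 2 * N * ∑ i, regPotential κ μ (l i) -
      ∑ i, ∑ j, regLog κ (l i - l j) - (N : ℝ) ^ 2 * regEnergy κ μ μ := by
    unfold regDist
    rw [regEnergy_empirical hκ hκ1 l h1, regEnergy_empirical hκ hκ1 l (integrable_empirical l _)]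
    simp only [regPotential_empirical, ← Finset.mul_sum]
    field_simp
  rw [mul_add ((N : ℝ) ^ 2), h4, ← two_mul_robinConstant_add, Finset.sum_neg_distrib,
    ← Finset.mul_sum]
  have h5 := mul_le_mul_of_nonneg_left h2 (show 0 ≤ β * N by positivity)
  have h6 := mul_le_mul_of_nonneg_left h3 (show 0 ≤ β / 2 * (N : ℝ) ^ 2 by positivity)
  linarith

lemma integrable_tail : Integrable fun x : ℝ => Real.exp (-(2 * logOneAdd x)) := by
  have h := integrable_one_add_norm (E := ℝ) (μ := volume) (r := 2) (by simp)
  refine h.congr (Eventually.of_forall fun x => ?_)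
  simp only [logOneAdd, Real.norm_eq_abs]
  rw [Real.rpow_def_of_pos (by positivity)]
  congr 1; ring

/-- A uniform bound for the weight by an integrable product. -/
lemma weight_le_tail (hV : IsConfining V bm bp) (hμ : HasFiniteEnergy V (interval bm bp) μ)
    {β κ δ c : ℝ} (hβ : 0 < β) (hκ : 0 < κ) (hκ1 : κ ≤ 1)
    (hlow : ∀ x ∈ interval bm bp,
      robinConstant V μ - δ + c * logOneAdd x ≤ V x / 2 - regPotential κ μ x)
    {N : ℕ} [NeZero N] (hN : 2 ≤ β * N * c) {q : ℝ} {l : Fin N → ℝ}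
    (hl : ∀ i, l i ∈ interval bm bp) (hq : q ≤ regDist κ (empirical l) μ) :
    weight N β V l ≤ Real.exp (-(β / 2 * ((N : ℝ) ^ 2 * (energy V μ - 2 * δ + q) +
      N * Real.log κ))) * ∏ i, Real.exp (-(2 * logOneAdd (l i))) := by
  refine (weight_le hV hμ hβ hκ hκ1 hlow hl).trans ?_
  refine mul_le_mul ?_ (Finset.prod_le_prod (fun i _ => (Real.exp_pos _).le) fun i _ => ?_)
    (Finset.prod_nonneg fun i _ => (Real.exp_pos _).le) (Real.exp_pos _).le
  · gcongr
  · have := logOneAdd_nonneg (l i)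
    gcongr

end Equilibrium

end BetaEnsemble

/-! ### Lower bound for the partition function -/

namespace BetaEnsemble

open scoped Topology

/-- The energy of a configuration; the diagonal terms vanish because `Real.log 0 = 0`. -/
noncomputable def hamiltonian {N : ℕ} (V : ℝ → ℝ) (l : Fin N → ℝ) : ℝ :=
  N * ∑ i, V (l i) - ∑ i, ∑ j, Real.log |l i - l j|

lemma weight_eq_exp {N : ℕ} (β : ℝ) (V : ℝ → ℝ) {l : Fin N → ℝ} (hl : Function.Injective l) :
    weight N β V l = Real.exp (-(β / 2 * hamiltonian V l)) := by
  have h1 : ∏ i, ∏ j ∈ Finset.Ioi i, |l i - l j| ^ β =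
      ∏ i, ∏ j ∈ Finset.Ioi i, Real.exp (β * Real.log |l i - l j|) := by
    refine Finset.prod_congr rfl fun i _ => Finset.prod_congr rfl fun j hj => ?_
    have : l i - l j ≠ 0 := sub_ne_zero.2 (hl.ne (Finset.mem_Ioi.1 hj).ne)
    rw [Real.rpow_def_of_pos (abs_pos.2 this), mul_comm]
  have h2 := sum_sum_symm (fun i j : Fin N => Real.log |l i - l j|)
    fun i j => by rw [abs_sub_comm]
  simp only [sub_self, abs_zero, Real.log_zero, Finset.sum_const_zero, add_zero] at h2
  unfold weight hamiltonian
  rw [h1, h2]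
  simp only [← Real.exp_sum, ← Finset.mul_sum, ← Real.exp_add, Finset.sum_neg_distrib]
  congr 1
  ring

lemma measurePreserving_pair {N : ℕ} (μ : Measure ℝ) [IsProbabilityMeasure μ] {i j : Fin N}
    (hij : i ≠ j) : MeasurePreserving (fun l : Fin N → ℝ => (l i, l j))
      (Measure.pi fun _ => μ) (μ.prod μ) := by
  refine ⟨by fun_prop, ?_⟩
  have h := (ProbabilityTheory.iIndepFun_pi (μ := fun _ : Fin N => μ) (X := fun _ x => x)
    fun _ => aemeasurable_id).indepFun hij
  rw [ProbabilityTheory.indepFun_iff_map_prod_eq_prod_map_map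
    (measurable_pi_apply i).aemeasurable (measurable_pi_apply j).aemeasurable] at h
  rw [h]
  have e : ∀ k : Fin N, Measure.map (fun l : Fin N → ℝ => l k) (Measure.pi fun _ => μ) = μ :=
    fun k => (measurePreserving_eval (fun _ : Fin N => μ) k).map_eq
  rw [e, e]

section Average

variable {V : ℝ → ℝ} {I : Set ℝ} {μ : Measure ℝ}

lemma integral_pi_eval {N : ℕ} [IsProbabilityMeasure μ] {f : ℝ → ℝ} (hf : Integrable f μ)
    (i : Fin N) : Integrable (fun l : Fin N → ℝ => f (l i)) (Measure.pi fun _ => μ) ∧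
      ∫ l : Fin N → ℝ, f (l i) ∂(Measure.pi fun _ => μ) = ∫ x, f x ∂μ := by
  have hmp := measurePreserving_eval (fun _ : Fin N => μ) i
  refine ⟨(hmp.integrable_comp hf.aestronglyMeasurable).2 hf, ?_⟩
  have hf' : AEStronglyMeasurable f
      (Measure.map (Function.eval i) (Measure.pi fun _ : Fin N => μ)) := by
    rw [hmp.map_eq]; exact hf.aestronglyMeasurable
  have := integral_map hmp.measurable.aemeasurable hf'
  rw [hmp.map_eq] at this
  exact this.symm

lemma integral_pi_pair {N : ℕ} [IsProbabilityMeasure μ] {f : ℝ × ℝ → ℝ}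
    (hf : Integrable f (μ.prod μ)) {i j : Fin N} (hij : i ≠ j) :
    Integrable (fun l : Fin N → ℝ => f (l i, l j)) (Measure.pi fun _ => μ) ∧
      ∫ l : Fin N → ℝ, f (l i, l j) ∂(Measure.pi fun _ => μ) = ∫ p, f p ∂(μ.prod μ) := by
  have hmp := measurePreserving_pair μ hij
  refine ⟨(hmp.integrable_comp hf.aestronglyMeasurable).2 hf, ?_⟩
  have hf' : AEStronglyMeasurable f
      (Measure.map (fun l : Fin N → ℝ => (l i, l j)) (Measure.pi fun _ : Fin N => μ)) := by
    rw [hmp.map_eq]; exact hf.aestronglyMeasurable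
  have := integral_map hmp.measurable.aemeasurable hf'
  rw [hmp.map_eq] at this
  exact this.symm

/-- For independent points of law `μ` each off-diagonal pair contributes `logEnergy μ μ`. The
diagonal contributes `0` since `Real.log 0 = 0`, whence the correction of order `N`. -/
lemma integral_hamiltonian {N : ℕ} (hμ : HasFiniteEnergy V I μ) :
    Integrable (fun l : Fin N → ℝ => hamiltonian V l) (Measure.pi fun _ => μ) ∧
      ∫ l : Fin N → ℝ, hamiltonian V l ∂(Measure.pi fun _ => μ) =
        (N : ℝ) ^ 2 * energy V μ + N * logEnergy μ μ := by
  have := hμ.isProbabilityMeasure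
  have hdiag : ∀ i j : Fin N,
      Integrable (fun l : Fin N → ℝ => Real.log |l i - l j|) (Measure.pi fun _ => μ) ∧
      ∫ l : Fin N → ℝ, Real.log |l i - l j| ∂(Measure.pi fun _ => μ) =
        logEnergy μ μ - if i = j then logEnergy μ μ else 0 := by
    intro i j
    rcases eq_or_ne i j with rfl | hij
    · simp
    · simpa [hij, logEnergy] using integral_pi_pair hμ.integrable_log hij
  have hV := fun i : Fin N => integral_pi_eval (N := N) hμ.integrable_potential i
  have i1 : Integrable (fun l : Fin N → ℝ => (N : ℝ) * ∑ i, V (l i)) (Measure.pi fun _ => μ) :=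
    (integrable_finsetSum _ fun i _ => (hV i).1).const_mul _
  have i2 : Integrable (fun l : Fin N → ℝ => ∑ i, ∑ j, Real.log |l i - l j|)
      (Measure.pi fun _ => μ) :=
    integrable_finsetSum _ fun i _ => integrable_finsetSum _ fun j _ => (hdiag i j).1
  refine ⟨i1.sub i2, ?_⟩
  unfold hamiltonian
  rw [integral_sub i1 i2, integral_const_mul, integral_finsetSum _ fun i _ => (hV i).1,
    integral_finsetSum _ fun i _ => integrable_finsetSum _ fun j _ => (hdiag i j).1]
  have e : ∀ i : Fin N, ∫ l : Fin N → ℝ, ∑ j, Real.log |l i - l j| ∂(Measure.pi fun _ => μ) =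
      ∑ j, (logEnergy μ μ - if i = j then logEnergy μ μ else 0) := fun i => by
    rw [integral_finsetSum _ fun j _ => (hdiag i j).1]
    exact Finset.sum_congr rfl fun j _ => (hdiag i j).2
  simp only [e, (hV _).2, Finset.sum_sub_distrib, Finset.sum_const, Finset.card_univ,
    Fintype.card_fin, Finset.sum_ite_eq, Finset.mem_univ, if_true, nsmul_eq_mul]
  unfold energy logEnergy
  ring

lemma ae_pi_injective {N : ℕ} (hμ : HasFiniteEnergy V I μ) :
    ∀ᵐ l ∂(Measure.pi fun _ : Fin N => μ), Function.Injective l := by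
  have := hμ.isProbabilityMeasure
  have h : ∀ i j : Fin N, i ≠ j → ∀ᵐ l ∂(Measure.pi fun _ : Fin N => μ), l i ≠ l j := by
    intro i j hij
    have h1 : ∀ᵐ p ∂(μ.prod μ), p.1 - p.2 ≠ (0 : ℝ) := by
      refine (Measure.ae_prod_iff_ae_ae ?_).2 ?_
      · exact (measurableSet_eq_fun (by fun_prop) (by fun_prop)).compl
      · exact Eventually.of_forall fun x => ae_ne_of_noAtoms x (hμ.noAtoms x)
    filter_upwards [(measurePreserving_pair μ hij).quasiMeasurePreserving.ae h1] with l hl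
    exact sub_ne_zero.1 hl
  have h2 : ∀ᵐ l ∂(Measure.pi fun _ : Fin N => μ), ∀ i j : Fin N, i ≠ j → l i ≠ l j := by
    simp only [ae_all_iff]
    exact h
  filter_upwards [h2] with l hl i j hij
  by_contra hne
  exact hl i j hne hij

/-- Probabilistic method: among samples almost surely injective and in `S`, one has at most the mean
energy. -/
lemma exists_config {N : ℕ} (hμ : HasFiniteEnergy V I μ) {S : Set ℝ} (hS : ∀ᵐ x ∂μ, x ∈ S) :
    ∃ l : Fin N → ℝ, (∀ i, l i ∈ S) ∧ Function.Injective l ∧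
      hamiltonian V l ≤ (N : ℝ) ^ 2 * energy V μ + N * logEnergy μ μ := by
  have := hμ.isProbabilityMeasure
  have hSN : ∀ᵐ l ∂(Measure.pi fun _ : Fin N => μ), ∀ i, l i ∈ S := by
    rw [ae_all_iff]
    exact fun i => (measurePreserving_eval (fun _ : Fin N => μ) i).quasiMeasurePreserving.ae hS
  obtain ⟨hint, hval⟩ := integral_hamiltonian (N := N) hμ
  obtain ⟨l, hl, hle⟩ := exists_notMem_null_le_integral hint (hSN.and (ae_pi_injective hμ))
  simp only [mem_compl_iff, mem_ofPred_eq, not_not] at hl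
  exact ⟨l, hl.1, hl.2, hval ▸ hle⟩

end Average

/-- The number of points of the configuration that are smaller than `l i`. -/
noncomputable def rank {N : ℕ} (l : Fin N → ℝ) (i : Fin N) : ℕ :=
  (Finset.univ.filter fun j => l j < l i).card

lemma rank_lt {N : ℕ} (l : Fin N → ℝ) (i : Fin N) : rank l i + 1 ≤ N := by
  have h : (Finset.univ.filter fun j => l j < l i) ⊂ Finset.univ := by
    rw [Finset.ssubset_univ_iff]
    intro h
    have := h ▸ Finset.mem_univ i
    simp at this
  have := Finset.card_lt_card h
  rwa [Finset.card_univ, Fintype.card_fin] at this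

lemma rank_lt_rank {N : ℕ} {l : Fin N → ℝ} {i j : Fin N} (h : l i < l j) :
    rank l i + 1 ≤ rank l j := by
  have : (Finset.univ.filter fun k => l k < l i) ⊂ Finset.univ.filter fun k => l k < l j := by
    refine Finset.ssubset_iff_of_subset (fun k hk => ?_) |>.2 ⟨i, by simpa using h, by simp⟩
    simp only [Finset.mem_filter, Finset.mem_univ, true_and] at hk ⊢
    exact hk.trans h
  exact Finset.card_lt_card this

/-- The corner of a box of configurations that are ordered like `x`. -/
noncomputable def boxCorner {N : ℕ} (x : Fin N → ℝ) (a b r : ℝ) (i : Fin N) : ℝ :=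
  (1 - r) * x i + r * (a + (b - a) * (rank x i / N))

section Box

variable {N : ℕ} {x : Fin N → ℝ} {a b r : ℝ}

/-- A point of the box is a convex combination of `x i` and a point `v` of the slot numbered by the
rank of `x i` when `[a, b]` is cut into `N` equal slots. -/
lemma exists_of_mem_box (hN : 0 < N) (hr : 0 < r)
    {l : Fin N → ℝ} (hl : l ∈ Icc (boxCorner x a b r) fun i => boxCorner x a b r i + r * (b - a) / N)
    (i : Fin N) : ∃ v : ℝ, l i = (1 - r) * x i + r * v ∧
      v ∈ Icc (a + (b - a) * (rank x i / N)) (a + (b - a) * ((rank x i + 1) / N)) := by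
  have hN' : (0 : ℝ) < N := by exact_mod_cast hN
  have h1 := hl.1 i
  have h2 := hl.2 i
  simp only [boxCorner] at h1 h2
  refine ⟨(l i - (1 - r) * x i) / r, by field_simp; ring, ?_, ?_⟩
  · rw [le_div_iff₀ hr]; linarith
  · rw [div_le_iff₀ hr]
    have e : r * (b - a) / N = r * ((b - a) * (1 / N)) := by ring
    rw [e] at h2
    rw [add_div]
    linarith

lemma slot_subset (hN : 0 < N) (hab : a < b) (i : Fin N) :
    Icc (a + (b - a) * (rank x i / N)) (a + (b - a) * ((rank x i + 1) / N)) ⊆ Icc a b := by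
  have hN' : (0 : ℝ) < N := by exact_mod_cast hN
  have hba : 0 < b - a := sub_pos.2 hab
  refine Icc_subset_Icc ?_ ?_
  · have : 0 ≤ (b - a) * ((rank x i : ℝ) / N) := by positivity
    linarith
  · have h : ((rank x i : ℝ) + 1) / N ≤ 1 := by
      rw [div_le_one hN']
      exact_mod_cast rank_lt x i
    nlinarith

/-- The slots are ordered like the `x i`, so the added displacements only push points further apart.
The loss of distance comes from the factor `1 - r` alone. -/
lemma abs_sub_ge_of_mem_box (hN : 0 < N) (hab : a < b) (hr : 0 < r)
    {l : Fin N → ℝ} (hl : l ∈ Icc (boxCorner x a b r) fun i => boxCorner x a b r i + r * (b - a) / N)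
    (i j : Fin N) : (1 - r) * |x i - x j| ≤ |l i - l j| := by
  have hN' : (0 : ℝ) < N := by exact_mod_cast hN
  have key : ∀ i j : Fin N, x i < x j → (1 - r) * (x j - x i) ≤ l j - l i := by
    intro i j hij
    obtain ⟨v, hv, hv1⟩ := exists_of_mem_box hN hr hl i
    obtain ⟨w, hw, hw1⟩ := exists_of_mem_box hN hr hl j
    have h1 : ((rank x i : ℝ) + 1) / N ≤ rank x j / N := by
      gcongr
      exact_mod_cast rank_lt_rank hij
    have h2 : v ≤ w := hv1.2.trans (le_trans (by gcongr) hw1.1)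
    rw [hv, hw]
    nlinarith
  rcases lt_trichotomy (x i) (x j) with h | h | h
  · rw [abs_sub_comm, abs_of_pos (sub_pos.2 h), abs_sub_comm]
    exact (key i j h).trans (le_abs_self _)
  · rw [h, sub_self, abs_zero, mul_zero]
    exact abs_nonneg _
  · rw [abs_of_pos (sub_pos.2 h)]
    exact (key j i h).trans (le_abs_self _)

/-- The energy rises by at most a small multiple of `N²` on a set of volume `(r (b - a) / N)^N`.
Thus one good configuration yields a lower bound for an integral. -/
lemma hamiltonian_le_of_mem_box {V : ℝ → ℝ} {d : ℝ} (hN : 0 < N) (hab : a < b) (hr : 0 < r)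
    (hr1 : r < 1) (hx : ∀ i, x i ∈ Icc a b) (hinj : Function.Injective x)
    (hV : ∀ s ∈ Icc a b, ∀ t ∈ Icc a b, |s - t| ≤ r * (b - a) → V s ≤ V t + d)
    {l : Fin N → ℝ} (hl : l ∈ Icc (boxCorner x a b r) fun i => boxCorner x a b r i + r * (b - a) / N) :
    (∀ i, l i ∈ Icc a b) ∧ Function.Injective l ∧
      hamiltonian V l ≤ hamiltonian V x + (N : ℝ) ^ 2 * (d - Real.log (1 - r)) := by
  have hmem : ∀ i, l i ∈ Icc a b := by
    intro i
    obtain ⟨v, hv, hv1⟩ := exists_of_mem_box hN hr hl i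
    have hv2 := slot_subset hN hab i hv1
    rw [hv]
    exact ⟨by nlinarith [(hx i).1, hv2.1], by nlinarith [(hx i).2, hv2.2]⟩
  have hlinj : Function.Injective l := by
    intro i j hij
    by_contra hne
    have h1 := abs_sub_ge_of_mem_box hN hab hr hl i j
    rw [hij, sub_self, abs_zero] at h1
    have h2 : 0 < |x i - x j| := abs_pos.2 (sub_ne_zero.2 (hinj.ne hne))
    have : 0 < (1 - r) * |x i - x j| := mul_pos (by linarith) h2
    linarith
  refine ⟨hmem, hlinj, ?_⟩
  have h1 : ∑ i, V (l i) ≤ ∑ i, V (x i) + N * d := by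
    have := Finset.sum_le_sum fun i (_ : i ∈ Finset.univ) => hV (l i) (hmem i) (x i) (hx i) (by
      obtain ⟨v, hv, hv1⟩ := exists_of_mem_box hN hr hl i
      have hv2 := slot_subset hN hab i hv1
      rw [hv, show (1 - r) * x i + r * v - x i = r * (v - x i) by ring, abs_mul, abs_of_pos hr]
      refine mul_le_mul_of_nonneg_left (abs_le.2 ⟨?_, ?_⟩) hr.le
      · linarith [hv2.1, (hx i).2]
      · linarith [hv2.2, (hx i).1])
    simpa [Finset.sum_add_distrib] using this
  have hlog0 : Real.log (1 - r) ≤ 0 := Real.log_nonpos (by linarith) (by linarith)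
  have h2 : ∑ i, ∑ j, Real.log |x i - x j| + (N : ℝ) ^ 2 * Real.log (1 - r) ≤
      ∑ i, ∑ j, Real.log |l i - l j| := by
    have := Finset.sum_le_sum fun i (_ : i ∈ Finset.univ) => Finset.sum_le_sum
      fun j (_ : j ∈ Finset.univ) => (?_ : Real.log |x i - x j| + Real.log (1 - r) ≤
        Real.log |l i - l j|)
    · refine le_trans (le_of_eq ?_) this
      simp only [Finset.sum_add_distrib, Finset.sum_const, Finset.card_univ, Fintype.card_fin,
        nsmul_eq_mul]
      ring
    · rcases eq_or_ne i j with rfl | hij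
      · simpa using hlog0
      · have h3 : 0 < |x i - x j| := abs_pos.2 (sub_ne_zero.2 (hinj.ne hij))
        rw [add_comm, ← Real.log_mul (by linarith) h3.ne']
        exact Real.log_le_log (mul_pos (by linarith) h3) (abs_sub_ge_of_mem_box hN hab hr hl i j)
  unfold hamiltonian
  have hN' : (0 : ℝ) ≤ N := N.cast_nonneg
  have h3 := mul_le_mul_of_nonneg_left h1 hN'
  linarith

end Box

section Equilibrium

variable {V : ℝ → ℝ} {bm bp : EReal} {μ : Measure ℝ}
variable (hbm : bm < bp) (hV : IsConfining V bm bp)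
  (hμ : IsEquilibriumMeasure V (interval bm bp) μ)

include hbm hV hμ

lemma exists_modulus {d : ℝ} (hd : 0 < d) : ∃ r : ℝ, 0 < r ∧ r < 1 ∧ -Real.log (1 - r) ≤ d ∧
    ∀ s ∈ Icc (leftEnd μ) (rightEnd μ), ∀ t ∈ Icc (leftEnd μ) (rightEnd μ),
      |s - t| ≤ r * (rightEnd μ - leftEnd μ) → V s ≤ V t + d := by
  have hab := leftEnd_lt_rightEnd hbm hV hμ
  have huc := isCompact_Icc.uniformContinuousOn_of_continuous
    (hV.continuousOn.mono (Icc_subset_interval hbm hV hμ))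
  rw [Metric.uniformContinuousOn_iff] at huc
  obtain ⟨δ, hδ, hVδ⟩ := huc d hd
  have h1 : ∀ᶠ r : ℝ in 𝓝[>] 0, r * (rightEnd μ - leftEnd μ) < δ := by
    have : Tendsto (fun r : ℝ => r * (rightEnd μ - leftEnd μ)) (𝓝[>] 0)
        (𝓝 (0 * (rightEnd μ - leftEnd μ))) :=
      (Continuous.tendsto (by fun_prop) 0).mono_left nhdsWithin_le_nhds
    exact this.eventually_lt_const (by simpa using hδ)
  have h2 : ∀ᶠ r : ℝ in 𝓝[>] 0, -Real.log (1 - r) < d := by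
    have : ContinuousAt (fun r : ℝ => -Real.log (1 - r)) 0 :=
      (ContinuousAt.log (by fun_prop) (by norm_num)).neg
    exact (this.tendsto.mono_left nhdsWithin_le_nhds).eventually_lt_const (by simpa using hd)
  obtain ⟨r, h3, h4, h5⟩ := (h1.and (h2.and (Ioo_mem_nhdsGT (one_pos : (0 : ℝ) < 1)))).exists
  refine ⟨r, h5.1, h5.2, h4.le, fun s hs t ht hst => ?_⟩
  have := hVδ s hs t ht (by rw [Real.dist_eq]; linarith)
  rw [Real.dist_eq] at this
  linarith [le_abs_self (V s - V t)]

/-- A lower bound for the partition function. -/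
theorem exists_partitionFunction_lower_bound {β δ : ℝ} (hβ : 0 < β) (hδ : 0 < δ) :
    ∃ N₀ : ℕ, ∀ N : ℕ, N₀ ≤ N → ∀ A : Set ℝ, Icc (leftEnd μ) (rightEnd μ) ⊆ A →
      IntegrableOn (weight N β V) (cube N A) →
        Real.exp (-(β / 2 * ((N : ℝ) ^ 2 * (energy V μ + δ)))) ≤ partitionFunction N β V A := by
  have hab := leftEnd_lt_rightEnd hbm hV hμ
  obtain ⟨r, hr, hr1, hrlog, hVr⟩ := exists_modulus hbm hV hμ (show 0 < δ / 4 by positivity)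
  set a := leftEnd μ with ha
  set b := rightEnd μ with hb
  set w := r * (b - a) with hw
  have hw0 : 0 < w := mul_pos hr (sub_pos.2 hab)
  -- The volume of the box costs only order `N log N`, negligible against `N²`. With `δ / 4` each
  -- for the modulus of `V` and for `-ln (1 - r)`, a margin of `δ / 2` remains for it.
  have hlim : Tendsto (fun N : ℕ => (Real.log N - Real.log w + β / 2 * logEnergy μ μ) / (N : ℝ))
      atTop (𝓝 0) := by
    have h1 : Tendsto (fun N : ℕ => Real.log N / (N : ℝ)) atTop (𝓝 0) :=
      (Real.isLittleO_log_id_atTop.tendsto_div_nhds_zero).comp tendsto_natCast_atTop_atTop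
    have h2 := (tendsto_const_div_atTop_nhds_zero_nat (-Real.log w + β / 2 * logEnergy μ μ))
    have := h1.add h2
    rw [add_zero] at this
    refine this.congr fun N => ?_
    rw [← add_div]
    ring
  obtain ⟨N₀, hN₀⟩ := eventually_atTop.1 ((hlim.eventually_lt_const
    (show 0 < β / 2 * (δ / 2) by positivity)).and (eventually_gt_atTop 0))
  refine ⟨N₀, fun N hN A hA hint => ?_⟩
  obtain ⟨hsmall, hNpos⟩ := hN₀ N hN
  have hN' : (0 : ℝ) < N := by exact_mod_cast hNpos
  obtain ⟨x, hx, hxinj, hxle⟩ := exists_config (N := N) hμ.1 (ae_mem_Icc hbm hV hμ)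
  set K := Icc (boxCorner x a b r) fun i => boxCorner x a b r i + r * (b - a) / N with hK
  set M := (N : ℝ) ^ 2 * energy V μ + N * logEnergy μ μ +
    (N : ℝ) ^ 2 * (δ / 4 - Real.log (1 - r)) with hM
  have hKA : K ⊆ cube N A := fun l hl i =>
    hA ((hamiltonian_le_of_mem_box hNpos hab hr hr1 hx hxinj hVr hl).1 i)
  have hlow : ∀ l ∈ K, Real.exp (-(β / 2 * M)) ≤ weight N β V l := by
    intro l hl
    obtain ⟨_, h2, h3⟩ := hamiltonian_le_of_mem_box hNpos hab hr hr1 hx hxinj hVr hl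
    rw [weight_eq_exp β V h2]
    have : hamiltonian V l ≤ M := by linarith
    gcongr
  have hvol : (volume K).toReal = (w / N) ^ N := by
    rw [hK, Real.volume_Icc_pi_toReal fun i => by
      have : 0 ≤ r * (b - a) / N := by positivity
      linarith]
    simp [hw, div_pow]
  have h1 : (w / N) ^ N * Real.exp (-(β / 2 * M)) ≤ partitionFunction N β V A := by
    have h2 := setIntegral_ge_of_const_le measurableSet_Icc isCompact_Icc.measure_lt_top.ne hlow
      (hint.mono_set hKA)
    rw [Measure.real, hvol, smul_eq_mul] at h2
    refine h2.trans (setIntegral_mono_set hint ?_ hKA.eventuallyLE)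
    exact Eventually.of_forall fun l => weight_nonneg N β V l
  refine le_trans ?_ h1
  have h3 : (w / N) ^ N = Real.exp (N * (Real.log w - Real.log N)) := by
    rw [← Real.log_div hw0.ne' hN'.ne', Real.exp_nat_mul, Real.exp_log (by positivity)]
  rw [h3, ← Real.exp_add, Real.exp_le_exp]
  rw [div_lt_iff₀ hN'] at hsmall
  have h4 := mul_lt_mul_of_pos_left hsmall hN'
  have h5 := mul_le_mul_of_nonneg_left hrlog (show 0 ≤ β / 2 * (N : ℝ) ^ 2 by positivity)
  rw [hM]
  linarith

end Equilibrium

end BetaEnsemble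

/-! ### Splitting off one eigenvalue, and Jensen's inequality on a segment -/

namespace BetaEnsemble

open scoped Topology

section Fubini

variable {E : Type*} [NormedAddCommGroup E] [NormedSpace ℝ E]

lemma measurePreserving_insertNth (m : ℕ) (i : Fin (m + 1)) :
    MeasurePreserving (fun p : ℝ × (Fin m → ℝ) => (i.insertNth p.1 p.2 : Fin (m + 1) → ℝ))
      (volume.prod volume) volume :=
  (volume_preserving_piFinSuccAbove (fun _ : Fin (m + 1) => ℝ) i).symm _

lemma measurableEmbedding_insertNth (m : ℕ) (i : Fin (m + 1)) :
    MeasurableEmbedding (fun p : ℝ × (Fin m → ℝ) => (i.insertNth p.1 p.2 : Fin (m + 1) → ℝ)) :=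
  (MeasurableEquiv.piFinSuccAbove (fun _ : Fin (m + 1) => ℝ) i).symm.measurableEmbedding

lemma insertNth_mem_cube {m : ℕ} (i : Fin (m + 1)) {A : Set ℝ} (x : ℝ) (t : Fin m → ℝ) :
    (i.insertNth x t : Fin (m + 1) → ℝ) ∈ cube (m + 1) A ↔ x ∈ A ∧ t ∈ cube m A := by
  unfold cube
  rw [mem_ofPred_eq, mem_ofPred_eq, Fin.forall_iff_succAbove i]
  simp

lemma preimage_insertNth_cube {m : ℕ} (i : Fin (m + 1)) (A : Set ℝ) :
    (fun p : ℝ × (Fin m → ℝ) => (i.insertNth p.1 p.2 : Fin (m + 1) → ℝ)) ⁻¹' cube (m + 1) A =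
      A ×ˢ cube m A := by
  ext p
  rw [mem_preimage, insertNth_mem_cube, mem_prod]

omit [NormedSpace ℝ E] in
lemma integrableOn_insertNth {m : ℕ} (i : Fin (m + 1)) {S : Set (Fin (m + 1) → ℝ)}
    {f : (Fin (m + 1) → ℝ) → E} (hf : IntegrableOn f S) :
    IntegrableOn (fun p : ℝ × (Fin m → ℝ) => f (i.insertNth p.1 p.2))
      ((fun p : ℝ × (Fin m → ℝ) => (i.insertNth p.1 p.2 : Fin (m + 1) → ℝ)) ⁻¹' S)
      (volume.prod volume) :=
  ((measurePreserving_insertNth m i).integrableOn_comp_preimage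
    (measurableEmbedding_insertNth m i)).2 hf

lemma setIntegral_insertNth {m : ℕ} (i : Fin (m + 1)) (S : Set (Fin (m + 1) → ℝ))
    (f : (Fin (m + 1) → ℝ) → E) :
    ∫ l in S, f l = ∫ p in (fun p : ℝ × (Fin m → ℝ) => (i.insertNth p.1 p.2 : Fin (m + 1) → ℝ)) ⁻¹' S,
      f (i.insertNth p.1 p.2) ∂(volume.prod volume) :=
  ((measurePreserving_insertNth m i).setIntegral_preimage_emb
    (measurableEmbedding_insertNth m i) f S).symm

end Fubini

/-- The difference `½ ln (1 + κ² / y²)` of the regularized and the true logarithm. -/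
lemma regLog_sub_log_le {κ y : ℝ} (hy : y ≠ 0) :
    regLog κ y - Real.log |y| ≤ κ ^ 2 / (2 * y ^ 2) := by
  have hy2 : 0 < y ^ 2 := by positivity
  have h : Real.log |y| = Real.log (y ^ 2) / 2 := by
    rw [← sq_abs, Real.log_pow]; push_cast; ring
  rw [h]
  unfold regLog
  rw [← sub_div, ← Real.log_div (by positivity) hy2.ne', div_le_iff₀ (by norm_num)]
  have := Real.log_le_sub_one_of_pos (show 0 < (y ^ 2 + κ ^ 2) / y ^ 2 by positivity)
  refine this.trans (le_of_eq ?_)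
  field_simp
  ring

/-- The difference has a logarithmic singularity at the origin and decays like `y⁻²`. -/
lemma integrable_regLog_sub_log : Integrable fun y : ℝ => regLog 1 y - Real.log |y| := by
  rw [← integrableOn_univ, ← union_compl_self (Icc (-1 : ℝ) 1)]
  refine IntegrableOn.union ?_ ?_
  · refine (continuous_regLog one_pos).continuousOn.integrableOn_Icc.sub ?_
    rw [integrableOn_Icc_iff_integrableOn_Ioc, ← intervalIntegrable_iff_integrableOn_Ioc_of_le
      (by norm_num)]
    simp only [Real.log_abs]
    exact intervalIntegral.intervalIntegrable_log'
  · refine Integrable.mono' (integrable_inv_one_add_sq.integrableOn)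
      (((continuous_regLog one_pos).measurable.sub (by fun_prop)).aestronglyMeasurable) ?_
    rw [ae_restrict_iff' measurableSet_Icc.compl]
    refine Eventually.of_forall fun y hy => ?_
    have hy1 : 1 ≤ y ^ 2 := by
      rw [mem_compl_iff, mem_Icc, ← abs_le, not_le] at hy
      rw [← sq_abs]
      nlinarith
    have hy0 : y ≠ 0 := by rintro rfl; norm_num at hy1
    rw [Real.norm_of_nonneg (sub_nonneg.2 (log_le_regLog 1 hy0))]
    refine (regLog_sub_log_le hy0).trans ?_
    rw [inv_eq_one_div, one_pow]
    gcongr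
    linarith

lemma regLog_scale {κ : ℝ} (hκ : 0 < κ) {y : ℝ} (hy : y ≠ 0) :
    regLog κ y - Real.log |y| = regLog 1 (y / κ) - Real.log |y / κ| := by
  have h := regLog_sub_log hκ y
  rw [← h, Real.log_abs, Real.log_abs, Real.log_div hy hκ.ne']
  ring

/-- On average, the regularized logarithm is uniformly close to the logarithm. -/
lemma exists_regLog_average_bound : ∃ K : ℝ, ∀ κ : ℝ, 0 < κ → ∀ s : ℝ, 0 < s → ∀ z : ℝ,
    ∫ u in Icc (0 : ℝ) 1, regLog κ (z + s * u) ≤ avgLog z s + κ * K / s := by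
  set g : ℝ → ℝ := fun y => regLog 1 y - Real.log |y| with hg
  have hgnn : ∀ᵐ y : ℝ, 0 ≤ g y := by
    have : ∀ᵐ y : ℝ, y ≠ 0 := by simp [ae_iff]
    filter_upwards [this] with y hy
    exact sub_nonneg.2 (log_le_regLog 1 hy)
  -- By scaling, the excess of `regLog κ` over the logarithm has total integral `κ` times that of
  -- `g`. Averaging over a segment of length `s` divides by `s` at most, wherever the segment lies.
  refine ⟨∫ y, g y, fun κ hκ s hs z => ?_⟩
  have hcont : IntegrableOn (fun u : ℝ => regLog κ (z + s * u)) (Icc 0 1) :=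
    ((continuous_regLog hκ).comp (by fun_prop)).continuousOn.integrableOn_Icc
  have hsub : (∫ u in Icc (0 : ℝ) 1, regLog κ (z + s * u)) - avgLog z s =
      ∫ u in Icc (0 : ℝ) 1, (regLog κ (z + s * u) - Real.log |z + s * u|) :=
    (integral_sub hcont (integrableOn_log_affine hs.ne' z)).symm
  have hint : Integrable (fun u : ℝ => g ((z + s * u) / κ)) := by
    have h1 : Integrable fun y : ℝ => g (y / κ) := integrable_regLog_sub_log.comp_div hκ.ne'
    exact (h1.comp_add_left z).comp_mul_left' hs.ne'
  have hval : ∫ u : ℝ, g ((z + s * u) / κ) = κ * (∫ y, g y) / s := by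
    have h1 : ∫ u : ℝ, g ((z + s * u) / κ) = |s⁻¹| • ∫ u : ℝ, g ((z + u) / κ) :=
      Measure.integral_comp_mul_left (fun u : ℝ => g ((z + u) / κ)) s
    have h2 : ∫ u : ℝ, g ((z + u) / κ) = ∫ u : ℝ, g (u / κ) :=
      integral_add_left_eq_self (fun u : ℝ => g (u / κ)) z
    rw [h1, h2, Measure.integral_comp_div, abs_of_pos (inv_pos.2 hs), abs_of_pos hκ]
    simp only [smul_eq_mul]
    field_simp
  have hne : ∀ᵐ u : ℝ, z + s * u ≠ 0 := by
    have : {u : ℝ | ¬ z + s * u ≠ 0} ⊆ {-z / s} := by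
      intro u hu
      simp only [mem_ofPred_eq, not_not] at hu
      rw [mem_singleton_iff, eq_div_iff hs.ne']
      linarith
    exact measure_mono_null this (by simp)
  have hle : ∫ u in Icc (0 : ℝ) 1, (regLog κ (z + s * u) - Real.log |z + s * u|) ≤
      ∫ u : ℝ, g ((z + s * u) / κ) := by
    have h1 : ∫ u in Icc (0 : ℝ) 1, (regLog κ (z + s * u) - Real.log |z + s * u|) =
        ∫ u in Icc (0 : ℝ) 1, g ((z + s * u) / κ) := by
      refine integral_congr_ae (ae_restrict_of_ae ?_)
      filter_upwards [hne] with u hu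
      exact regLog_scale hκ hu
    rw [h1]
    refine setIntegral_le_integral hint ?_
    filter_upwards [hne] with u hu
    exact sub_nonneg.2 (log_le_regLog 1 (div_ne_zero hu hκ.ne'))
  linarith

lemma regPotential_segmentMeasure (κ x y : ℝ) {s : ℝ} (hs : s ≠ 0) :
    regPotential κ (segmentMeasure x s) y = ∫ u in Icc (0 : ℝ) 1, regLog κ ((x - y) + s * u) := by
  unfold regPotential
  rw [integral_segmentMeasure x hs]
  refine integral_congr_ae (Eventually.of_forall fun u => ?_)
  simp only
  rw [← regLog_neg]
  congr 1; ring

lemma potential_segmentMeasure (x y : ℝ) {s : ℝ} (hs : s ≠ 0) :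
    potential (segmentMeasure x s) y = avgLog (x - y) s :=
  integral_log_segmentMeasure x y hs

/-- Jensen's inequality for the weight of one eigenvalue. -/
lemma le_setIntegral_weight {m : ℕ} {β : ℝ} (hβ : 0 < β) {V : ℝ → ℝ} {A : Set ℝ}
    (t : Fin m → ℝ) {x s : ℝ} (hs : 0 < s) (hV : ContinuousOn V (Icc x (x + s)))
    (hA : Icc x (x + s) ⊆ A)
    (hint : IntegrableOn (fun y => weight (m + 1) β V (Fin.cons y t)) A) :
    restWeight m β V t * (s * Real.exp (-(((m + 1 : ℕ) : ℝ) * β / 2 *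
      ∫ y, V y ∂(segmentMeasure x s)) + β * ∑ j, potential (segmentMeasure x s) (t j))) ≤
      ∫ y in A, weight (m + 1) β V (Fin.cons y t) := by
  set n : ℝ := ((m + 1 : ℕ) : ℝ) with hn
  set ν := segmentMeasure x s with hν
  set G : ℝ → ℝ := fun y => Real.exp (-(n * β / 2 * V y)) * ∏ j, |y - t j| ^ β with hG
  set f : ℝ → ℝ := fun y => -(n * β / 2 * V y) + β * ∑ j, Real.log |y - t j| with hf
  have hseg : ∀ u ∈ Icc (0 : ℝ) 1, x + s * u ∈ Icc x (x + s) := fun u hu =>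
    ⟨by nlinarith [hu.1], by nlinarith [hu.2]⟩
  have hVint : Integrable V ν := by
    rw [hν, integrable_segmentMeasure x hs.ne']
    exact (hV.comp (by fun_prop) hseg).integrableOn_Icc
  have hlogint : ∀ j, Integrable (fun y => Real.log |y - t j|) ν := fun j => by
    simp only [abs_sub_comm _ (t j)]
    exact integrable_log_sub_segmentMeasure x (t j) hs.ne'
  have hfint : Integrable f ν :=
    (hVint.const_mul _).neg.add ((integrable_finsetSum _ fun j _ => hlogint j).const_mul _)
  have hGcont : ContinuousOn G (Icc x (x + s)) := by
    refine ContinuousOn.mul (Real.continuous_exp.comp_continuousOn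
      (continuousOn_const.mul hV).neg) (Continuous.continuousOn ?_)
    exact continuous_finsetProd _ fun j _ =>
      Continuous.rpow_const (by fun_prop) fun _ => Or.inr hβ.le
  have hGint : Integrable G ν := by
    rw [hν, integrable_segmentMeasure x hs.ne']
    exact (hGcont.comp (by fun_prop) hseg).integrableOn_Icc
  -- The identity fails when `y` meets some `t j`, where the product vanishes but `Real.log 0 = 0`.
  -- These points are null for `ν`.
  have hGf : G =ᵐ[ν] fun y => Real.exp (f y) := by
    have hne : ∀ᵐ y ∂ν, ∀ j, t j - y ≠ 0 := by
      rw [ae_all_iff]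
      exact fun j => ae_ne_of_noAtoms (t j) (segmentMeasure_singleton x hs.ne' (t j))
    filter_upwards [hne] with y hy
    simp only [hG, hf, Real.exp_add, Finset.mul_sum, Real.exp_sum]
    congr 1
    refine Finset.prod_congr rfl fun j _ => ?_
    have : 0 < |y - t j| := by
      rw [abs_sub_comm]; exact abs_pos.2 (hy j)
    rw [Real.rpow_def_of_pos this, mul_comm]
  have hjensen : Real.exp (∫ y, f y ∂ν) ≤ ∫ y, G y ∂ν := by
    rw [integral_congr_ae hGf]
    exact convexOn_exp.map_integral_le Real.continuous_exp.continuousOn isClosed_univ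
      (Eventually.of_forall fun _ => mem_univ _) hfint (hGint.congr hGf)
  have hfval : ∫ y, f y ∂ν = -(n * β / 2 * ∫ y, V y ∂ν) + β * ∑ j, potential ν (t j) := by
    have h1 : Integrable (fun y => -(n * β / 2 * V y)) ν := (hVint.const_mul _).neg
    have h2 : Integrable (fun y => β * ∑ j, Real.log |y - t j|) ν :=
      (integrable_finsetSum _ fun j _ => hlogint j).const_mul _
    change ∫ y, (-(n * β / 2 * V y) + β * ∑ j, Real.log |y - t j|) ∂ν = _
    rw [integral_add h1 h2, integral_neg,
      integral_const_mul, integral_const_mul, integral_finsetSum _ fun j _ => hlogint j]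
    simp only [potential, abs_sub_comm]
  have hGval : s * ∫ y, G y ∂ν = ∫ y in Icc x (x + s), G y := by
    rw [hν, integral_segmentMeasure x hs.ne', integral_Icc_eq_integral_Ioc,
      ← intervalIntegral.integral_of_le zero_le_one,
      intervalIntegral.integral_comp_add_mul G hs.ne', integral_Icc_eq_integral_Ioc,
      ← intervalIntegral.integral_of_le (by linarith)]
    simp only [mul_zero, add_zero, mul_one, smul_eq_mul]
    field_simp
  rw [← hfval]
  calc restWeight m β V t * (s * Real.exp (∫ y, f y ∂ν))
      ≤ restWeight m β V t * (s * ∫ y, G y ∂ν) := by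
        have := restWeight_nonneg m β V t
        gcongr
    _ = ∫ y in Icc x (x + s), weight (m + 1) β V (Fin.cons y t) := by
        rw [hGval, ← integral_const_mul]
        simp only [weight_cons, hG, hn]
    _ ≤ _ := setIntegral_mono_set hint
        (Eventually.of_forall fun y => weight_nonneg _ _ _ _) hA.eventuallyLE

end BetaEnsemble

/-! ### Moving an outlying eigenvalue to the support -/

namespace BetaEnsemble

open scoped Topology

/-- The growth in `a` is only `1 + logOneAdd a`, the same as that of the gap in `exists_rate_gap`.
The Cauchy-Schwarz error can thus be a small fraction of the gap for all `a` at once. -/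
lemma regDist_dirac_le {κ : ℝ} (hκ : 0 < κ) (hκ1 : κ ≤ 1) (a : ℝ) {ν : Measure ℝ}
    [IsProbabilityMeasure ν] (h : Integrable logOneAdd ν) :
    regDist κ (Measure.dirac a) ν ≤
      2 * (1 + (∫ y, logOneAdd y ∂ν) + |Real.log κ|) * (1 + logOneAdd a) := by
  have hd : Integrable logOneAdd (Measure.dirac a) := integrable_dirac (by simp)
  have e1 : regEnergy κ (Measure.dirac a) ν = regPotential κ ν a := by
    rw [regEnergy_eq_integral hκ hκ1 hd h, integral_dirac]
  have e2 : regEnergy κ (Measure.dirac a) (Measure.dirac a) = Real.log κ := by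
    rw [regEnergy_eq_integral hκ hκ1 hd hd, integral_dirac]
    unfold regPotential
    rw [integral_dirac, sub_self, regLog_zero]
  have e3 : Real.log κ ≤ regEnergy κ ν ν := by
    have := integral_mono (integrable_const (Real.log κ)) (integrable_regLog_prod hκ hκ1 h h)
      fun p => log_le_regLog_zero hκ (p.1 - p.2)
    rw [integral_const, probReal_univ, one_smul] at this
    exact this
  have h1 := regPotential_le hκ hκ1 h a
  have h2 : 0 ≤ ∫ y, logOneAdd y ∂ν := integral_nonneg fun y => logOneAdd_nonneg y
  have h3 := logOneAdd_nonneg a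
  unfold regDist
  rw [e1, e2]
  nlinarith [neg_abs_le (Real.log κ), abs_nonneg (Real.log κ), mul_nonneg h2 h3,
    mul_nonneg (abs_nonneg (Real.log κ)) h3]

lemma weight_cons_le_exp (m : ℕ) {β : ℝ} (hβ : 0 < β) (κ : ℝ) (V : ℝ → ℝ) (a : ℝ)
    (t : Fin m → ℝ) : weight (m + 1) β V (Fin.cons a t) ≤ restWeight m β V t *
      Real.exp (-(((m + 1 : ℕ) : ℝ) * β / 2 * V a) + β * ∑ j, regLog κ (a - t j)) := by
  rw [weight_cons, Real.exp_add, Finset.mul_sum, Real.exp_sum]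
  have h1 : ∏ j, |a - t j| ^ β ≤ ∏ j, Real.exp (β * regLog κ (a - t j)) := by
    refine Finset.prod_le_prod (fun j _ => by positivity) fun j _ => ?_
    rw [mul_comm, Real.exp_mul]
    exact Real.rpow_le_rpow (abs_nonneg _) (abs_le_exp_regLog κ _) hβ.le
  have h2 := restWeight_nonneg m β V t
  gcongr

/-- If the empirical measure of a configuration with an eigenvalue at `a` is close to the
equilibrium measure, then moving this eigenvalue to the support increases the weight by an
exponential factor. -/
lemma weight_cons_le_of_regDist_le {V : ℝ → ℝ} {μ : Measure ℝ} [IsProbabilityMeasure μ]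
    (h1 : Integrable logOneAdd μ) {β κ c x s a : ℝ} (hβ : 0 < β) (hκ : 0 < κ) (hκ1 : κ ≤ 1)
    (hc : 0 < c) (hs : 0 < s) {A : Set ℝ} (hV : ContinuousOn V (Icc x (x + s)))
    (hA : Icc x (x + s) ⊆ A)
    (hgap : robinConstant V μ + c * (1 + logOneAdd a) ≤ rate V μ a)
    (hfar : regPotential κ μ a ≤ potential μ a + c / 8)
    (hseg : (∫ y, V y ∂(segmentMeasure x s)) / 2 - logEnergy μ (segmentMeasure x s) ≤
      robinConstant V μ + c / 8)
    (hK : ∀ y, regPotential κ (segmentMeasure x s) y ≤ potential (segmentMeasure x s) y + c / 8)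
    {m : ℕ} {t : Fin m → ℝ}
    (hdist : regDist κ (empirical (Fin.cons a t : Fin (m + 1) → ℝ)) μ ≤
      c ^ 2 / (32 * (1 + (∫ y, logOneAdd y ∂(segmentMeasure x s)) + |Real.log κ|)))
    (hN1 : 1 + (∫ y, logOneAdd y ∂(segmentMeasure x s)) + |Real.log κ| ≤
      ((m + 1 : ℕ) : ℝ) * c / 8)
    (hN2 : -Real.log s ≤ β * ((m + 1 : ℕ) : ℝ) * c / 8)
    (hint : IntegrableOn (fun y => weight (m + 1) β V (Fin.cons y t)) A) :
    weight (m + 1) β V (Fin.cons a t) ≤ Real.exp (-(β * ((m + 1 : ℕ) : ℝ) * c / 8)) *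
      ∫ y in A, weight (m + 1) β V (Fin.cons y t) := by
  set ν := segmentMeasure x s with hν
  set n : ℝ := ((m + 1 : ℕ) : ℝ) with hn
  set L := empirical (Fin.cons a t : Fin (m + 1) → ℝ) with hL
  set D := 1 + (∫ y, logOneAdd y ∂ν) + |Real.log κ| with hD
  have hn0 : 0 < n := by rw [hn]; positivity
  have hνint : Integrable logOneAdd ν := integrable_logOneAdd_segmentMeasure x hs.ne'
  have hm0 : 0 ≤ ∫ y, logOneAdd y ∂ν := integral_nonneg fun y => logOneAdd_nonneg y
  have hD1 : 1 ≤ D := by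
    have := abs_nonneg (Real.log κ)
    linarith
  have hD0 : 0 < D := by linarith
  have hLa := logOneAdd_nonneg a
  have hLint : Integrable logOneAdd L := integrable_empirical _ _
  have hdint : Integrable logOneAdd (Measure.dirac a) := integrable_dirac (by simp)
  -- the Cauchy-Schwarz inequality
  have hcs := regEnergy_cross_le (t := c / (8 * D)) hκ hκ1 (by positivity) hLint h1 hdint hνint
  -- The parameter `t = c / (8 D)` and the threshold `c² / (32 D)` are matched: the first term is at
  -- most `c / 8` and the second at most `c / 8` times `1 + logOneAdd a`.
  have hq1 : regDist κ L μ / (2 * (c / (8 * D))) ≤ c / 8 := by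
    rw [div_le_iff₀ (by positivity)]
    refine hdist.trans (le_of_eq ?_)
    field_simp
    norm_num
  have hq2 : c / (8 * D) * regDist κ (Measure.dirac a) ν / 2 ≤ c / 8 * (1 + logOneAdd a) := by
    have := mul_le_mul_of_nonneg_left (regDist_dirac_le hκ hκ1 a hνint)
      (show 0 ≤ c / (8 * D) by positivity)
    rw [← hD] at this
    have e : c / (8 * D) * (2 * D * (1 + logOneAdd a)) = c / 4 * (1 + logOneAdd a) := by
      field_simp
      norm_num
    rw [e] at this
    linarith
  -- The empirical measure contains the eigenvalue at `a` itself. It adds the self-interaction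
  -- `Real.log κ` here and `regPotential κ ν a` in `e3`, both absorbed through `hN1`.
  have e1 : regEnergy κ (Measure.dirac a) L = n⁻¹ * (Real.log κ + ∑ j, regLog κ (a - t j)) := by
    rw [regEnergy_comm, regEnergy_empirical hκ hκ1 _ hdint, Fin.sum_univ_succ]
    simp only [Fin.cons_zero, Fin.cons_succ, regPotential, integral_dirac, sub_self, regLog_zero]
    congr 3
    funext j
    rw [← regLog_neg, neg_sub]
  have e2 : regEnergy κ (Measure.dirac a) μ = regPotential κ μ a := by
    rw [regEnergy_eq_integral hκ hκ1 hdint h1, integral_dirac]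
  have e3 : regEnergy κ ν L = n⁻¹ * (regPotential κ ν a + ∑ j, regPotential κ ν (t j)) := by
    rw [regEnergy_comm, regEnergy_empirical hκ hκ1 _ hνint, Fin.sum_univ_succ]
    simp only [Fin.cons_zero, Fin.cons_succ, hn]
  have e4 : logEnergy μ ν ≤ regEnergy κ ν μ := by
    rw [regEnergy_comm]
    exact logEnergy_le_regEnergy hκ hκ1 (segmentMeasure_singleton x hs.ne')
      (integrable_log_prod_segmentMeasure h1 x hs.ne') h1 hνint
  rw [e1, e2, e3] at hcs
  have hsum : ∑ j, regLog κ (a - t j) - ∑ j, regPotential κ ν (t j) ≤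
      n * (regPotential κ μ a - logEnergy μ ν + c / 8 + c / 8 * (1 + logOneAdd a)) -
        Real.log κ + regPotential κ ν a := by
    have h2 : n⁻¹ * ((Real.log κ + ∑ j, regLog κ (a - t j)) -
        (regPotential κ ν a + ∑ j, regPotential κ ν (t j))) ≤
        regPotential κ μ a - logEnergy μ ν + c / 8 + c / 8 * (1 + logOneAdd a) := by
      rw [mul_sub]
      linarith
    rw [inv_mul_le_iff₀ hn0] at h2
    linarith
  have hpot : ∑ j, regPotential κ ν (t j) ≤ ∑ j, potential ν (t j) + n * (c / 8) := by
    have := Finset.sum_le_sum fun j (_ : j ∈ Finset.univ) => hK (t j)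
    simp only [Finset.sum_add_distrib, Finset.sum_const, Finset.card_univ, Fintype.card_fin,
      nsmul_eq_mul] at this
    have h2 : (m : ℝ) * (c / 8) ≤ n * (c / 8) := by
      rw [hn]; push_cast; nlinarith
    linarith
  have hself : -Real.log κ + regPotential κ ν a ≤ D * (1 + logOneAdd a) := by
    have h2 := regPotential_le hκ hκ1 hνint a
    nlinarith [neg_abs_le (Real.log κ), abs_nonneg (Real.log κ), mul_nonneg hm0 hLa,
      mul_nonneg (abs_nonneg (Real.log κ)) hLa]
  have hrate : V a / 2 = rate V μ a + potential μ a := by unfold rate potential; ring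
  -- Per eigenvalue, the gap gains `c (1 + logOneAdd a)`. The losses are four times `c / 8` (from
  -- `hfar`, `hseg`, `hK` and the first Cauchy-Schwarz term) and twice `c / 8 * (1 + logOneAdd a)`
  -- (from the second one and the self-interaction). At least `c / 4` is left, half of which pays
  -- for the length `s` of the segment.
  have hexp : -(n * β / 2 * V a) + β * ∑ j, regLog κ (a - t j) ≤
      -(β * n * c / 8) + Real.log s + (-(n * β / 2 * ∫ y, V y ∂ν) +
        β * ∑ j, potential ν (t j)) := by
    have h2 : D * (1 + logOneAdd a) ≤ n * c / 8 * (1 + logOneAdd a) := by gcongr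
    have h3 : n * (regPotential κ μ a - V a / 2 + (∫ y, V y ∂ν) / 2 - logEnergy μ ν) ≤
        n * (c / 4 - c * (1 + logOneAdd a)) :=
      mul_le_mul_of_nonneg_left (by linarith) hn0.le
    have h4 : ∑ j, regLog κ (a - t j) - ∑ j, potential ν (t j) + n * ((∫ y, V y ∂ν) / 2 - V a / 2) ≤
        -(n * c / 4) := by
      have h5 : 0 ≤ n * c * logOneAdd a := by positivity
      nlinarith
    have h6 := mul_le_mul_of_nonneg_left h4 hβ.le
    linarith
  refine (weight_cons_le_exp m hβ κ V a t).trans ?_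
  have hj := le_setIntegral_weight hβ t hs hV hA hint
  have h5 := mul_le_mul_of_nonneg_left hj (Real.exp_pos (-(β * n * c / 8))).le
  refine le_trans ?_ h5
  have h6 : Real.exp (-(β * n * c / 8)) * (restWeight m β V t * (s * Real.exp (-(n * β / 2 *
      ∫ y, V y ∂ν) + β * ∑ j, potential ν (t j)))) = restWeight m β V t *
      Real.exp (-(β * n * c / 8) + Real.log s + (-(n * β / 2 * ∫ y, V y ∂ν) +
        β * ∑ j, potential ν (t j))) := by
    rw [Real.exp_add (-(β * n * c / 8) + Real.log s), Real.exp_add (-(β * n * c / 8)),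
      Real.exp_log hs]
    ring
  rw [h6]
  have := restWeight_nonneg m β V t
  gcongr

end BetaEnsemble

/-! ### The boundary term is exponentially small -/

namespace BetaEnsemble

open scoped Topology

/-- The function `∏ᵢ (1 + |lᵢ|)⁻²`. -/
noncomputable def tailProd {N : ℕ} (l : Fin N → ℝ) : ℝ := ∏ i, Real.exp (-(2 * logOneAdd (l i)))

lemma tailProd_nonneg {N : ℕ} (l : Fin N → ℝ) : 0 ≤ tailProd l :=
  Finset.prod_nonneg fun _ _ => (Real.exp_pos _).le

lemma exp_neg_logOneAdd_le_one (x : ℝ) : Real.exp (-(2 * logOneAdd x)) ≤ 1 := by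
  rw [Real.exp_le_one_iff]
  linarith [logOneAdd_nonneg x]

lemma tailProd_insertNth_le {m : ℕ} (i : Fin (m + 1)) (x : ℝ) (t : Fin m → ℝ) :
    tailProd (i.insertNth x t : Fin (m + 1) → ℝ) ≤ tailProd t := by
  unfold tailProd
  rw [Fin.prod_univ_succAbove _ i]
  simp only [Fin.insertNth_apply_same, Fin.insertNth_apply_succAbove]
  exact mul_le_of_le_one_left (tailProd_nonneg t) (exp_neg_logOneAdd_le_one x)

lemma integrable_tailProd (N : ℕ) : Integrable (tailProd (N := N)) :=
  Integrable.fintype_prod (f := fun _ x => Real.exp (-(2 * logOneAdd x)))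
    (μ := fun _ => volume) fun _ => integrable_tail

lemma integral_tailProd (N : ℕ) :
    ∫ l : Fin N → ℝ, tailProd l = (∫ x : ℝ, Real.exp (-(2 * logOneAdd x))) ^ N := by
  unfold tailProd
  rw [integral_fintype_prod_volume_eq_prod (fun _ x => Real.exp (-(2 * logOneAdd x)))]
  simp

lemma integrableOn_of_le_tailProd {E : Type*} [NormedAddCommGroup E] {N : ℕ}
    {f : (Fin N → ℝ) → E} {A : Set ℝ} (hA : MeasurableSet A) (hf : ContinuousOn f (cube N A))
    {K : ℝ} (hK : ∀ l ∈ cube N A, ‖f l‖ ≤ K * tailProd l) : IntegrableOn f (cube N A) := by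
  refine Integrable.mono' ((integrable_tailProd N).const_mul K).integrableOn
    (hf.aestronglyMeasurable (measurableSet_cube N hA)) ?_
  rw [ae_restrict_iff' (measurableSet_cube N hA)]
  exact Eventually.of_forall hK

/-- Half of the exponential rate is spent on the prefactor `2 N`. -/
lemma eventually_two_mul_exp_le {b : ℝ} (hb : 0 < b) :
    ∀ᶠ N : ℕ in atTop, (N : ℝ) * (2 * Real.exp (-(2 * b * N))) ≤ Real.exp (-(N * b)) := by
  have h1 : Tendsto (fun N : ℕ => b * (N : ℝ)) atTop atTop :=
    tendsto_natCast_atTop_atTop.const_mul_atTop hb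
  have h2 := (Real.tendsto_pow_mul_exp_neg_atTop_nhds_zero 1).comp h1
  filter_upwards [h2.eventually_lt_const (show 0 < b / 2 by positivity)] with N hN
  simp only [Function.comp, pow_one] at hN
  have h3 : Real.exp (-(2 * b * N)) = Real.exp (-(b * N)) * Real.exp (-(N * b)) := by
    rw [← Real.exp_add]; ring_nf
  have h4 : 2 * (N * Real.exp (-(b * N))) ≤ 1 := by
    have : b * N * Real.exp (-(b * N)) = b * (N * Real.exp (-(b * N))) := by ring
    rw [this] at hN
    have h5 := lt_of_mul_lt_mul_left (by linarith : b * (N * Real.exp (-(b * N))) < b * (1 / 2)) hb.le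
    linarith
  rw [h3]
  have := mul_le_mul_of_nonneg_right h4 (Real.exp_pos (-(N * b))).le
  linarith

lemma eventually_const_le_mul {b : ℝ} (hb : 0 < b) (C : ℝ) :
    ∀ᶠ N : ℕ in atTop, C ≤ b * (N : ℝ) :=
  (tendsto_natCast_atTop_atTop.const_mul_atTop hb).eventually_ge_atTop C

section Slices

variable {m : ℕ} {β : ℝ} {V : ℝ → ℝ} {A : Set ℝ}

lemma integrableOn_weight_slices (i : Fin (m + 1))
    (hint : IntegrableOn (weight (m + 1) β V) (cube (m + 1) A)) :
    Integrable (fun p : ℝ × (Fin m → ℝ) => weight (m + 1) β V (Fin.cons p.1 p.2))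
      ((volume.restrict A).prod (volume.restrict (cube m A))) := by
  have h := integrableOn_insertNth i hint
  rw [preimage_insertNth_cube] at h
  simp only [weight_insertNth] at h
  rw [Measure.prod_restrict]
  exact h

lemma partitionFunction_eq_slices
    (hint : IntegrableOn (weight (m + 1) β V) (cube (m + 1) A)) :
    partitionFunction (m + 1) β V A =
      ∫ t in cube m A, ∫ x in A, weight (m + 1) β V (Fin.cons x t) := by
  unfold partitionFunction
  rw [setIntegral_insertNth 0, preimage_insertNth_cube]
  simp only [weight_insertNth]
  rw [← Measure.prod_restrict, integral_prod_symm _ (integrableOn_weight_slices 0 hint)]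

end Slices

section Equilibrium

variable {V : ℝ → ℝ} {bm bp : EReal} {μ : Measure ℝ}
variable (hbm : bm < bp) (hV : IsConfining V bm bp)
  (hμ : IsEquilibriumMeasure V (interval bm bp) μ)

include hbm hV hμ

lemma regPotential_le_of_far {κ ε a : ℝ} (hκ : 0 < κ) (hκ1 : κ ≤ 1) (hε : 0 < ε)
    (ha : a ∉ Ioo (leftEnd μ - ε) (rightEnd μ + ε)) :
    regPotential κ μ a ≤ potential μ a + κ ^ 2 / (2 * ε ^ 2) := by
  have := hμ.1.isProbabilityMeasure
  have h1 := hμ.1.integrable_logOneAdd hV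
  have hlog := integrable_log_equilibrium hbm hV hμ a
  have h2 := integral_mono_ae (integrable_regLog_sub hκ hκ1 h1 a)
    (hlog.add (integrable_const (κ ^ 2 / (2 * ε ^ 2)))) (by
    filter_upwards [ae_mem_Icc hbm hV hμ] with y hy
    have hfar : ε ≤ |a - y| := by
      rcases le_or_gt a (leftEnd μ - ε) with h | h
      · exact le_abs.2 (Or.inr (by linarith [hy.1]))
      · have : rightEnd μ + ε ≤ a := not_lt.1 fun h' => ha ⟨h, h'⟩
        exact le_abs.2 (Or.inl (by linarith [hy.2]))
    have hne : a - y ≠ 0 := abs_pos.1 (hε.trans_le hfar)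
    have h3 := regLog_sub_log_le (κ := κ) hne
    have h4 : κ ^ 2 / (2 * (a - y) ^ 2) ≤ κ ^ 2 / (2 * ε ^ 2) := by
      rw [← sq_abs (a - y)]
      gcongr
    simp only [Pi.add_apply]
    linarith)
  refine h2.trans (le_of_eq ?_)
  simp only [Pi.add_apply]
  rw [integral_add hlog (integrable_const _)]
  simp [potential]

/-- The contribution of the configurations with an eigenvalue far from the support is exponentially
small compared to the partition function. -/
theorem exists_edge_bound
    (hmin : ∀ x ∈ interval bm bp, IsMinOn (rate V μ) (interval bm bp) x →
      x ∈ Icc (leftEnd μ) (rightEnd μ)) {β ε : ℝ} (hβ : 0 < β) (hε : 0 < ε) :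
    ∃ η : ℝ, 0 < η ∧ ∃ N₀ : ℕ, ∀ m : ℕ, N₀ ≤ m + 1 →
      (∃ K : ℝ, ∀ l ∈ cube (m + 1) (interval bm bp), weight (m + 1) β V l ≤ K * tailProd l) ∧
      ∀ A : Set ℝ, MeasurableSet A → A ⊆ interval bm bp → Icc (leftEnd μ) (rightEnd μ) ⊆ A →
        0 < partitionFunction (m + 1) β V A ∧
        ∀ a ∈ interval bm bp \ Ioo (leftEnd μ - ε) (rightEnd μ + ε),
          ((m + 1 : ℕ) : ℝ) * ∫ t in cube m A, weight (m + 1) β V (Fin.cons a t) ≤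
            Real.exp (-(((m + 1 : ℕ) : ℝ) * η)) * partitionFunction (m + 1) β V A := by
  have hprob := hμ.1.isProbabilityMeasure
  have h1 := hμ.1.integrable_logOneAdd hV
  have hab := leftEnd_lt_rightEnd hbm hV hμ
  obtain ⟨c, hc, hgap⟩ := exists_rate_gap hbm hV hμ hmin hε
  -- the segment on which eigenvalues are put back
  obtain ⟨hx₀, hlog₀, hrate₀⟩ := rate_eq_of_mem_support hbm hV hμ (leftEnd_mem hbm hV hμ)
  set x := leftEnd μ with hx
  have hr : 0 < rightEnd μ - x := sub_pos.2 hab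
  have hsegI : ∀ u ∈ Icc (0 : ℝ) 1, x + (rightEnd μ - x) * u ∈ interval bm bp := fun u hu =>
    Icc_subset_interval hbm hV hμ ⟨by nlinarith [hu.1], by nlinarith [hu.2]⟩
  obtain ⟨τ, hseg, hτ⟩ := ((eventually_segment_rate_le hV.continuousOn h1 hr.ne' hsegI
    (hμ.1.noAtoms x) hlog₀ (show 0 < c / 8 by positivity)).and
      (Ioc_mem_nhdsGT (one_pos : (0 : ℝ) < 1))).exists
  set s := (rightEnd μ - x) * τ with hs_def
  have hs : 0 < s := mul_pos hr hτ.1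
  have hIcc : Icc x (x + s) ⊆ Icc (leftEnd μ) (rightEnd μ) :=
    Icc_subset_Icc le_rfl (by nlinarith [hτ.2])
  rw [hrate₀] at hseg
  -- the regularization
  obtain ⟨K, hK⟩ := exists_regLog_average_bound
  have hκex : ∃ κ : ℝ, κ * K / s < c / 8 ∧ κ ^ 2 / (2 * ε ^ 2) < c / 8 ∧ κ ∈ Ioc (0 : ℝ) 1 := by
    have e1 : ∀ᶠ κ : ℝ in 𝓝[>] 0, κ * K / s < c / 8 := by
      have : Tendsto (fun κ : ℝ => κ * K / s) (𝓝[>] 0) (𝓝 (0 * K / s)) :=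
        (Continuous.tendsto (by fun_prop) 0).mono_left nhdsWithin_le_nhds
      exact this.eventually_lt_const (by rw [zero_mul, zero_div]; positivity)
    have e2 : ∀ᶠ κ : ℝ in 𝓝[>] 0, κ ^ 2 / (2 * ε ^ 2) < c / 8 := by
      have : Tendsto (fun κ : ℝ => κ ^ 2 / (2 * ε ^ 2)) (𝓝[>] 0) (𝓝 (0 ^ 2 / (2 * ε ^ 2))) :=
        (Continuous.tendsto (by fun_prop) 0).mono_left nhdsWithin_le_nhds
      exact this.eventually_lt_const (by simpa using hc)
    exact (e1.and (e2.and (Ioc_mem_nhdsGT one_pos))).exists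
  obtain ⟨κ₁, hκK, hκε, hκ₁, hκ₁1⟩ := hκex
  set D := 1 + (∫ y, logOneAdd y ∂(segmentMeasure x s)) + |Real.log κ₁| with hD
  have hD0 : 0 < D := by
    have h2 : 0 ≤ ∫ y, logOneAdd y ∂(segmentMeasure x s) :=
      integral_nonneg fun y => logOneAdd_nonneg y
    have := abs_nonneg (Real.log κ₁)
    linarith
  set δ := c ^ 2 / (32 * D) with hδ
  have hδ0 : 0 < δ := by positivity
  -- Two scales are needed. The threshold `δ` depends on `κ₁` through `D`, while the weight bound
  -- with error `δ / 8` requires a scale `κ₂` chosen after `δ`. As `κ₂ ≤ κ₁`, a configuration far at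
  -- scale `κ₁` is also far at scale `κ₂`, by `regDist_anti`.
  obtain ⟨κ₂, hκ₂, hκ₂₁, hκ₂1, c₂, hc₂, hlow⟩ :=
    exists_regRate_lower_bound hbm hV hμ (show 0 < δ / 8 by positivity) hκ₁
  obtain ⟨N₁, hN₁⟩ := exists_partitionFunction_lower_bound hbm hV hμ hβ
    (show 0 < δ / 8 by positivity)
  set T := ∫ x : ℝ, Real.exp (-(2 * logOneAdd x)) with hT
  have hT0 : 0 < T := by
    rw [hT, integral_pos_iff_support_of_nonneg (fun x => (Real.exp_pos _).le) integrable_tail]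
    have : Function.support (fun x : ℝ => Real.exp (-(2 * logOneAdd x))) = univ := by
      ext x; simp [(Real.exp_pos _).ne']
    simp [this]
  set b := β * c / 16 with hb
  have hb0 : 0 < b := by positivity
  -- The far configurations have energy parameter at least `E - δ / 4 + δ` against `E + δ / 8` in
  -- the lower bound for `Z`. The difference `5 / 8 * δ`, times `N²`, must beat all terms of order
  -- `N`.
  obtain ⟨N₂, hN₂⟩ := eventually_atTop.1 ((eventually_const_le_mul (mul_pos hβ hc₂) 2).and
    ((eventually_const_le_mul (show 0 < c / 8 by positivity) D).and
    ((eventually_const_le_mul (show 0 < β * c / 8 by positivity) (-Real.log s)).and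
    ((eventually_const_le_mul (show 0 < β / 2 * (5 / 8 * δ) by positivity)
      (β / 2 * |Real.log κ₂| + |Real.log T| + β * c / 8)).and
    (eventually_two_mul_exp_le hb0)))))
  refine ⟨b, hb0, max N₁ N₂, fun m hm => ?_⟩
  have hmN₁ := hN₁ (m + 1) ((le_max_left _ _).trans hm)
  obtain ⟨hn1, hn2, hn3, hn4, hn5⟩ := hN₂ (m + 1) ((le_max_right _ _).trans hm)
  set n : ℝ := ((m + 1 : ℕ) : ℝ) with hn
  have hn0 : 0 < n := by rw [hn]; positivity
  have htail : ∀ q : ℝ, ∀ l ∈ cube (m + 1) (interval bm bp),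
      q ≤ regDist κ₂ (empirical l) μ → weight (m + 1) β V l ≤
        Real.exp (-(β / 2 * (n ^ 2 * (energy V μ - 2 * (δ / 8) + q) + n * Real.log κ₂))) *
          tailProd l := fun q l hl hq =>
    weight_le_tail hV hμ.1 hβ hκ₂ hκ₂1 hlow (by linarith) hl hq
  have hbound : ∀ l ∈ cube (m + 1) (interval bm bp), weight (m + 1) β V l ≤
      Real.exp (-(β / 2 * (n ^ 2 * (energy V μ - 2 * (δ / 8) + 0) + n * Real.log κ₂))) *
        tailProd l := fun l hl =>
    htail 0 l hl (regDist_nonneg hκ₂ hκ₂1 (integrable_empirical l _) h1)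
  refine ⟨⟨_, hbound⟩, fun A hAm hAI hA => ?_⟩
  have hint : IntegrableOn (weight (m + 1) β V) (cube (m + 1) A) :=
    integrableOn_of_le_tailProd hAm (continuousOn_weight _ hβ (hV.continuousOn.mono hAI))
      fun l hl => by
        rw [Real.norm_of_nonneg (weight_nonneg _ _ _ _)]
        exact hbound l fun i => hAI (hl i)
  have hZ := hmN₁ A hA hint
  set Z := partitionFunction (m + 1) β V A with hZdef
  refine ⟨(Real.exp_pos _).trans_le hZ, fun a ha => ?_⟩
  set w := Real.exp (-(β / 2 * (n ^ 2 * (energy V μ - 2 * (δ / 8) + δ) + n * Real.log κ₂)))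
    with hw
  have hslices := integrableOn_weight_slices 0 hint
  -- the pointwise bound
  have hpt : ∀ᵐ t ∂(volume.restrict (cube m A)), weight (m + 1) β V (Fin.cons a t) ≤
      Real.exp (-(β * n * c / 8)) * (∫ y in A, weight (m + 1) β V (Fin.cons y t)) +
        w * tailProd t := by
    filter_upwards [hslices.prod_left_ae, ae_restrict_mem (measurableSet_cube m hAm)] with t ht htA
    have hl : (Fin.cons a t : Fin (m + 1) → ℝ) ∈ cube (m + 1) (interval bm bp) := by
      rw [← Fin.insertNth_zero', insertNth_mem_cube]
      exact ⟨ha.1, fun i => hAI (htA i)⟩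
    have hI0 : 0 ≤ ∫ y in A, weight (m + 1) β V (Fin.cons y t) :=
      integral_nonneg fun y => weight_nonneg _ _ _ _
    have hexp0 := (Real.exp_pos (-(β * n * c / 8))).le
    -- Near the equilibrium measure the moved eigenvalue gives the gain; far from it the whole
    -- configuration has small weight.
    rcases le_or_gt (regDist κ₁ (empirical (Fin.cons a t : Fin (m + 1) → ℝ)) μ) δ with hd | hd
    · have h2 := weight_cons_le_of_regDist_le h1 hβ hκ₁ hκ₁1 hc hs
        (hV.continuousOn.mono (hIcc.trans (Icc_subset_interval hbm hV hμ))) (hIcc.trans hA)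
        (hgap a ha) ((regPotential_le_of_far hbm hV hμ hκ₁ hκ₁1 hε ha.2).trans (by linarith))
        hseg (fun y => by
          rw [regPotential_segmentMeasure _ _ _ hs.ne', potential_segmentMeasure _ _ hs.ne']
          exact (hK κ₁ hκ₁ s hs (x - y)).trans (by linarith))
        hd (by linarith) (by linarith) ht
      exact h2.trans (le_add_of_nonneg_right (mul_nonneg (Real.exp_pos _).le (tailProd_nonneg t)))
    · have h2 := htail δ _ hl (hd.le.trans (regDist_anti hκ₂ hκ₂₁ hκ₁1
        (integrable_empirical _ _) h1))
      have h3 := tailProd_insertNth_le 0 a t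
      rw [Fin.insertNth_zero'] at h3
      refine h2.trans ((mul_le_mul_of_nonneg_left h3 (Real.exp_pos _).le).trans ?_)
      exact le_add_of_nonneg_left (mul_nonneg hexp0 hI0)
  -- integration
  have hin : Integrable (fun t => ∫ y in A, weight (m + 1) β V (Fin.cons y t))
      (volume.restrict (cube m A)) := hslices.integral_prod_right
  have htl : IntegrableOn (tailProd (N := m)) (cube m A) := (integrable_tailProd m).integrableOn
  have hmain : ∫ t in cube m A, weight (m + 1) β V (Fin.cons a t) ≤
      Real.exp (-(β * n * c / 8)) * Z + w * T ^ m := by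
    have h2 := integral_mono_of_nonneg (Eventually.of_forall fun t => weight_nonneg _ _ _ _)
      ((hin.const_mul (Real.exp (-(β * n * c / 8)))).add (htl.const_mul w)) hpt
    refine h2.trans ?_
    simp only [Pi.add_apply]
    rw [integral_add (hin.const_mul _) (htl.const_mul w), integral_const_mul, integral_const_mul,
      ← partitionFunction_eq_slices hint, ← integral_tailProd]
    have h3 : ∫ t in cube m A, tailProd t ≤ ∫ t : Fin m → ℝ, tailProd t :=
      setIntegral_le_integral (integrable_tailProd m) (Eventually.of_forall tailProd_nonneg)
    have h4 := mul_le_mul_of_nonneg_left h3 (Real.exp_pos _ |>.le : 0 ≤ w)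
    linarith
  have hbad : w * T ^ m ≤ Real.exp (-(β * n * c / 8)) * Z := by
    refine le_trans ?_ (mul_le_mul_of_nonneg_left hZ (Real.exp_pos _).le)
    have h2 : T ^ m ≤ Real.exp (n * |Real.log T|) := by
      rw [← Real.exp_log (pow_pos hT0 m), Real.log_pow]
      apply Real.exp_le_exp.2
      have h3 : (m : ℝ) ≤ n := by rw [hn]; push_cast; linarith
      exact (mul_le_mul_of_nonneg_left (le_abs_self _) m.cast_nonneg).trans
        (mul_le_mul_of_nonneg_right h3 (abs_nonneg _))
    refine (mul_le_mul_of_nonneg_left h2 (Real.exp_pos _).le).trans ?_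
    rw [← Real.exp_add, ← Real.exp_add]
    apply Real.exp_le_exp.2
    have h4 := mul_le_mul_of_nonneg_left hn4 hn0.le
    have h5 := mul_le_mul_of_nonneg_left (neg_abs_le (Real.log κ₂)) (show 0 ≤ β / 2 * n by positivity)
    linarith
  have hfin : n * (2 * Real.exp (-(β * n * c / 8))) ≤ Real.exp (-(n * b)) := by
    have e : 2 * b * n = β * n * c / 8 := by rw [hb]; ring
    rw [← e]
    exact hn5
  have hZ0 : 0 ≤ Z := (Real.exp_pos _).le.trans hZ
  calc n * ∫ t in cube m A, weight (m + 1) β V (Fin.cons a t)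
      ≤ n * (2 * Real.exp (-(β * n * c / 8)) * Z) := by
        refine mul_le_mul_of_nonneg_left ?_ hn0.le
        linarith
    _ = n * (2 * Real.exp (-(β * n * c / 8))) * Z := by ring
    _ ≤ _ := mul_le_mul_of_nonneg_right hfin hZ0

end Equilibrium

end BetaEnsemble

/-! ### Differentiating an integral over a cube in its end point -/

namespace BetaEnsemble

open scoped Topology

section Slope

variable {E : Type*} [NormedAddCommGroup E] [NormedSpace ℝ E]

lemma mem_interval_coe_left {s x : ℝ} {c : EReal} :
    x ∈ interval s c ↔ s ≤ x ∧ (x : EReal) ≤ c := by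
  unfold interval
  rw [mem_ofPred_eq, EReal.coe_le_coe_iff]

lemma mem_interval_coe_right {s x : ℝ} {b : EReal} :
    x ∈ interval b s ↔ b ≤ (x : EReal) ∧ x ≤ s := by
  unfold interval
  rw [mem_ofPred_eq, EReal.coe_le_coe_iff]

lemma volume_setOf_apply_eq_apply {ι : Type*} [Fintype ι] {i j : ι} (hij : i ≠ j) :
    volume {l : ι → ℝ | l i = l j} = 0 := by
  classical
  let φ : (ι → ℝ) →ₗ[ℝ] ℝ := (LinearMap.proj i : (ι → ℝ) →ₗ[ℝ] ℝ) - LinearMap.proj j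
  have h : {l : ι → ℝ | l i = l j} = (LinearMap.ker φ : Set (ι → ℝ)) := by
    ext l
    simp [φ, sub_eq_zero]
  rw [h]
  refine Measure.addHaar_submodule _ _ fun htop => ?_
  have h1 : Pi.single i (1 : ℝ) ∈ LinearMap.ker φ := htop ▸ Submodule.mem_top
  simp [φ, hij.symm] at h1

lemma volume_setOf_apply_eq {ι : Type*} [Fintype ι] (i : ι) (a : ℝ) :
    volume {l : ι → ℝ | l i = a} = 0 :=
  Measure.pi_hyperplane (fun _ : ι => (volume : Measure ℝ)) i a

/-- The configurations in `[s, c]` whose smallest point is the one with index `i`. -/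
def minAt (m : ℕ) (c : EReal) (s : ℝ) (i : Fin (m + 1)) : Set (Fin (m + 1) → ℝ) :=
  {l | (s ≤ l i ∧ (l i : EReal) ≤ c) ∧ ∀ j, l i ≤ l j ∧ (l j : EReal) ≤ c}

lemma isClosed_minAt (m : ℕ) (c : EReal) (s : ℝ) (i : Fin (m + 1)) :
    IsClosed (minAt m c s i) := by
  have hc : ∀ j : Fin (m + 1), Continuous fun l : Fin (m + 1) → ℝ => (l j : EReal) := fun j =>
    continuous_coe_real_ereal.comp (continuous_apply j)
  refine IsClosed.and ((isClosed_le continuous_const (continuous_apply i)).and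
    (isClosed_le (hc i) continuous_const)) ?_
  simp only [ofPred_forall]
  exact isClosed_iInter fun j => (isClosed_le (continuous_apply i) (continuous_apply j)).and
    (isClosed_le (hc j) continuous_const)

lemma iUnion_minAt (m : ℕ) (c : EReal) (s : ℝ) :
    ⋃ i, minAt m c s i = cube (m + 1) (interval s c) := by
  ext l
  simp only [mem_iUnion, minAt, cube, mem_ofPred_eq, mem_interval_coe_left]
  constructor
  · rintro ⟨i, h, h'⟩ j
    exact ⟨h.1.trans (h' j).1, (h' j).2⟩
  · intro h
    obtain ⟨i, hi⟩ := Finite.exists_min l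
    exact ⟨i, h i, fun j => ⟨hi j, (h j).2⟩⟩

/-- Overlaps require a tie between two coordinates, which lies in a hyperplane. -/
lemma aedisjoint_minAt (m : ℕ) (c : EReal) (s : ℝ) :
    Pairwise (Function.onFun (AEDisjoint volume) (minAt m c s)) := by
  intro i j hij
  refine measure_mono_null ?_ (volume_setOf_apply_eq_apply hij)
  rintro l ⟨h1, h2⟩
  exact le_antisymm (h1.2 j).1 (h2.2 i).1

/-- Once the smallest point `x` is fixed, the others range over `[x, c]`, independently of `s`. The
moving end point thus enters only as the limit of a one-dimensional integral. -/
lemma insertNth_mem_minAt {m : ℕ} {c : EReal} {s : ℝ} {i : Fin (m + 1)} {x : ℝ} {t : Fin m → ℝ} :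
    (i.insertNth x t : Fin (m + 1) → ℝ) ∈ minAt m c s i ↔
      x ∈ interval s c ∧ t ∈ cube m (interval x c) := by
  simp only [minAt, cube, mem_ofPred_eq, mem_interval_coe_left]
  rw [Fin.forall_iff_succAbove i]
  simp only [Fin.insertNth_apply_same, Fin.insertNth_apply_succAbove, le_refl, true_and]
  tauto

/-- The integral over the remaining points when the smallest point, of index `i`, is `x`. -/
noncomputable def minSlice {m : ℕ} (c : EReal) (s : ℝ) (f : (Fin (m + 1) → ℝ) → E)
    (i : Fin (m + 1)) (x : ℝ) : E :=
  ∫ t, (minAt m c s i).indicator f (i.insertNth x t)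

lemma minSlice_eq {m : ℕ} {c : EReal} {s : ℝ} (f : (Fin (m + 1) → ℝ) → E)
    (i : Fin (m + 1)) {x : ℝ} (hx : x ∈ interval s c) :
    minSlice c s f i x = ∫ t in cube m (interval x c), f (i.insertNth x t) := by
  rw [← integral_indicator (measurableSet_cube m (isClosed_interval _ _).measurableSet)]
  refine integral_congr_ae (Eventually.of_forall fun t => ?_)
  by_cases ht : t ∈ cube m (interval x c)
  · simp only [indicator_of_mem ht]
    rw [indicator_of_mem (insertNth_mem_minAt.2 ⟨hx, ht⟩)]
  · simp only [indicator_of_notMem ht]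
    rw [indicator_of_notMem fun h => ht (insertNth_mem_minAt.1 h).2]

variable {m : ℕ} {c : EReal} {a' a : ℝ} {f : (Fin (m + 1) → ℝ) → E}

omit [NormedSpace ℝ E] in
lemma integrable_minAt_indicator (hf : IntegrableOn f (cube (m + 1) (interval a' c)))
    (i : Fin (m + 1)) :
    Integrable (fun p : ℝ × (Fin m → ℝ) => (minAt m c a' i).indicator f (i.insertNth p.1 p.2))
      (volume.prod volume) := by
  have h1 : IntegrableOn f (minAt m c a' i) :=
    hf.mono_set (iUnion_minAt m c a' ▸ subset_iUnion _ i)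
  exact (measurePreserving_insertNth m i).integrable_comp_of_integrable
    ((integrable_indicator_iff (isClosed_minAt m c a' i).measurableSet).2 h1)

lemma integrable_minSlice (hf : IntegrableOn f (cube (m + 1) (interval a' c)))
    (i : Fin (m + 1)) : Integrable (minSlice c a' f i) :=
  (integrable_minAt_indicator hf i).integral_prod_left

lemma setIntegral_cube_eq_sum (hf : IntegrableOn f (cube (m + 1) (interval a' c))) {s : ℝ}
    (hs : a' ≤ s) :
    ∫ l in cube (m + 1) (interval s c), f l = ∑ i, ∫ x in Ici s, minSlice c a' f i x := by
  have hsub : cube (m + 1) (interval s c) ⊆ cube (m + 1) (interval a' c) := fun l hl j => by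
    have := mem_interval_coe_left.1 (hl j)
    exact mem_interval_coe_left.2 ⟨hs.trans this.1, this.2⟩
  rw [← iUnion_minAt, integral_iUnion_ae
    (fun i => (isClosed_minAt m c s i).measurableSet.nullMeasurableSet)
    (aedisjoint_minAt m c s) (by rw [iUnion_minAt]; exact hf.mono_set hsub), tsum_fintype]
  refine Finset.sum_congr rfl fun i _ => ?_
  have hi := integrable_minAt_indicator hf i
  rw [← integral_indicator (isClosed_minAt m c s i).measurableSet,
    ← (measurePreserving_insertNth m i).integral_comp (measurableEmbedding_insertNth m i),
    ← integral_indicator measurableSet_Ici]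
  -- The region for `s` is the region for `a'` cut by the condition that the smallest point be at
  -- least `s`.
  have h : (fun p : ℝ × (Fin m → ℝ) => (minAt m c s i).indicator f (i.insertNth p.1 p.2)) =
      fun p => (Ici s ×ˢ univ).indicator
        (fun p : ℝ × (Fin m → ℝ) => (minAt m c a' i).indicator f (i.insertNth p.1 p.2)) p := by
    funext p
    by_cases hp : s ≤ p.1
    · rw [indicator_of_mem (show p ∈ Ici s ×ˢ univ from ⟨hp, mem_univ _⟩)]
      by_cases h1 : (i.insertNth p.1 p.2 : Fin (m + 1) → ℝ) ∈ minAt m c s i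
      · have h2 := insertNth_mem_minAt.1 h1
        rw [indicator_of_mem h1, indicator_of_mem (insertNth_mem_minAt.2 ⟨mem_interval_coe_left.2
          ⟨hs.trans hp, (mem_interval_coe_left.1 h2.1).2⟩, h2.2⟩)]
      · rw [indicator_of_notMem h1, indicator_of_notMem fun h2 => h1 ?_]
        have h3 := insertNth_mem_minAt.1 h2
        exact insertNth_mem_minAt.2 ⟨mem_interval_coe_left.2 ⟨hp,
          (mem_interval_coe_left.1 h3.1).2⟩, h3.2⟩
    · rw [indicator_of_notMem (fun h : p ∈ Ici s ×ˢ univ => hp h.1), indicator_of_notMem]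
      exact fun h => hp (mem_interval_coe_left.1 (insertNth_mem_minAt.1 h).1).1
  rw [h, integral_prod _ (hi.indicator (measurableSet_Ici.prod MeasurableSet.univ))]
  refine integral_congr_ae (Eventually.of_forall fun x => ?_)
  by_cases hx : x ∈ Ici s
  · simp only [indicator_of_mem hx, minSlice]
    refine integral_congr_ae (Eventually.of_forall fun t => ?_)
    exact indicator_of_mem (show (x, t) ∈ Ici s ×ˢ univ from ⟨hx, mem_univ _⟩) _
  · simp only [indicator_of_notMem hx]
    refine integral_eq_zero_of_ae (Eventually.of_forall fun t => ?_)
    exact indicator_of_notMem (fun h : (x, t) ∈ Ici s ×ˢ univ => hx h.1) _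

lemma continuous_insertNth_left (i : Fin (m + 1)) (t : Fin m → ℝ) :
    Continuous fun x : ℝ => (i.insertNth x t : Fin (m + 1) → ℝ) :=
  Continuous.finInsertNth i continuous_id continuous_const

lemma continuous_insertNth_right (i : Fin (m + 1)) (x : ℝ) :
    Continuous fun t : Fin m → ℝ => (i.insertNth x t : Fin (m + 1) → ℝ) :=
  Continuous.finInsertNth i continuous_const continuous_id

omit [NormedSpace ℝ E] in
-- When no `t j` equals `a`, membership in the region does not change for `x` near `a`. The excluded
-- `t` form a null set.
lemma continuousAt_minAt_indicator (haa : a' < a) (hac : (a : EReal) < c)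
    (hf : ContinuousOn f (cube (m + 1) (interval a' c))) (i : Fin (m + 1)) {t : Fin m → ℝ}
    (ht : ∀ j, t j ≠ a) :
    ContinuousAt (fun x => (minAt m c a' i).indicator f (i.insertNth x t)) a := by
  have hx : ∀ᶠ x : ℝ in 𝓝 a, x ∈ interval a' c := by
    have h1 := (continuous_coe_real_ereal.tendsto a).eventually_lt_const hac
    filter_upwards [eventually_gt_nhds haa, h1] with x h1 h2
    exact mem_interval_coe_left.2 ⟨h1.le, h2.le⟩
  by_cases h : t ∈ cube m (interval a c)
  · have h1 : ∀ᶠ x : ℝ in 𝓝 a, ∀ j, x < t j := by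
      rw [eventually_all]
      exact fun j => eventually_lt_nhds (lt_of_le_of_ne (mem_interval_coe_left.1 (h j)).1
        (ht j).symm)
    have h2 : ∀ᶠ x : ℝ in 𝓝 a, (i.insertNth x t : Fin (m + 1) → ℝ) ∈ minAt m c a' i := by
      filter_upwards [h1, hx] with x h1 h2
      exact insertNth_mem_minAt.2 ⟨h2, fun j => mem_interval_coe_left.2
        ⟨(h1 j).le, (mem_interval_coe_left.1 (h j)).2⟩⟩
    have hsub : minAt m c a' i ⊆ cube (m + 1) (interval a' c) :=
      iUnion_minAt m c a' ▸ subset_iUnion _ i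
    have h3 : Tendsto (fun x : ℝ => (i.insertNth x t : Fin (m + 1) → ℝ)) (𝓝 a)
        (𝓝[cube (m + 1) (interval a' c)] (i.insertNth a t)) :=
      tendsto_nhdsWithin_iff.2 ⟨(continuous_insertNth_left i t).tendsto a,
        h2.mono fun x hx => hsub hx⟩
    have h4 : ContinuousAt (fun x => f (i.insertNth x t)) a :=
      Tendsto.comp (hf _ (hsub h2.self_of_nhds)) h3
    refine h4.congr ?_
    filter_upwards [h2] with x hx
    rw [indicator_of_mem hx]
  · obtain ⟨j, hj⟩ := not_forall.1 h
    rw [mem_interval_coe_left, not_and_or, not_le] at hj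
    have h1 : ∀ᶠ x : ℝ in 𝓝 a, t ∉ cube m (interval x c) := by
      rcases hj with hj | hj
      · filter_upwards [eventually_gt_nhds hj] with x hx h2
        exact absurd (mem_interval_coe_left.1 (h2 j)).1 (not_le.2 hx)
      · exact Eventually.of_forall fun x h2 => hj (mem_interval_coe_left.1 (h2 j)).2
    refine (continuousAt_const (y := (0 : E))).congr ?_
    filter_upwards [h1] with x hx
    rw [indicator_of_notMem fun h => hx (insertNth_mem_minAt.1 h).2]

lemma continuousAt_minSlice (haa : a' < a) (hac : (a : EReal) < c)
    (hf : ContinuousOn f (cube (m + 1) (interval a' c))) {K : ℝ}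
    (hK : ∀ l ∈ cube (m + 1) (interval a' c), ‖f l‖ ≤ K * tailProd l) (i : Fin (m + 1)) :
    ContinuousAt (minSlice c a' f i) a := by
  have hsub : minAt m c a' i ⊆ cube (m + 1) (interval a' c) :=
    iUnion_minAt m c a' ▸ subset_iUnion _ i
  refine continuousAt_of_dominated (bound := fun t => |K| * tailProd t) ?_ ?_ ?_ ?_
  · refine Eventually.of_forall fun x => ?_
    have h1 : MeasurableSet ((fun t : Fin m → ℝ => (i.insertNth x t : Fin (m + 1) → ℝ)) ⁻¹'
        minAt m c a' i) :=
      (continuous_insertNth_right i x).measurable (isClosed_minAt m c a' i).measurableSet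
    have h2 : ContinuousOn (fun t : Fin m → ℝ => f (i.insertNth x t))
        ((fun t : Fin m → ℝ => (i.insertNth x t : Fin (m + 1) → ℝ)) ⁻¹' minAt m c a' i) :=
      (hf.mono hsub).comp (continuous_insertNth_right i x).continuousOn fun t ht => ht
    exact (aestronglyMeasurable_indicator_iff h1).2 (h2.aestronglyMeasurable h1)
  · refine Eventually.of_forall fun x => Eventually.of_forall fun t => ?_
    by_cases h : (i.insertNth x t : Fin (m + 1) → ℝ) ∈ minAt m c a' i
    · rw [indicator_of_mem h]
      refine (hK _ (hsub h)).trans ?_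
      refine (mul_le_mul_of_nonneg_right (le_abs_self K) (tailProd_nonneg _)).trans ?_
      exact mul_le_mul_of_nonneg_left (tailProd_insertNth_le i x t) (abs_nonneg K)
    · rw [indicator_of_notMem h, norm_zero]
      exact mul_nonneg (abs_nonneg K) (tailProd_nonneg t)
  · exact (integrable_tailProd m).const_mul _
  · have h : ∀ᵐ t : Fin m → ℝ, ∀ j, t j ≠ a :=
      ae_all_iff.2 fun j => measure_eq_zero_iff_ae_notMem.1 (volume_setOf_apply_eq j a)
    filter_upwards [h] with t ht
    exact continuousAt_minAt_indicator haa hac hf i ht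

lemma hasDerivAt_integral_Ici [CompleteSpace E] {g : ℝ → E} (hg : Integrable g)
    (hc : ContinuousAt g a) : HasDerivAt (fun s => ∫ x in Ici s, g x) (-g a) a := by
  have h : (fun s => ∫ x in Ici s, g x) = fun s => (∫ x in Ici a, g x) - ∫ x in a..s, g x := by
    funext s
    rw [integral_Ici_eq_integral_Ioi, integral_Ici_eq_integral_Ioi,
      ← intervalIntegral.integral_Ioi_sub_Ioi' hg.integrableOn hg.integrableOn, sub_sub_cancel]
  rw [h]
  exact (intervalIntegral.integral_hasDerivAt_right (by simp)
    (hg.aestronglyMeasurable.stronglyMeasurableAtFilter) hc).const_sub _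

/-- The derivative of an integral over `[s, c]^N` with respect to `s`. -/
theorem hasDerivAt_integral_cube_left [CompleteSpace E] (haa : a' < a) (hac : (a : EReal) < c)
    (hf : ContinuousOn f (cube (m + 1) (interval a' c))) {K : ℝ}
    (hK : ∀ l ∈ cube (m + 1) (interval a' c), ‖f l‖ ≤ K * tailProd l) :
    HasDerivAt (fun s : ℝ => ∫ l in cube (m + 1) (interval s c), f l)
      (-∑ i : Fin (m + 1), ∫ t in cube m (interval a c), f (i.insertNth a t)) a := by
  have hint := integrableOn_of_le_tailProd (isClosed_interval _ _).measurableSet hf hK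
  have h1 : HasDerivAt (fun s : ℝ => ∑ i : Fin (m + 1), ∫ x in Ici s, minSlice c a' f i x)
      (∑ i : Fin (m + 1), -minSlice c a' f i a) a :=
    HasDerivAt.fun_sum fun i _ => hasDerivAt_integral_Ici (integrable_minSlice hint i)
      (continuousAt_minSlice haa hac hf hK i)
  rw [Finset.sum_neg_distrib] at h1
  simp only [minSlice_eq f _ (mem_interval_coe_left.2 ⟨haa.le, hac.le⟩)] at h1
  refine h1.congr_of_eventuallyEq ?_
  filter_upwards [eventually_gt_nhds haa] with s hs
  exact setIntegral_cube_eq_sum hint hs.le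

end Slope

/-! ### The upper end point, by reflection -/

section Reflection

variable {E : Type*} [NormedAddCommGroup E] [NormedSpace ℝ E]

lemma neg_mem_cube_interval {N : ℕ} {b c : EReal} {l : Fin N → ℝ} :
    -l ∈ cube N (interval (-c) (-b)) ↔ l ∈ cube N (interval b c) := by
  simp only [cube, interval, mem_ofPred_eq, Pi.neg_apply, EReal.coe_neg, EReal.neg_le_neg_iff]
  exact forall_congr' fun i => and_comm

lemma setIntegral_cube_neg {N : ℕ} (b c : EReal) (f : (Fin N → ℝ) → E) :
    ∫ l in cube N (interval b c), f l = ∫ l in cube N (interval (-c) (-b)), f (-l) := by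
  rw [← (Measure.measurePreserving_neg (volume : Measure (Fin N → ℝ))).setIntegral_preimage_emb
    (Homeomorph.neg _).measurableEmbedding]
  congr 2
  ext l
  rw [mem_preimage, ← neg_mem_cube_interval, neg_neg]

lemma tailProd_neg {N : ℕ} (l : Fin N → ℝ) : tailProd (-l) = tailProd l := by
  simp [tailProd, logOneAdd]

/-- The derivative of an integral over `[b, s]^N` with respect to `s`. -/
theorem hasDerivAt_integral_cube_right [CompleteSpace E] {m : ℕ} {b : EReal} {a a' : ℝ}
    {f : (Fin (m + 1) → ℝ) → E} (haa : a < a') (hba : b < (a : EReal))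
    (hf : ContinuousOn f (cube (m + 1) (interval b a'))) {K : ℝ}
    (hK : ∀ l ∈ cube (m + 1) (interval b a'), ‖f l‖ ≤ K * tailProd l) :
    HasDerivAt (fun s : ℝ => ∫ l in cube (m + 1) (interval b s), f l)
      (∑ i : Fin (m + 1), ∫ t in cube m (interval b a), f (i.insertNth a t)) a := by
  have hcube : ∀ l ∈ cube (m + 1) (interval (-a' : ℝ) (-b)), -l ∈ cube (m + 1) (interval b a') :=
    fun l hl => by rwa [← neg_mem_cube_interval, neg_neg, ← EReal.coe_neg]
  have h := hasDerivAt_integral_cube_left (f := fun l => f (-l)) (c := -b) (neg_lt_neg haa)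
    (by rwa [EReal.coe_neg, EReal.neg_lt_neg_iff])
    (hf.comp continuous_neg.continuousOn hcube) (K := K) fun l hl => by
      rw [← tailProd_neg]; exact hK _ (hcube l hl)
  have h1 := HasDerivAt.scomp a h (hasDerivAt_neg a)
  have h2 : (fun s : ℝ => ∫ l in cube (m + 1) (interval b s), f l) =
      (fun s : ℝ => ∫ l in cube (m + 1) (interval s (-b)), f (-l)) ∘ Neg.neg := by
    funext s
    simp only [Function.comp, EReal.coe_neg]
    exact setIntegral_cube_neg b s f
  rw [h2]
  convert h1 using 1
  rw [neg_smul, one_smul, neg_neg]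
  refine Finset.sum_congr rfl fun i _ => ?_
  rw [setIntegral_cube_neg, EReal.coe_neg]
  congr 1
  funext t
  congr 1
  rw [Fin.insertNth_eq_iff]
  exact ⟨by simp, by funext j; simp [Fin.removeNth]⟩

end Reflection

end BetaEnsemble

/-! ### Expectations, cumulants and correlators under a moving end point -/

namespace BetaEnsemble

open scoped Topology

lemma isProbabilityMeasure_law {N : ℕ} {β : ℝ} {V : ℝ → ℝ} {A : Set ℝ}
    (hint : IntegrableOn (weight N β V) (cube N A)) (hZ : 0 < partitionFunction N β V A) :
    IsProbabilityMeasure (law N β V A) := by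
  constructor
  unfold law
  rw [withDensity_apply _ MeasurableSet.univ, Measure.restrict_univ,
    ← ofReal_integral_eq_lintegral_ofReal (hint.div_const _)
      (Eventually.of_forall fun l => div_nonneg (weight_nonneg N β V l) hZ.le),
    integral_div]
  change ENNReal.ofReal (partitionFunction N β V A / partitionFunction N β V A) = 1
  rw [div_self hZ.ne', ENNReal.ofReal_one]

lemma integral_law {N : ℕ} {β : ℝ} (hβ : 0 < β) {V : ℝ → ℝ} {A : Set ℝ} (hA : MeasurableSet A)
    (hV : ContinuousOn V A) (φ : (Fin N → ℝ) → ℂ) :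
    ∫ l, φ l ∂law N β V A =
      (∫ l in cube N A, weight N β V l • φ l) / (partitionFunction N β V A : ℂ) := by
  have hZ : 0 ≤ partitionFunction N β V A := integral_nonneg fun l => weight_nonneg N β V l
  have hmeas : AEMeasurable (weight N β V) (volume.restrict (cube N A)) :=
    ((continuousOn_weight N hβ hV).aestronglyMeasurable (measurableSet_cube N hA)).aemeasurable
  unfold law
  rw [integral_withDensity_eq_integral_toReal_smul₀ (hmeas.div_const _).ennreal_ofReal
    (Eventually.of_forall fun l => ENNReal.ofReal_lt_top), ← integral_div]
  refine integral_congr_ae (Eventually.of_forall fun l => ?_)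
  simp only
  rw [ENNReal.toReal_ofReal (div_nonneg (weight_nonneg N β V l) hZ), Complex.real_smul,
    Complex.real_smul, Complex.ofReal_div]
  ring

/-- The integral over `(J s)^N` is differentiable at `s = a` with the boundary term one expects of a
moving end point, for all continuous functions on `B^N` that decay as `∏ᵢ (1 + |lᵢ|)⁻²`. -/
def HasEdgeDerivAt (E : Type*) [NormedAddCommGroup E] [NormedSpace ℝ E] (m : ℕ) (J : ℝ → Set ℝ)
    (σ : ℝ) (B : Set ℝ) (a : ℝ) : Prop :=
  ∀ (f : (Fin (m + 1) → ℝ) → E) (K : ℝ), ContinuousOn f (cube (m + 1) B) →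
    (∀ l ∈ cube (m + 1) B, ‖f l‖ ≤ K * tailProd l) →
    HasDerivAt (fun s : ℝ => ∫ l in cube (m + 1) (J s), f l)
      (σ • ∑ i : Fin (m + 1), ∫ t in cube m (J a), f (i.insertNth a t)) a

section Moments

variable {m : ℕ} {β : ℝ} {V : ℝ → ℝ} {J : ℝ → Set ℝ} {σ a K : ℝ} {B : Set ℝ}

lemma cube_mono {N : ℕ} {A A' : Set ℝ} (h : A ⊆ A') : cube N A ⊆ cube N A' :=
  fun _ hl i => h (hl i)

lemma integrableOn_weight_boundary (hβ : 0 < β) (hV : ContinuousOn V B)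
    (hK : ∀ l ∈ cube (m + 1) B, weight (m + 1) β V l ≤ K * tailProd l) (ha : a ∈ J a)
    (hJ : MeasurableSet (J a)) (hJB : J a ⊆ B) :
    IntegrableOn (fun t => weight (m + 1) β V (Fin.cons a t)) (cube m (J a)) := by
  have hmem : ∀ t ∈ cube m (J a), ((0 : Fin (m + 1)).insertNth a t : Fin (m + 1) → ℝ) ∈
      cube (m + 1) B := fun t ht => (insertNth_mem_cube 0 a t).2 ⟨hJB ha, cube_mono hJB ht⟩
  simp only [← weight_insertNth m β V 0]
  refine integrableOn_of_le_tailProd (K := |K|) hJ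
    ((continuousOn_weight (m + 1) hβ hV).comp (continuous_insertNth_right 0 a).continuousOn hmem)
    fun t ht => ?_
  rw [Real.norm_of_nonneg (weight_nonneg _ _ _ _)]
  refine (hK _ (hmem t ht)).trans ?_
  refine (mul_le_mul_of_nonneg_right (le_abs_self K) (tailProd_nonneg _)).trans ?_
  exact mul_le_mul_of_nonneg_left (tailProd_insertNth_le 0 a t) (abs_nonneg K)

lemma hasDerivAt_partitionFunction (hβ : 0 < β) (hV : ContinuousOn V B)
    (hK : ∀ l ∈ cube (m + 1) B, weight (m + 1) β V l ≤ K * tailProd l)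
    (hD : HasEdgeDerivAt ℝ m J σ B a) :
    HasDerivAt (fun s => partitionFunction (m + 1) β V (J s))
      (σ * (((m + 1 : ℕ) : ℝ) * ∫ t in cube m (J a), weight (m + 1) β V (Fin.cons a t))) a := by
  have h := hD (weight (m + 1) β V) K (continuousOn_weight (m + 1) hβ hV) fun l hl => by
    rw [Real.norm_of_nonneg (weight_nonneg _ _ _ _)]
    exact hK l hl
  simp only [weight_insertNth, Finset.sum_const, Finset.card_univ, Fintype.card_fin, smul_eq_mul,
    nsmul_eq_mul] at h
  exact h

/-- The bound `C` on the larger set `B` serves only for domination. The estimate involves the bound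
`D` on `J a`, so enlarging the domain costs nothing in the constants. -/
lemma exists_hasDerivAt_integral_weight_smul (hβ : 0 < β) (hV : ContinuousOn V B)
    (hK : ∀ l ∈ cube (m + 1) B, weight (m + 1) β V l ≤ K * tailProd l) (ha : a ∈ J a)
    (hJ : MeasurableSet (J a)) (hJB : J a ⊆ B) (hσ : |σ| ≤ 1) (hD : HasEdgeDerivAt ℂ m J σ B a)
    {φ : (Fin (m + 1) → ℝ) → ℂ} (hφ : ContinuousOn φ (cube (m + 1) B)) {C D : ℝ}
    (hC : ∀ l ∈ cube (m + 1) B, ‖φ l‖ ≤ C) (hφD : ∀ l ∈ cube (m + 1) (J a), ‖φ l‖ ≤ D) :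
    ∃ F' : ℂ, HasDerivAt (fun s => ∫ l in cube (m + 1) (J s), weight (m + 1) β V l • φ l) F' a ∧
      ‖F'‖ ≤ (((m + 1 : ℕ) : ℝ) * ∫ t in cube m (J a), weight (m + 1) β V (Fin.cons a t)) * D := by
  refine ⟨_, hD (fun l => weight (m + 1) β V l • φ l) (K * C)
    ((continuousOn_weight (m + 1) hβ hV).smul hφ) (fun l hl => ?_), ?_⟩
  · rw [norm_smul, Real.norm_of_nonneg (weight_nonneg _ _ _ _), mul_right_comm]
    exact mul_le_mul (hK l hl) (hC l hl) (norm_nonneg _)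
      ((weight_nonneg _ _ _ _).trans (hK l hl))
  · have hg := (integrableOn_weight_boundary hβ hV hK ha hJ hJB).mul_const D
    have h1 : ∀ i : Fin (m + 1), ‖∫ t in cube m (J a), weight (m + 1) β V (i.insertNth a t) •
        φ (i.insertNth a t)‖ ≤
        (∫ t in cube m (J a), weight (m + 1) β V (Fin.cons a t)) * D := fun i => by
      rw [← integral_mul_const]
      refine norm_integral_le_of_norm_le hg ?_
      rw [ae_restrict_iff' (measurableSet_cube m hJ)]
      refine Eventually.of_forall fun t ht => ?_
      rw [norm_smul, Real.norm_of_nonneg (weight_nonneg _ _ _ _), weight_insertNth]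
      exact mul_le_mul_of_nonneg_left (hφD _ ((insertNth_mem_cube i a t).2 ⟨ha, ht⟩))
        (weight_nonneg _ _ _ _)
    have h2 := norm_sum_le_of_le Finset.univ fun i _ => h1 i
    rw [norm_smul, Real.norm_eq_abs]
    refine (mul_le_of_le_one_left (norm_nonneg _) hσ).trans (h2.trans (le_of_eq ?_))
    simp [mul_assoc]

lemma norm_integral_weight_smul_le {N : ℕ} {A : Set ℝ} (hA : MeasurableSet A)
    (hint : IntegrableOn (weight N β V) (cube N A)) {φ : (Fin N → ℝ) → ℂ} {D : ℝ}
    (hφ : ∀ l ∈ cube N A, ‖φ l‖ ≤ D) :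
    ‖∫ l in cube N A, weight N β V l • φ l‖ ≤ partitionFunction N β V A * D := by
  unfold partitionFunction
  rw [← integral_mul_const]
  refine norm_integral_le_of_norm_le (hint.mul_const D) ?_
  rw [ae_restrict_iff' (measurableSet_cube N hA)]
  refine Eventually.of_forall fun l hl => ?_
  rw [norm_smul, Real.norm_of_nonneg (weight_nonneg _ _ _ _)]
  exact mul_le_mul_of_nonneg_left (hφ l hl) (weight_nonneg _ _ _ _)

lemma integrableOn_weight_of_le (hβ : 0 < β) {N : ℕ} {A : Set ℝ} (hA : MeasurableSet A)
    (hV : ContinuousOn V A) (hK : ∀ l ∈ cube N A, weight N β V l ≤ K * tailProd l) :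
    IntegrableOn (weight N β V) (cube N A) :=
  integrableOn_of_le_tailProd hA (continuousOn_weight N hβ hV) fun l hl => by
    rw [Real.norm_of_nonneg (weight_nonneg _ _ _ _)]
    exact hK l hl

/-- Expectations of bounded observables hardly depend on the end point. -/
lemma exists_hasDerivAt_integral_law (hβ : 0 < β) (hV : ContinuousOn V B)
    (hK : ∀ l ∈ cube (m + 1) B, weight (m + 1) β V l ≤ K * tailProd l) (ha : a ∈ J a)
    (hJ : ∀ s, MeasurableSet (J s)) (hJB : ∀ᶠ s in 𝓝 a, J s ⊆ B) (hσ : |σ| ≤ 1)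
    (hDR : HasEdgeDerivAt ℝ m J σ B a) (hDC : HasEdgeDerivAt ℂ m J σ B a)
    (hZ : 0 < partitionFunction (m + 1) β V (J a)) {ρ : ℝ}
    (hρ : (((m + 1 : ℕ) : ℝ) * ∫ t in cube m (J a), weight (m + 1) β V (Fin.cons a t)) ≤
      ρ * partitionFunction (m + 1) β V (J a))
    {φ : (Fin (m + 1) → ℝ) → ℂ} (hφ : ContinuousOn φ (cube (m + 1) B)) {C D : ℝ} (hD0 : 0 ≤ D)
    (hC : ∀ l ∈ cube (m + 1) B, ‖φ l‖ ≤ C) (hφD : ∀ l ∈ cube (m + 1) (J a), ‖φ l‖ ≤ D) :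
    ‖∫ l, φ l ∂law (m + 1) β V (J a)‖ ≤ D ∧
    ∃ M' : ℂ, HasDerivAt (fun s => ∫ l, φ l ∂law (m + 1) β V (J s)) M' a ∧
      ‖M'‖ ≤ 2 * ρ * D := by
  have hJa := hJB.self_of_nhds
  set Z := fun s => partitionFunction (m + 1) β V (J s) with hZdef
  set F := fun s => ∫ l in cube (m + 1) (J s), weight (m + 1) β V l • φ l with hFdef
  set g := ((m + 1 : ℕ) : ℝ) * ∫ t in cube m (J a), weight (m + 1) β V (Fin.cons a t) with hg
  have hg0 : 0 ≤ g := mul_nonneg (Nat.cast_nonneg _)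
    (integral_nonneg fun t => weight_nonneg _ _ _ _)
  change 0 < Z a at hZ
  change g ≤ ρ * Z a at hρ
  have hint := integrableOn_weight_of_le hβ (hJ a) (hV.mono hJa)
    fun l hl => hK l (cube_mono hJa hl)
  have hFle : ‖F a‖ ≤ Z a * D := norm_integral_weight_smul_le (hJ a) hint hφD
  have hlaw : ∀ᶠ s in 𝓝 a, ∫ l, φ l ∂law (m + 1) β V (J s) = F s / (Z s : ℂ) := by
    filter_upwards [hJB] with s hs
    exact integral_law hβ (hJ s) (hV.mono hs) φ
  have hnZ : ‖(Z a : ℂ)‖ = Z a := by rw [Complex.norm_real, Real.norm_of_nonneg hZ.le]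
  refine ⟨?_, ?_⟩
  · rw [hlaw.self_of_nhds, norm_div, hnZ, div_le_iff₀ hZ, mul_comm]
    exact hFle
  · obtain ⟨F', hF', hF'le⟩ := exists_hasDerivAt_integral_weight_smul hβ hV hK ha (hJ a) hJa hσ hDC
      hφ hC hφD
    have hZ' : HasDerivAt Z (σ * g) a := hasDerivAt_partitionFunction hβ hV hK hDR
    have hZ0 : (Z a : ℂ) ≠ 0 := by exact_mod_cast hZ.ne'
    -- Quotient rule: each of the two terms of the numerator is at most `ρ D Z²`, whence the factor
    -- `2`.
    refine ⟨_, (hF'.fun_div hZ'.ofReal_comp hZ0).congr_of_eventuallyEq hlaw, ?_⟩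
    rw [norm_div, norm_pow, hnZ, div_le_iff₀ (by positivity)]
    have hσg : |σ * g| ≤ g := by
      rw [abs_mul, abs_of_nonneg hg0]
      exact mul_le_of_le_one_left hg0 hσ
    have h1 : ‖F' * (Z a : ℂ)‖ ≤ g * D * Z a := by
      rw [norm_mul, hnZ]
      exact mul_le_mul_of_nonneg_right hF'le hZ.le
    have h2 : ‖F a * ((σ * g : ℝ) : ℂ)‖ ≤ Z a * D * g := by
      rw [norm_mul, Complex.norm_real, Real.norm_eq_abs]
      exact mul_le_mul hFle hσg (abs_nonneg _) (by positivity)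
    have h3 : g * (D * Z a) ≤ ρ * Z a * (D * Z a) :=
      mul_le_mul_of_nonneg_right hρ (by positivity)
    calc _ ≤ _ := norm_sub_le _ _
      _ ≤ g * D * Z a + Z a * D * g := add_le_add h1 h2
      _ = 2 * (g * (D * Z a)) := by ring
      _ ≤ 2 * (ρ * Z a * (D * Z a)) := by linarith
      _ = _ := by ring

end Moments

section Cumulant

/-- The constant in `exists_hasDerivAt_jointCumulant`, which depends only on the number of variables. -/
noncomputable def cumulantBound (n : ℕ) : ℝ :=
  -- The sum vanishes for `n = 0`, so the added `1` is what makes the constant positive for every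
  -- `n`.
  1 + ∑ π : Finpartition (Finset.univ : Finset (Fin n)),
    ((π.parts.card - 1).factorial : ℝ) * (π.parts.card * 2)

lemma cumulantBound_pos (n : ℕ) : 0 < cumulantBound n :=
  add_pos_of_pos_of_nonneg one_pos (Finset.sum_nonneg fun _ _ => by positivity)

lemma prod_parts_prod {n : ℕ} (π : Finpartition (Finset.univ : Finset (Fin n))) (D : Fin n → ℝ) :
    ∏ B ∈ π.parts, ∏ i ∈ B, D i = ∏ i, D i := by
  have h := Finset.prod_biUnion (t := id) (f := D) π.disjoint
  rw [π.biUnion_parts] at h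
  exact h.symm

/-- Leibniz' rule. The moment of a block is bounded by the product of `D` over the block, and the
blocks partition the indices; so each term of the derivative is at most `2 ρ ∏ D`, times the
combinatorial coefficient. -/
lemma exists_hasDerivAt_jointCumulant {Ω : Type*} [MeasurableSpace Ω] {P : ℝ → Measure Ω} {n : ℕ}
    {X : Fin n → Ω → ℂ} {D : Fin n → ℝ} (hD : ∀ i, 0 ≤ D i) {a ρ : ℝ} (hρ : 0 ≤ ρ)
    (hM : ∀ B : Finset (Fin n), ‖∫ ω, ∏ i ∈ B, X i ω ∂P a‖ ≤ ∏ i ∈ B, D i ∧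
      ∃ M' : ℂ, HasDerivAt (fun s => ∫ ω, ∏ i ∈ B, X i ω ∂P s) M' a ∧
        ‖M'‖ ≤ 2 * ρ * ∏ i ∈ B, D i) :
    ∃ c' : ℂ, HasDerivAt (fun s => jointCumulant (P s) X) c' a ∧
      ‖c'‖ ≤ cumulantBound n * (ρ * ∏ i, D i) := by
  choose h0 M' hM' hle using hM
  have hDn : ∀ B : Finset (Fin n), 0 ≤ ∏ i ∈ B, D i := fun B => Finset.prod_nonneg fun i _ => hD i
  refine ⟨_, HasDerivAt.fun_sum fun π _ =>
    (HasDerivAt.fun_finsetProd fun B _ => hM' B).const_mul _, ?_⟩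
  have hsum : ∀ π : Finpartition (Finset.univ : Finset (Fin n)),
      ‖(-1 : ℂ) ^ (π.parts.card - 1) * ((π.parts.card - 1).factorial : ℂ) *
        ∑ B ∈ π.parts, (∏ B' ∈ π.parts.erase B, ∫ ω, ∏ i ∈ B', X i ω ∂P a) • M' B‖ ≤
      ((π.parts.card - 1).factorial : ℝ) * (π.parts.card * 2) * (ρ * ∏ i, D i) := fun π => by
    have h1 : ∀ B ∈ π.parts, ‖(∏ B' ∈ π.parts.erase B, ∫ ω, ∏ i ∈ B', X i ω ∂P a) • M' B‖ ≤
        2 * (ρ * ∏ i, D i) := fun B hB => by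
      rw [norm_smul, norm_prod, ← prod_parts_prod π D, ← Finset.prod_erase_mul _ _ hB]
      calc _ ≤ (∏ B' ∈ π.parts.erase B, ∏ i ∈ B', D i) * (2 * ρ * ∏ i ∈ B, D i) :=
            mul_le_mul (Finset.prod_le_prod (fun _ _ => norm_nonneg _) fun B' _ => h0 B') (hle B)
              (norm_nonneg _) (Finset.prod_nonneg fun B' _ => hDn B')
        _ = _ := by ring
    have h2 := norm_sum_le_of_le _ h1
    rw [Finset.sum_const, nsmul_eq_mul] at h2
    rw [norm_mul, norm_mul, norm_pow, norm_neg, norm_one, one_pow, one_mul, Complex.norm_natCast,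
      mul_assoc]
    refine mul_le_mul_of_nonneg_left (h2.trans (le_of_eq (by ring))) (by positivity)
  refine (norm_sum_le_of_le _ fun π _ => hsum π).trans ?_
  rw [← Finset.sum_mul]
  exact mul_le_mul_of_nonneg_right (le_add_of_nonneg_left zero_le_one)
    (mul_nonneg hρ (hDn _))

end Cumulant

section Stieltjes

lemma isClosed_complexSet {I : Set ℝ} (hI : IsClosed I) : IsClosed (complexSet I) :=
  Complex.isometry_ofReal.isClosedEmbedding.isClosedMap I hI

lemma norm_stieltjes_le {N : ℕ} {x : ℂ} {A : Set ℝ} {d : ℝ} (hd : 0 < d)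
    (h : ∀ t ∈ A, d ≤ dist x (t : ℂ)) {l : Fin N → ℝ} (hl : l ∈ cube N A) :
    ‖stieltjes x l‖ ≤ N / d := by
  unfold stieltjes
  have h1 : ∀ i ∈ (Finset.univ : Finset (Fin N)), ‖(x - (l i : ℂ))⁻¹‖ ≤ d⁻¹ := fun i _ => by
    rw [norm_inv, ← dist_eq_norm]
    exact inv_anti₀ hd (h _ (hl i))
  refine (norm_sum_le_of_le _ h1).trans (le_of_eq ?_)
  simp [div_eq_mul_inv]

lemma continuousOn_stieltjes {N : ℕ} {x : ℂ} {A : Set ℝ} {d : ℝ} (hd : 0 < d)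
    (h : ∀ t ∈ A, d ≤ dist x (t : ℂ)) : ContinuousOn (stieltjes (N := N) x) (cube N A) := by
  unfold stieltjes
  refine continuousOn_finsetSum _ fun i _ => ContinuousOn.inv₀ (by fun_prop) fun l hl h0 => ?_
  have := h _ (hl i)
  rw [dist_eq_norm, h0, norm_zero] at this
  linarith

end Stieltjes

/-- Weak dependence on a moving end point, given that the boundary term is small compared to the
partition function. -/
theorem edge_dependence {m : ℕ} {β : ℝ} {V : ℝ → ℝ} {J : ℝ → Set ℝ} {σ a K ρ : ℝ} {I : Set ℝ}
    (hβ : 0 < β) (hV : ContinuousOn V I)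
    (hK : ∀ l ∈ cube (m + 1) I, weight (m + 1) β V l ≤ K * tailProd l) (ha : a ∈ J a)
    (hJ : ∀ s, IsClosed (J s)) (hσ : |σ| ≤ 1)
    (hB : ∀ δ : ℝ, 0 < δ → ∃ B ⊆ I, (∀ᶠ s in 𝓝 a, J s ⊆ B) ∧
      (∀ t ∈ B, ∃ u ∈ J a, |t - u| ≤ δ) ∧
      HasEdgeDerivAt ℝ m J σ B a ∧ HasEdgeDerivAt ℂ m J σ B a)
    (hZ : 0 < partitionFunction (m + 1) β V (J a)) (hρ0 : 0 ≤ ρ)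
    (hρ : (((m + 1 : ℕ) : ℝ) * ∫ t in cube m (J a), weight (m + 1) β V (Fin.cons a t)) ≤
      ρ * partitionFunction (m + 1) β V (J a)) :
    IsProbabilityMeasure (law (m + 1) β V (J a)) ∧
    DifferentiableAt ℝ (fun s : ℝ => Real.log (partitionFunction (m + 1) β V (J s))) a ∧
    |deriv (fun s : ℝ => Real.log (partitionFunction (m + 1) β V (J s))) a| ≤ ρ ∧
    ∀ (n : ℕ) (x : Fin n → ℂ), (∀ i, x i ∉ complexSet (J a)) →
      DifferentiableAt ℝ (fun s : ℝ => correlator (m + 1) β V (J s) x) a ∧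
      ‖deriv (fun s : ℝ => correlator (m + 1) β V (J s) x) a‖
        ≤ cumulantBound n * ((m + 1 : ℕ) : ℝ) ^ n /
          (∏ i, Metric.infDist (x i) (complexSet (J a))) * ρ := by
  have hmeas : ∀ s, MeasurableSet (J s) := fun s => (hJ s).measurableSet
  set g := ((m + 1 : ℕ) : ℝ) * ∫ t in cube m (J a), weight (m + 1) β V (Fin.cons a t) with hg
  have hg0 : 0 ≤ g := mul_nonneg (Nat.cast_nonneg _)
    (integral_nonneg fun t => weight_nonneg _ _ _ _)
  obtain ⟨B, hBI, hJB, -, hDR, -⟩ := hB 1 one_pos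
  have hJI : J a ⊆ I := hJB.self_of_nhds.trans hBI
  have hlog := (hasDerivAt_partitionFunction hβ (hV.mono hBI)
    (fun l hl => hK l (cube_mono hBI hl)) hDR).log hZ.ne'
  refine ⟨isProbabilityMeasure_law (integrableOn_weight_of_le hβ (hmeas a) (hV.mono hJI)
    fun l hl => hK l (cube_mono hJI hl)) hZ, hlog.differentiableAt, ?_, ?_⟩
  · rw [hlog.deriv, abs_div, abs_of_pos hZ, div_le_iff₀ hZ]
    change |σ * g| ≤ _
    rw [abs_mul, abs_of_nonneg hg0]
    exact (mul_le_of_le_one_left hg0 hσ).trans hρ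
  intro n x hx
  set d : Fin n → ℝ := fun i => Metric.infDist (x i) (complexSet (J a)) with hd
  have hd0 : ∀ i, 0 < d i := fun i =>
    ((isClosed_complexSet (hJ a)).notMem_iff_infDist_pos ⟨_, a, ha, rfl⟩).1 (hx i)
  -- With this `δ` the points `x i` stay at distance at least `d i / 2` from `B`, so the Stieltjes
  -- transforms are continuous and bounded there.
  have hδ : ∃ δ : ℝ, 0 < δ ∧ ∀ i, δ ≤ d i / 2 := by
    rcases isEmpty_or_nonempty (Fin n) with h | h
    · exact ⟨1, one_pos, fun i => h.elim i⟩
    · obtain ⟨i, hi⟩ := Finite.exists_min d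
      exact ⟨d i / 2, half_pos (hd0 i), fun j => by linarith [hi j]⟩
  obtain ⟨δ, hδ0, hδ⟩ := hδ
  obtain ⟨B, hBI, hJB, hnear, hDR, hDC⟩ := hB δ hδ0
  have hdJ : ∀ i, ∀ t ∈ J a, d i ≤ dist (x i) (t : ℂ) := fun i t ht =>
    Metric.infDist_le_dist_of_mem ⟨t, ht, rfl⟩
  have hdB : ∀ i, ∀ t ∈ B, d i / 2 ≤ dist (x i) (t : ℂ) := fun i t ht => by
    obtain ⟨u, hu, htu⟩ := hnear t ht
    have h1 := dist_triangle (x i) (t : ℂ) (u : ℂ)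
    rw [Complex.isometry_ofReal.dist_eq t u, Real.dist_eq] at h1
    linarith [hdJ i u hu, hδ i]
  have hDn : ∀ (S : Finset (Fin n)) (e : ℝ → ℝ), (∀ r, 0 < r → 0 < e r) →
      0 ≤ ∏ i ∈ S, (((m + 1 : ℕ) : ℝ) / e (d i)) := fun S e he =>
    Finset.prod_nonneg fun i _ => div_nonneg (Nat.cast_nonneg _) (he _ (hd0 i)).le
  have hmom : ∀ S : Finset (Fin n),
      ‖∫ l, ∏ i ∈ S, stieltjes (x i) l ∂law (m + 1) β V (J a)‖ ≤
        ∏ i ∈ S, (((m + 1 : ℕ) : ℝ) / d i) ∧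
      ∃ M' : ℂ, HasDerivAt
        (fun s => ∫ l, ∏ i ∈ S, stieltjes (x i) l ∂law (m + 1) β V (J s)) M' a ∧
        ‖M'‖ ≤ 2 * ρ * ∏ i ∈ S, (((m + 1 : ℕ) : ℝ) / d i) := fun S => by
    refine exists_hasDerivAt_integral_law hβ (hV.mono hBI) (fun l hl => hK l (cube_mono hBI hl)) ha
      hmeas hJB hσ hDR hDC hZ hρ
      (continuousOn_finsetProd _ fun i _ => continuousOn_stieltjes (half_pos (hd0 i)) (hdB i))
      (C := ∏ i ∈ S, (((m + 1 : ℕ) : ℝ) / (d i / 2))) (hDn S id fun _ h => h) ?_ ?_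
    · intro l hl
      rw [norm_prod]
      exact Finset.prod_le_prod (fun _ _ => norm_nonneg _) fun i _ =>
        norm_stieltjes_le (half_pos (hd0 i)) (hdB i) hl
    · intro l hl
      rw [norm_prod]
      exact Finset.prod_le_prod (fun _ _ => norm_nonneg _) fun i _ =>
        norm_stieltjes_le (hd0 i) (hdJ i) hl
  obtain ⟨c', hc', hc'le⟩ := exists_hasDerivAt_jointCumulant
    (P := fun s => law (m + 1) β V (J s)) (X := fun i => stieltjes (x i))
    (D := fun i => ((m + 1 : ℕ) : ℝ) / d i) (fun i => div_nonneg (Nat.cast_nonneg _) (hd0 i).le) hρ0 hmom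
  have hc : HasDerivAt (fun s : ℝ => correlator (m + 1) β V (J s) x) c' a := hc'
  refine ⟨hc.differentiableAt, ?_⟩
  rw [hc.deriv]
  refine hc'le.trans (le_of_eq ?_)
  rw [Finset.prod_div_distrib, Finset.prod_const, Finset.card_univ, Fintype.card_fin]
  ring

end BetaEnsemble

/-! ### The two edges and the conclusion -/

namespace BetaEnsemble

open scoped Topology

section Edges

variable {m : ℕ} {bm bp : EReal} {a δ : ℝ}

/-- The set `B` is `[a', b₊]` with `a'` slightly below `a` and above `b₋`: derivatives need room on
both sides of `a`. The sign is `-1` because raising the lower end removes mass. -/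
lemma exists_lower_neighbourhood (hba : bm < (a : EReal)) (hac : (a : EReal) < bp) (hδ : 0 < δ) :
    ∃ B ⊆ interval bm bp, (∀ᶠ s : ℝ in 𝓝 a, interval s bp ⊆ B) ∧
      (∀ t ∈ B, ∃ u ∈ interval a bp, |t - u| ≤ δ) ∧
      HasEdgeDerivAt ℝ m (fun s => interval s bp) (-1) B a ∧
      HasEdgeDerivAt ℂ m (fun s => interval s bp) (-1) B a := by
  obtain ⟨a', h1, h2⟩ := EReal.lt_iff_exists_real_btwn.1
    (max_lt hba (EReal.coe_lt_coe_iff.2 (sub_lt_self a hδ)))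
  rw [EReal.coe_lt_coe_iff] at h2
  obtain ⟨hb, hd⟩ := max_lt_iff.1 h1
  rw [EReal.coe_lt_coe_iff] at hd
  refine ⟨interval a' bp, fun t ht => ⟨hb.le.trans ht.1, ht.2⟩, ?_, ?_, ?_, ?_⟩
  · filter_upwards [eventually_gt_nhds h2] with s hs t ht
    rw [mem_interval_coe_left] at ht ⊢
    exact ⟨hs.le.trans ht.1, ht.2⟩
  · intro t ht
    rw [mem_interval_coe_left] at ht
    rcases le_total a t with h | h
    · exact ⟨t, mem_interval_coe_left.2 ⟨h, ht.2⟩, by simpa using hδ.le⟩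
    · refine ⟨a, mem_interval_coe_left.2 ⟨le_rfl, hac.le⟩, ?_⟩
      rw [abs_sub_comm, abs_of_nonneg (sub_nonneg.2 h)]
      linarith [ht.1]
  all_goals
    intro f K hf hK
    rw [neg_one_smul]
    exact hasDerivAt_integral_cube_left h2 hac hf hK

lemma exists_upper_neighbourhood (hba : bm < (a : EReal)) (hac : (a : EReal) < bp) (hδ : 0 < δ) :
    ∃ B ⊆ interval bm bp, (∀ᶠ s : ℝ in 𝓝 a, interval bm s ⊆ B) ∧
      (∀ t ∈ B, ∃ u ∈ interval bm a, |t - u| ≤ δ) ∧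
      HasEdgeDerivAt ℝ m (fun s => interval bm s) 1 B a ∧
      HasEdgeDerivAt ℂ m (fun s => interval bm s) 1 B a := by
  obtain ⟨a', h2, h1⟩ := EReal.lt_iff_exists_real_btwn.1
    (lt_min hac (EReal.coe_lt_coe_iff.2 (lt_add_of_pos_right a hδ)))
  rw [EReal.coe_lt_coe_iff] at h2
  obtain ⟨hb, hd⟩ := lt_min_iff.1 h1
  rw [EReal.coe_lt_coe_iff] at hd
  refine ⟨interval bm a', fun t ht => ⟨ht.1, ht.2.trans hb.le⟩, ?_, ?_, ?_, ?_⟩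
  · filter_upwards [eventually_lt_nhds h2] with s hs t ht
    rw [mem_interval_coe_right] at ht ⊢
    exact ⟨ht.1, ht.2.trans hs.le⟩
  · intro t ht
    rw [mem_interval_coe_right] at ht
    rcases le_total t a with h | h
    · exact ⟨t, mem_interval_coe_right.2 ⟨ht.1, h⟩, by simpa using hδ.le⟩
    · refine ⟨a, mem_interval_coe_right.2 ⟨hba.le, le_rfl⟩, ?_⟩
      rw [abs_of_nonneg (sub_nonneg.2 h)]
      linarith [ht.2]
  all_goals
    intro f K hf hK
    rw [one_smul]
    exact hasDerivAt_integral_cube_right h2 hba hf hK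

end Edges

end BetaEnsemble

open BetaEnsemble in
theorem mainTheorem7 :
    ∃ γ : ℕ → ℝ, (∀ n, 0 < γ n) ∧
      ∀ (β : ℝ) (_ : 0 < β) (bm bp : EReal) (_ : bm < bp) (V : ℝ → ℝ) (_ : IsConfining V bm bp)
        (μeq : Measure ℝ) (_ : IsEquilibriumMeasure V (interval bm bp) μeq)
        (_ : ∀ x ∈ interval bm bp, IsMinOn (rate V μeq) (interval bm bp) x →
          x ∈ Set.Icc (leftEnd μeq) (rightEnd μeq))
        (ε : ℝ) (_ : 0 < ε),
        ∃ η : ℝ, 0 < η ∧ ∃ N₀ : ℕ, ∀ N : ℕ, N₀ ≤ N →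
          (∀ a : ℝ, bm < (a : EReal) → a < leftEnd μeq - ε →
            IsProbabilityMeasure (law N β V (interval a bp)) ∧
            DifferentiableAt ℝ (fun s : ℝ => Real.log (partitionFunction N β V (interval s bp))) a ∧
            |deriv (fun s : ℝ => Real.log (partitionFunction N β V (interval s bp))) a|
              ≤ Real.exp (-(N * η)) ∧
            ∀ n : ℕ, 1 ≤ n → ∀ x : Fin n → ℂ, (∀ i, x i ∉ complexSet (interval a bp)) →
              DifferentiableAt ℝ (fun s : ℝ => correlator N β V (interval s bp) x) a ∧
              ‖deriv (fun s : ℝ => correlator N β V (interval s bp) x) a‖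
                ≤ γ n * (N : ℝ) ^ n / (∏ i, Metric.infDist (x i) (complexSet (interval a bp)))
                  * Real.exp (-(N * η))) ∧
          (∀ a : ℝ, rightEnd μeq + ε < a → (a : EReal) < bp →
            IsProbabilityMeasure (law N β V (interval bm a)) ∧
            DifferentiableAt ℝ (fun s : ℝ => Real.log (partitionFunction N β V (interval bm s))) a ∧
            |deriv (fun s : ℝ => Real.log (partitionFunction N β V (interval bm s))) a|
              ≤ Real.exp (-(N * η)) ∧
            ∀ n : ℕ, 1 ≤ n → ∀ x : Fin n → ℂ, (∀ i, x i ∉ complexSet (interval bm a)) →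
              DifferentiableAt ℝ (fun s : ℝ => correlator N β V (interval bm s) x) a ∧
              ‖deriv (fun s : ℝ => correlator N β V (interval bm s) x) a‖
                ≤ γ n * (N : ℝ) ^ n / (∏ i, Metric.infDist (x i) (complexSet (interval bm a)))
                  * Real.exp (-(N * η))) := by
  refine ⟨cumulantBound, cumulantBound_pos, ?_⟩
  intro β hβ bm bp hbm V hV μ hμ hmin ε hε
  obtain ⟨η, hη, N₀, h⟩ := exists_edge_bound hbm hV hμ hmin hβ hε
  -- The shift by one ensures `N ≥ 1`, so that `N = m + 1`.
  refine ⟨η, hη, N₀ + 1, fun N hN => ?_⟩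
  obtain ⟨m, rfl⟩ : ∃ m, N = m + 1 := ⟨N - 1, by omega⟩
  obtain ⟨⟨K, hK⟩, hA⟩ := h m (by omega)
  have hlr := leftEnd_lt_rightEnd hbm hV hμ
  have hsub := Icc_subset_interval hbm hV hμ
  have hl := hsub (left_mem_Icc.2 hlr.le)
  have hr := hsub (right_mem_Icc.2 hlr.le)
  refine ⟨fun a hba hal => ?_, fun a har hab => ?_⟩
  · have hab : (a : EReal) < bp :=
      (EReal.coe_lt_coe_iff.2 (by linarith : a < leftEnd μ)).trans_le hl.2
    obtain ⟨hZ, hb⟩ := hA (interval a bp) (isClosed_interval _ _).measurableSet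
      (fun t ht => ⟨hba.le.trans ht.1, ht.2⟩)
      (fun t ht => mem_interval_coe_left.2 ⟨by linarith [ht.1], (hsub ht).2⟩)
    obtain ⟨h1, h2, h3, h4⟩ := edge_dependence (J := fun s => interval s bp) hβ hV.continuousOn hK
      (mem_interval_coe_left.2 ⟨le_rfl, hab.le⟩) (fun s => isClosed_interval _ _)
      (by norm_num) (fun δ hδ => exists_lower_neighbourhood hba hab hδ) hZ (Real.exp_pos _).le
      (hb a ⟨⟨hba.le, hab.le⟩, fun h => absurd h.1 (by linarith)⟩)
    exact ⟨h1, h2, h3, fun n _ x hx => h4 n x hx⟩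
  · have hba : bm < (a : EReal) :=
      hr.1.trans_lt (EReal.coe_lt_coe_iff.2 (by linarith : rightEnd μ < a))
    obtain ⟨hZ, hb⟩ := hA (interval bm a) (isClosed_interval _ _).measurableSet
      (fun t ht => ⟨ht.1, ht.2.trans hab.le⟩)
      (fun t ht => mem_interval_coe_right.2 ⟨(hsub ht).1, by linarith [ht.2]⟩)
    obtain ⟨h1, h2, h3, h4⟩ := edge_dependence (J := fun s => interval bm s) hβ hV.continuousOn hK
      (mem_interval_coe_right.2 ⟨hba.le, le_rfl⟩) (fun s => isClosed_interval _ _)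
      (by norm_num) (fun δ hδ => exists_upper_neighbourhood hba hab hδ) hZ (Real.exp_pos _).le
      (hb a ⟨⟨hba.le, hab.le⟩, fun h => absurd h.2 (by linarith)⟩)
    exact ⟨h1, h2, h3, fun n _ x hx => h4 n x hx⟩
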